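/- **Setting.** Let $X_1,X_2,\dots$ be i.i.d. with law $P=P_{\theta_0,\eta_0}$, where $\{P_{\theta,\eta}:\theta\in\Theta\subset\mathbb R^d,\ \eta\in\mathcal H\}$ is a semiparametric model with densities $\mathrm{lik}(\theta,\eta)$ with respect to a $\sigma$-finite measure $\mu$, and $\mathcal H$ is a subset of a (semi)normed space. Put $\mathrm{lik}_n(\theta,\eta)=\prod_{i\le n}\mathrm{lik}(\theta,\eta)(X_i)$ and $pl_n(\theta)=\sup_{\eta\in\mathcal H}\mathrm{lik}_n(\theta,\eta)$. Assume that, almost surely, for each $\theta\in\Theta$ the supremum is attained at some $\hat\eta_\theta=\hat\eta_{\theta,n}\in\mathcal H$, and that $pl_n$ attains its maximum over $\Theta$ at $\hat\theta_n$ and is Lebesgue measurable in $\theta$. Write $\mathbb P_n$ for the empirical measure, $\mathbb G_n=\sqrt n(\mathbb P_n-P)$, and $M_n(r)=n^{-1/2}+n^{-2r+1/2}$. "Random sequence in $\Theta$" means any maps $\tilde\theta_n$ from the underlying probability space to $\Theta$; $o_P$, $O_P$ and convergence in probability are understood in outer probability. Let $r>1/4$ be such that $\|\hat\eta_{\tilde\theta_n}-\eta_0\|=O_P(\|\tilde\theta_n-\theta_0\|+n^{-r})$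 for every random sequence $\tilde\theta_n\to\theta_0$ in probability in $\Theta$. Let $\eta_t(\theta,\eta)$ be a map such that $t\mapsto \mathrm{lik}(t,\eta_t(\theta,\eta))$ is a least favorable submodel at $(\theta_0,\eta_0)$; write $\ell(t,\theta,\eta)=\log\mathrm{lik}(t,\eta_t(\theta,\eta))$, and $\dot\ell,\ddot\ell,\ell^{(3)}$ for its derivatives in $t$, $\ell_{t,\theta}$ for the derivative of $\dot\ell$ in $\theta$, $\dot\ell_0=\dot\ell(\theta_0,\theta_0,\eta_0)$. Least favorable means $\dot\ell_0=\tilde\ell_0$ $P$-a.s., where the efficient score $\tilde\ell_0$ is the $\theta$-score $\partial_\theta\log\mathrm{lik}(\theta,\eta_0)|_{\theta=\theta_0}$ (assumed in $L_2(P)$) minus its $L_2(P)$-projection on the closed linear span of the nuisance scores $\partial_s|_{s=0}\log\mathrm{lik}(\theta_0,\gamma_s)\in L_2^0(P)$, $\gamma$ running through some index set of paths in $\mathcal H$ with $\gamma_s\to\gamma_0=\eta_0$. Let $\tilde I_0=P\tilde\ell_0\tilde\ell_0^T$. **Assumptions.** - (A1) $\Theta$ is compact and $\theta_0$ is an interior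 point of $\Theta$. - (A2) $\eta_\theta(\theta,\eta)=\eta$ for all $(\theta,\eta)\in\Theta\times\mathcal H$. - (A3) $\tilde I_0$ is positive definite. - (B1) On a neighbourhood of $(\theta_0,\theta_0,\eta_0)$, $\eta_t(\theta,\eta)\in\mathcal H$, and for $P$-almost every $x$ the function $\ell$ is finite and differentiable in $t$, with $\dot\ell$ of class $C^2$ in $(t,\theta)$; the derivatives $\partial_t^l\partial_\theta^m\ell$ with $(l,m)=(0,0),(1,0),(2,0),(3,0),(1,1),(1,2),(2,1)$ have an envelope function in $L_1(P)$. - (B2) $\mathbb G_n(\dot\ell(\theta_0,\theta_0,\hat\eta_{\tilde\theta_n})-\dot\ell_0)=O_P\big(M_n(r)+(n^{1/2-r}\vee1)\|\tilde\theta_n-\theta_0\|\big)$ for every random sequence $\tilde\theta_n\to\theta_0$ in probability in $\Theta$; and, as $\eta\to\eta_0$ in $\mathcal H$, $P\ddot\ell(\theta_0,\theta_0,\eta)-P\ddot\ell(\theta_0,\theta_0,\eta_0)$ and $P\ell_{t,\theta}(\theta_0,\theta_0,\eta)-P\ell_{t,\theta}(\theta_0,\theta_0,\eta_0)$ are $O(\|\eta-\eta_0\|)$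 and $P\dot\ell(\theta_0,\theta_0,\eta)=O(\|\eta-\eta_0\|^2)$. - (C1) For some neighbourhood $V$ of $(\theta_0,\theta_0,\eta_0)$ in $\Theta\times\Theta\times\mathcal H$ and all $i,j,k$, the classes $\{\ddot\ell(t,\theta,\eta)_{i,j}:(t,\theta,\eta)\in V\}$ and $\{\ell_{t,\theta}(t,\theta,\eta)_{i,j}:(t,\theta,\eta)\in V\}$ are $P$-Donsker and $\{\ell^{(3)}(t,\theta,\eta)_{i,j,k}:(t,\theta,\eta)\in V\}$ is $P$-Glivenko–Cantelli. - (Differentiation under the integral) For $(t,\theta)$ near $(\theta_0,\theta_0)$ one has $\eta_t(\theta,\eta_0)\in\mathcal H$ and $P_{t,\eta_t(\theta,\eta_0)}\ll P$, and for $\mu$-almost every $x$ the function $(t,\theta)\mapsto\mathrm{lik}(t,\eta_t(\theta,\eta_0))(x)$ is $C^2$ there with first and second derivatives bounded in norm by a common $\mu$-integrable function of $x$. - (Identifiability) With $\Delta_n(\theta)=n^{-1}\{\log pl_n(\theta)-\log pl_n(\hat\theta_n)\}$, for every random sequence $\tilde\theta_n$ in $\Theta$, $\Delta_n(\tilde\theta_n)=o_P(1)$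 implies $\tilde\theta_n=\theta_0+o_P(1)$. - (Prior) $\rho$ is a probability density on $\Theta$ with $\rho(\theta_0)>0$, continuously differentiable in a neighbourhood of $\theta_0$. **Theorem 3.** Let $\tilde P_{\theta|\tilde X}(A)=\int_{A\cap\Theta}\rho\,pl_n\,d\theta\big/\int_{\Theta}\rho\,pl_n\,d\theta$ be the posterior profile distribution and $\Phi_d$ the distribution function of $N_d(0,I)$. Then, with $\le$ between vectors understood coordinatewise, $$\sup_{\xi\in\mathbb R^d}\Big|\tilde P_{\theta|\tilde X}\big(\sqrt n\,\tilde I_0^{1/2}(\theta-\hat\theta_n)\le\xi\big)-\Phi_d(\xi)\Big|=O_P(M_n(r)).$$ -/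

import Mathlib

open MeasureTheory ProbabilityTheory Filter Topology Asymptotics
open scoped ENNReal

namespace ProfileSampler

noncomputable section

/-! ### Stochastic orders (in outer probability: no measurability is required) -/

/-- `T n = O_P(a n)` for arbitrary maps `T n` and a possibly random nonnegative rate `a n`.
A measure of a non-measurable set is its outer measure. -/
def IsBigOP {Ω : Type*} [MeasurableSpace Ω] (Pr : Measure Ω) (T a : ℕ → Ω → ℝ) : Prop :=
  ∀ ε : ℝ≥0∞, 0 < ε → ∃ K : ℝ, ∀ᶠ n in atTop, Pr {ω | K * a n ω < |T n ω|} ≤ ε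

/-- The rate `M_n(r) = n^{-1/2} + n^{-2r+1/2}`. -/
def rateM (r : ℝ) (n : ℕ) : ℝ := (n : ℝ) ^ (-(1 / 2) : ℝ) + (n : ℝ) ^ (-2 * r + 1 / 2)

/-! ### Empirical measure, empirical process, Donsker and Glivenko–Cantelli classes -/

section Empirical

variable {𝒳 : Type*}

/-- The empirical mean `ℙ_n f` of the first `n` points of a sequence of observations. -/
def empMean (n : ℕ) (x : ℕ → 𝒳) (f : 𝒳 → ℝ) : ℝ := (n : ℝ)⁻¹ * ∑ i ∈ Finset.range n, f (x i)

variable [MeasurableSpace 𝒳]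

/-- The empirical process `𝔾_n f = √n (ℙ_n f - P f)`. -/
def empProc (P : Measure 𝒳) (n : ℕ) (x : ℕ → 𝒳) (f : 𝒳 → ℝ) : ℝ :=
  √(n : ℝ) * (empMean n x f - ∫ y, f y ∂P)

/-- `P`-Glivenko–Cantelli: `sup_{f ∈ 𝓕} |ℙ_n f - P f| → 0` outer almost surely, on the infinite
product space (there is a measurable majorant that tends to zero almost surely). -/
def IsGlivenkoCantelli (P : Measure 𝒳) [IsProbabilityMeasure P] (𝓕 : Set (𝒳 → ℝ)) : Prop :=
  (∀ f ∈ 𝓕, Integrable f P) ∧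
  ∃ D : ℕ → (ℕ → 𝒳) → ℝ≥0∞, (∀ n, Measurable (D n)) ∧
    (∀ n x, ∀ f ∈ 𝓕, ENNReal.ofReal |empMean n x f - ∫ y, f y ∂P| ≤ D n x) ∧
    ∀ᵐ x ∂(Measure.infinitePi fun _ : ℕ => P), Tendsto (fun n => D n x) atTop (𝓝 0)

/-- The outer expectation of a bounded function. -/
def outerExp {S : Type*} [MeasurableSpace S] (Q : Measure S) (h : S → ℝ) : ℝ :=
  sInf {c | ∃ U : S → ℝ, Measurable U ∧ Integrable U Q ∧ (∀ s, h s ≤ U s) ∧ c = ∫ s, U s ∂Q}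

/-- The space `ℓ^∞(𝓕)` with the supremum norm. -/
abbrev EllInfty (𝓕 : Set (𝒳 → ℝ)) : Type _ := lp (fun _ : 𝓕 => ℝ) ∞

open Classical in
/-- The empirical process as an element of `ℓ^∞(𝓕)` (zero where it is unbounded). -/
def empProcLInfty (P : Measure 𝒳) (𝓕 : Set (𝒳 → ℝ)) (n : ℕ) (x : ℕ → 𝒳) : EllInfty 𝓕 :=
  if h : Memℓp (fun f : 𝓕 => empProc P n x (f : 𝒳 → ℝ)) ∞ then ⟨_, h⟩ else 0

/-- `P`-Donsker: `𝓕 ⊆ L₂(P)`, the paths of `f ↦ f(x) - P f` are almost surely bounded, and `𝔾_n`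
converges weakly in `ℓ^∞(𝓕)` (in the sense of outer expectations of bounded continuous functions)
to a tight Borel law. -/
def IsDonsker (P : Measure 𝒳) [IsProbabilityMeasure P] (𝓕 : Set (𝒳 → ℝ)) : Prop :=
  (∀ f ∈ 𝓕, MemLp f 2 P) ∧
  (∀ᵐ x ∂P, ∃ C : ℝ, ∀ f ∈ 𝓕, |f x - ∫ y, f y ∂P| ≤ C) ∧
  ∃ ν : @Measure (EllInfty 𝓕) (borel _), ν Set.univ = 1 ∧
    (∀ ε : ℝ≥0∞, 0 < ε → ∃ C : Set (EllInfty 𝓕), IsCompact C ∧ ν Cᶜ ≤ ε) ∧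
    ∀ h : BoundedContinuousFunction (EllInfty 𝓕) ℝ,
      Tendsto
        (fun n => outerExp (Measure.infinitePi fun _ : ℕ => P)
          fun x => h (empProcLInfty P 𝓕 n x))
        atTop (𝓝 (@integral _ _ _ _ (borel _) ν h))

end Empirical

/-! ### Semiparametric models -/

/-- A dominated semiparametric model `{P_{θ,η} : θ ∈ Θ ⊆ ℝ^d, η ∈ ℋ}`: for `θ ∈ Θ` and `η ∈ ℋ` the
function `lik θ η` is the density of `P_{θ,η}` with respect to `μ`. -/
structure Model (d : ℕ) (𝒳 E : Type*) [MeasurableSpace 𝒳] where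
  Θ : Set (EuclideanSpace ℝ (Fin d))
  H : Set E
  μ : Measure 𝒳
  lik : EuclideanSpace ℝ (Fin d) → E → 𝒳 → ℝ
  sigmaFinite : SigmaFinite μ
  lik_nonneg : ∀ θ ∈ Θ, ∀ η ∈ H, ∀ x, 0 ≤ lik θ η x
  lik_measurable : ∀ θ ∈ Θ, ∀ η ∈ H, Measurable (lik θ η)
  lik_lintegral : ∀ θ ∈ Θ, ∀ η ∈ H, ∫⁻ x, ENNReal.ofReal (lik θ η x) ∂μ = 1

namespace Model

variable {d : ℕ} {𝒳 E : Type*} [MeasurableSpace 𝒳]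

/-- The distribution `P_{θ,η}` of one observation. -/
def law (M : Model d 𝒳 E) (θ : EuclideanSpace ℝ (Fin d)) (η : E) : Measure 𝒳 :=
  M.μ.withDensity fun x => ENNReal.ofReal (M.lik θ η x)

theorem isProbabilityMeasure_law (M : Model d 𝒳 E) {θ : EuclideanSpace ℝ (Fin d)} {η : E}
    (hθ : θ ∈ M.Θ) (hη : η ∈ M.H) : IsProbabilityMeasure (M.law θ η) :=
  ⟨by rw [law, withDensity_apply _ MeasurableSet.univ, Measure.restrict_univ]
      exact M.lik_lintegral θ hθ η hη⟩

/-- The full likelihood `lik_n(θ, η)` of the first `n` observations. -/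
def likn (M : Model d 𝒳 E) (n : ℕ) (x : ℕ → 𝒳) (θ : EuclideanSpace ℝ (Fin d)) (η : E) : ℝ :=
  ∏ i ∈ Finset.range n, M.lik θ η (x i)

/-- The profile likelihood `pl_n(θ) = sup_{η ∈ ℋ} lik_n(θ, η)`. -/
def profLik (M : Model d 𝒳 E) (n : ℕ) (x : ℕ → 𝒳) (θ : EuclideanSpace ℝ (Fin d)) : ℝ :=
  sSup ((fun η => M.likn n x θ η) '' M.H)

/-! #### Efficient score and efficient information -/

/-- The components of the score function for `θ`. -/
def scoreθ (M : Model d 𝒳 E) (θ : EuclideanSpace ℝ (Fin d)) (η : E) (i : Fin d) (x : 𝒳) : ℝ :=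
  fderiv ℝ (fun t => Real.log (M.lik t η x)) θ (EuclideanSpace.single i 1)

/-- `g` is the score function for the nuisance parameter at `(θ, η)` along the path `γ` in `ℋ`
through `η`: `g = ∂/∂t|_{t=0} log p_{θ,γ(t)}`, an element of `L₂⁰(P_{θ,η})`. -/
def IsNuisanceScore [TopologicalSpace E] (M : Model d 𝒳 E)
    (θ : EuclideanSpace ℝ (Fin d)) (η : E) (γ : ℝ → E) (g : 𝒳 → ℝ) : Prop :=
  γ 0 = η ∧ Tendsto γ (𝓝 0) (𝓝 η) ∧ (∀ᶠ t in 𝓝 0, γ t ∈ M.H) ∧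
  MemLp g 2 (M.law θ η) ∧ ∫ x, g x ∂(M.law θ η) = 0 ∧
  ∀ᵐ x ∂(M.law θ η), (∀ᶠ t in 𝓝 0, 0 < M.lik θ (γ t) x) ∧
    HasDerivAt (fun t => Real.log (M.lik θ (γ t) x)) (g x) 0

/-- The closed linear space in `L₂(P_{θ,η})` of the scores for the nuisance parameter along the
paths ("directions") in the index set `𝒟`. -/
def nuisanceTangent [TopologicalSpace E] (M : Model d 𝒳 E)
    (θ : EuclideanSpace ℝ (Fin d)) (η : E) (𝒟 : Set (ℝ → E)) :
    Submodule ℝ (Lp ℝ 2 (M.law θ η)) :=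
  (Submodule.span ℝ {G : Lp ℝ 2 (M.law θ η) |
    ∃ γ ∈ 𝒟, ∃ g, M.IsNuisanceScore θ η γ g ∧ G =ᵐ[M.law θ η] g}).topologicalClosure

/-- The efficient score `ℓ̃_{θ,η}`: the score for `θ` minus its orthogonal projection onto the
closed linear space of nuisance scores. -/
def effScore [TopologicalSpace E] (M : Model d 𝒳 E)
    (θ : EuclideanSpace ℝ (Fin d)) (η : E) (𝒟 : Set (ℝ → E))
    (hs : ∀ i, MemLp (M.scoreθ θ η i) 2 (M.law θ η)) (i : Fin d) : Lp ℝ 2 (M.law θ η) :=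
  haveI : CompleteSpace (M.nuisanceTangent θ η 𝒟) := Submodule.topologicalClosure.completeSpace _
  (hs i).toLp - (M.nuisanceTangent θ η 𝒟).starProjection (hs i).toLp

/-- The efficient information matrix `Ĩ_{θ,η} = P_{θ,η} ℓ̃_{θ,η} ℓ̃_{θ,η}ᵀ`. -/
def effInfo [TopologicalSpace E] (M : Model d 𝒳 E)
    (θ : EuclideanSpace ℝ (Fin d)) (η : E) (𝒟 : Set (ℝ → E))
    (hs : ∀ i, MemLp (M.scoreθ θ η i) 2 (M.law θ η)) : Matrix (Fin d) (Fin d) ℝ :=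
  Matrix.of fun i j => ∫ x, M.effScore θ η 𝒟 hs i x * M.effScore θ η 𝒟 hs j x ∂(M.law θ η)

/-! #### The submodel `t ↦ lik(t, η_t(θ, η))` and the derivatives of its log-likelihood

The map `sub t θ η` stands for `η_t(θ, η)`. -/

section Submodel

variable (M : Model d 𝒳 E)
  (sub : EuclideanSpace ℝ (Fin d) → EuclideanSpace ℝ (Fin d) → E → E)

/-- `ℓ(t, θ, η)(x) = log lik(t, η_t(θ, η))(x)`. -/
def ell (t θ : EuclideanSpace ℝ (Fin d)) (η : E) (x : 𝒳) : ℝ :=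
  Real.log (M.lik t (sub t θ η) x)

/-- `∂ℓ/∂t_i`. -/
def ellT (i : Fin d) (t θ : EuclideanSpace ℝ (Fin d)) (η : E) (x : 𝒳) : ℝ :=
  fderiv ℝ (fun s => M.ell sub s θ η x) t (EuclideanSpace.single i 1)

/-- `∂²ℓ/∂t_i∂t_j`. -/
def ellTT (i j : Fin d) (t θ : EuclideanSpace ℝ (Fin d)) (η : E) (x : 𝒳) : ℝ :=
  fderiv ℝ (fun s => M.ellT sub i s θ η x) t (EuclideanSpace.single j 1)

/-- `∂³ℓ/∂t_i∂t_j∂t_k`. -/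
def ellTTT (i j k : Fin d) (t θ : EuclideanSpace ℝ (Fin d)) (η : E) (x : 𝒳) : ℝ :=
  fderiv ℝ (fun s => M.ellTT sub i j s θ η x) t (EuclideanSpace.single k 1)

/-- `∂²ℓ/∂t_i∂θ_j`. -/
def ellTθ (i j : Fin d) (t θ : EuclideanSpace ℝ (Fin d)) (η : E) (x : 𝒳) : ℝ :=
  fderiv ℝ (fun s => M.ellT sub i t s η x) θ (EuclideanSpace.single j 1)

/-- `∂³ℓ/∂t_i∂θ_j∂θ_k`. -/
def ellTθθ (i j k : Fin d) (t θ : EuclideanSpace ℝ (Fin d)) (η : E) (x : 𝒳) : ℝ :=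
  fderiv ℝ (fun s => M.ellTθ sub i j t s η x) θ (EuclideanSpace.single k 1)

/-- `∂³ℓ/∂t_i∂t_j∂θ_k`. -/
def ellTTθ (i j k : Fin d) (t θ : EuclideanSpace ℝ (Fin d)) (η : E) (x : 𝒳) : ℝ :=
  fderiv ℝ (fun s => M.ellTT sub i j t s η x) θ (EuclideanSpace.single k 1)

/-- The map `sub` defines a least favorable submodel at `(θ, η)`: the score of the submodel at
`t = θ` is the efficient score. -/
def IsLeastFavorable [TopologicalSpace E] (θ : EuclideanSpace ℝ (Fin d)) (η : E)
    (𝒟 : Set (ℝ → E)) (hs : ∀ i, MemLp (M.scoreθ θ η i) 2 (M.law θ η)) : Prop :=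
  ∀ i, M.ellT sub i θ θ η =ᵐ[M.law θ η] M.effScore θ η 𝒟 hs i

variable [SeminormedAddCommGroup E]

/-- The neighbourhood of `(θ₀, θ₀, η₀)` of radius `δ` in `Θ × Θ × ℋ`. -/
def nbhd (θ₀ : EuclideanSpace ℝ (Fin d)) (η₀ : E) (δ : ℝ) :
    Set (EuclideanSpace ℝ (Fin d) × EuclideanSpace ℝ (Fin d) × E) :=
  {p | (p.1 ∈ M.Θ ∧ ‖p.1 - θ₀‖ < δ) ∧ (p.2.1 ∈ M.Θ ∧ ‖p.2.1 - θ₀‖ < δ) ∧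
    (p.2.2 ∈ M.H ∧ ‖p.2.2 - η₀‖ < δ)}

/-- Regularity at the truth that allows the identities `∫ lik(t, η_t(θ, η₀)) dμ = 1` to be
differentiated twice under the integral sign at `(t, θ) = (θ₀, θ₀)`. -/
def DiffUnderIntegral (θ₀ : EuclideanSpace ℝ (Fin d)) (η₀ : E) : Prop :=
  ∃ δ > 0, Metric.ball θ₀ δ ⊆ M.Θ ∧
    (∀ t ∈ Metric.ball θ₀ δ, ∀ θ ∈ Metric.ball θ₀ δ,
      sub t θ η₀ ∈ M.H ∧ M.law t (sub t θ η₀) ≪ M.law θ₀ η₀) ∧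
    ∃ G : 𝒳 → ℝ, Integrable G M.μ ∧ ∀ᵐ x ∂M.μ,
      ContDiffOn ℝ 2
        (fun p : EuclideanSpace ℝ (Fin d) × EuclideanSpace ℝ (Fin d) =>
          M.lik p.1 (sub p.1 p.2 η₀) x)
        (Metric.ball θ₀ δ ×ˢ Metric.ball θ₀ δ) ∧
      ∀ p ∈ Metric.ball θ₀ δ ×ˢ Metric.ball θ₀ δ, ∀ m : ℕ, 1 ≤ m → m ≤ 2 →
        ‖iteratedFDeriv ℝ m
          (fun p : EuclideanSpace ℝ (Fin d) × EuclideanSpace ℝ (Fin d) =>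
            M.lik p.1 (sub p.1 p.2 η₀) x) p‖ ≤ G x

/-- Smoothness in the Euclidean arguments. In a neighbourhood of `(θ₀, θ₀, η₀)` the submodel is
defined, its log-likelihood is finite, the derivatives `∂^{l+m} ℓ / ∂t^l ∂θ^m` with `(l, m)` in
`{(0,0), (1,0), (2,0), (3,0), (1,1), (1,2), (2,1)}` exist (that is, `ℓ` is differentiable in `t`
and its gradient in `t` is `C²` in `(t, θ)`), and they all have an envelope in `L₁(P)`. -/
def AssumptionB1 (θ₀ : EuclideanSpace ℝ (Fin d)) (η₀ : E) : Prop :=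
  ∃ δ > 0, Metric.ball θ₀ δ ⊆ M.Θ ∧
    (∀ p ∈ M.nbhd θ₀ η₀ δ, sub p.1 p.2.1 p.2.2 ∈ M.H) ∧
    (∀ᵐ x ∂(M.law θ₀ η₀), ∀ η ∈ M.H, ‖η - η₀‖ < δ →
      (∀ t ∈ Metric.ball θ₀ δ, ∀ θ ∈ Metric.ball θ₀ δ, 0 < M.lik t (sub t θ η) x) ∧
      (∀ θ ∈ Metric.ball θ₀ δ,
        DifferentiableOn ℝ (fun t => M.ell sub t θ η x) (Metric.ball θ₀ δ)) ∧
      ∀ i, ContDiffOn ℝ 2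
        (fun p : EuclideanSpace ℝ (Fin d) × EuclideanSpace ℝ (Fin d) =>
          M.ellT sub i p.1 p.2 η x)
        (Metric.ball θ₀ δ ×ˢ Metric.ball θ₀ δ)) ∧
    ∃ F : 𝒳 → ℝ, Integrable F (M.law θ₀ η₀) ∧
      ∀ᵐ x ∂(M.law θ₀ η₀), ∀ p ∈ M.nbhd θ₀ η₀ δ,
        |M.ell sub p.1 p.2.1 p.2.2 x| ≤ F x ∧
        (∀ i, |M.ellT sub i p.1 p.2.1 p.2.2 x| ≤ F x) ∧
        (∀ i j, |M.ellTT sub i j p.1 p.2.1 p.2.2 x| ≤ F x) ∧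
        (∀ i j k, |M.ellTTT sub i j k p.1 p.2.1 p.2.2 x| ≤ F x) ∧
        (∀ i j, |M.ellTθ sub i j p.1 p.2.1 p.2.2 x| ≤ F x) ∧
        (∀ i j k, |M.ellTθθ sub i j k p.1 p.2.1 p.2.2 x| ≤ F x) ∧
        (∀ i j k, |M.ellTTθ sub i j k p.1 p.2.1 p.2.2 x| ≤ F x)

/-- Smoothness in the nuisance parameter of the expected derivatives at `(θ₀, θ₀, η)`. -/
def AssumptionB2Bias (θ₀ : EuclideanSpace ℝ (Fin d)) (η₀ : E) : Prop :=
  (∀ i j, (fun η => ∫ x, M.ellTT sub i j θ₀ θ₀ η x ∂(M.law θ₀ η₀)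
      - ∫ x, M.ellTT sub i j θ₀ θ₀ η₀ x ∂(M.law θ₀ η₀)) =O[𝓝[M.H] η₀] fun η => ‖η - η₀‖) ∧
  (∀ i j, (fun η => ∫ x, M.ellTθ sub i j θ₀ θ₀ η x ∂(M.law θ₀ η₀)
      - ∫ x, M.ellTθ sub i j θ₀ θ₀ η₀ x ∂(M.law θ₀ η₀)) =O[𝓝[M.H] η₀] fun η => ‖η - η₀‖) ∧
  (∀ i, (fun η => ∫ x, M.ellT sub i θ₀ θ₀ η x ∂(M.law θ₀ η₀))
      =O[𝓝[M.H] η₀] fun η => ‖η - η₀‖ ^ 2)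

/-- The stochastic part of the smoothness in the nuisance parameter, for every random sequence
in `Θ` that is consistent for `θ₀`. Here `ηhat n ω θ` is the maximizer of `lik_n(θ, ·)`. -/
def AssumptionB2Stoch {Ω : Type*} [MeasurableSpace Ω] (Pr : Measure Ω) (X : ℕ → Ω → 𝒳)
    (ηhat : ℕ → Ω → EuclideanSpace ℝ (Fin d) → E)
    (θ₀ : EuclideanSpace ℝ (Fin d)) (η₀ : E) (r : ℝ) : Prop :=
  ∀ θt : ℕ → Ω → EuclideanSpace ℝ (Fin d), (∀ n ω, θt n ω ∈ M.Θ) →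
    TendstoInMeasure Pr θt atTop (fun _ => θ₀) →
    ∀ i, IsBigOP Pr
      (fun n ω => empProc (M.law θ₀ η₀) n (fun k => X k ω)
        fun x => M.ellT sub i θ₀ θ₀ (ηhat n ω (θt n ω)) x - M.ellT sub i θ₀ θ₀ η₀ x)
      (fun n ω => rateM r n + max ((n : ℝ) ^ (1 / 2 - r)) 1 * ‖θt n ω - θ₀‖)

/-- Empirical process conditions on the derivatives in a neighbourhood of `(θ₀, θ₀, η₀)`. -/
def AssumptionC1 (θ₀ : EuclideanSpace ℝ (Fin d)) (η₀ : E)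
    [IsProbabilityMeasure (M.law θ₀ η₀)] : Prop :=
  ∃ δ > 0, ∀ i j,
    IsDonsker (M.law θ₀ η₀) ((fun p => M.ellTT sub i j p.1 p.2.1 p.2.2) '' M.nbhd θ₀ η₀ δ) ∧
    IsDonsker (M.law θ₀ η₀) ((fun p => M.ellTθ sub i j p.1 p.2.1 p.2.2) '' M.nbhd θ₀ η₀ δ) ∧
    ∀ k, IsGlivenkoCantelli (M.law θ₀ η₀)
      ((fun p => M.ellTTT sub i j k p.1 p.2.1 p.2.2) '' M.nbhd θ₀ η₀ δ)

end Submodel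

/-- The convergence rate `r` of the nuisance parameter:
`‖η̂_{θ̃_n} - η₀‖ = O_P(‖θ̃_n - θ₀‖ + n^{-r})` for every random sequence in `Θ` that is consistent
for `θ₀`. -/
def HasNuisanceRate [SeminormedAddCommGroup E] (M : Model d 𝒳 E)
    {Ω : Type*} [MeasurableSpace Ω] (Pr : Measure Ω)
    (ηhat : ℕ → Ω → EuclideanSpace ℝ (Fin d) → E)
    (θ₀ : EuclideanSpace ℝ (Fin d)) (η₀ : E) (r : ℝ) : Prop :=
  ∀ θt : ℕ → Ω → EuclideanSpace ℝ (Fin d), (∀ n ω, θt n ω ∈ M.Θ) →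
    TendstoInMeasure Pr θt atTop (fun _ => θ₀) →
    IsBigOP Pr (fun n ω => ‖ηhat n ω (θt n ω) - η₀‖)
      (fun n ω => ‖θt n ω - θ₀‖ + (n : ℝ) ^ (-r))

/-- Identifiability: with `Δ_n(θ) = n⁻¹ (log pl_n(θ) - log pl_n(θ̂_n))`, for every random sequence
`θ̃_n` in `Θ`, `Δ_n(θ̃_n) = o_P(1)` implies `θ̃_n → θ₀` in probability. (At a point with
`pl_n(θ̃_n) = 0` the value of `Δ_n` is `-∞`, hence not small.) -/
def Identifiable (M : Model d 𝒳 E) {Ω : Type*} [MeasurableSpace Ω] (Pr : Measure Ω)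
    (X : ℕ → Ω → 𝒳) (θhat : ℕ → Ω → EuclideanSpace ℝ (Fin d))
    (θ₀ : EuclideanSpace ℝ (Fin d)) : Prop :=
  ∀ θt : ℕ → Ω → EuclideanSpace ℝ (Fin d), (∀ n ω, θt n ω ∈ M.Θ) →
    (∀ ε : ℝ, 0 < ε → Tendsto
      (fun n => Pr {ω | ¬ (0 < M.profLik n (fun k => X k ω) (θt n ω) ∧
        |(n : ℝ)⁻¹ * (Real.log (M.profLik n (fun k => X k ω) (θt n ω))
          - Real.log (M.profLik n (fun k => X k ω) (θhat n ω)))| ≤ ε)})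
      atTop (𝓝 0)) →
    TendstoInMeasure Pr θt atTop (fun _ => θ₀)

/-- The posterior profile probability of the set `A` for the prior density `ρ` on `Θ`:
`∫_{A ∩ Θ} ρ pl_n / ∫_Θ ρ pl_n`. -/
def posteriorProfile (M : Model d 𝒳 E) (ρ : EuclideanSpace ℝ (Fin d) → ℝ) (n : ℕ) (x : ℕ → 𝒳)
    (A : Set (EuclideanSpace ℝ (Fin d))) : ℝ :=
  ((∫⁻ θ in A ∩ M.Θ, ENNReal.ofReal (ρ θ * M.profLik n x θ)) /
    ∫⁻ θ in M.Θ, ENNReal.ofReal (ρ θ * M.profLik n x θ)).toReal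

end Model

/-- The positive semidefinite square root of a symmetric positive semidefinite matrix. -/
def matSqrt {d : ℕ} (A : Matrix (Fin d) (Fin d) ℝ) : Matrix (Fin d) (Fin d) ℝ := cfc Real.sqrt A

/-- The `d`-variate standard normal distribution function `Φ_d`. -/
def stdNormalCdf (d : ℕ) (ξ : Fin d → ℝ) : ℝ :=
  (Measure.pi (fun _ : Fin d => gaussianReal 0 1) (Set.Iic ξ)).toReal

end

end ProfileSampler

/-! The profile likelihood is squeezed between likelihoods of finite-dimensional submodels. For
every ψ one has pl_n(t) ≥ lik_n(t, η_t(ψ, η̂_ψ)), with equality at t = ψ. Taking ψ = θ and ψ = θ₀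
traps log pl_n(θ) − log pl_n(θ₀) between two differences along least favorable submodels, and each
of them is Taylor expanded in t at θ₀. At the truth the Bartlett identities give P ℓ̈ = −Ĩ₀ and P
ℓ_{t,θ} = 0 (`Model.information_identities`). The first supplies the curvature. The second, together
with the quadratic bias P ℓ̇(θ₀,θ₀,η) = O(‖η − η₀‖²), limits the effect of estimating η on the
score; the bias contributes √n n^{-2r}, the second term of M_n(r). Both bounds thus have the same
quadratic part, with score 𝔾_n ℓ̇₀ and curvature Ĩ₀ (`GoodSample.abs_log_profLik_sub_le`).

The score equation at θ̂_n, expanded in the same way, yields √n-consistency and 𝔾_n ℓ̇₀ = √n Ĩ₀(θ̂_n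
− θ₀) + O(M_n(r)). Completing the square recentres the quadratic at θ̂_n
(`exists_recentredExpansion`).

What remains is a Laplace approximation. Near θ₀ the normalized product of prior and profile
likelihood differs from a Gaussian kernel by M_n(r) times a wider Gaussian kernel. Away from θ₀
identifiability makes pl_n exponentially small relative to its maximum (`exists_gap_of_forall_seq`,
`profLik_le_of_gap`). So the L₁ distance to the Gaussian kernel, relative to the mass of that
kernel, is O(M_n(r)), and this controls the normalized probabilities of all sets at once
(`abs_ratio_integral_sub_le`): uniformity in ξ costs nothing.

Probability enters only through a few events. Hypotheses along arbitrary random sequences become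
bounds uniform in a neighbourhood (`tight_of_forall_seq`), Donsker classes make the empirical
process bounded (`IsDonsker.tight`), and the resulting `GoodSample` has large probability
(`tight_goodSample`). The expansions and the Laplace step are deterministic statements about one
sample. -/

namespace ProfileSampler

/-! ### Stochastic boundedness of a family of events indexed by a constant -/

section Tight

variable {Ω : Type*} [MeasurableSpace Ω] {Pr : Measure Ω}

/-- The event `Q K n` has outer probability close to one for large `K`, eventually in `n`. -/
def Tight (Pr : Measure Ω) (Q : ℝ → ℕ → Ω → Prop) : Prop :=
  ∀ ε : ℝ≥0∞, 0 < ε → ∃ K₀ : ℝ, ∀ K ≥ K₀, ∀ᶠ n in atTop, Pr {ω | ¬ Q K n ω} ≤ ε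

/-- Since `Tight` asks for every K beyond K₀, two events can share one constant without any
monotonicity in K. -/
theorem Tight.and {Q R : ℝ → ℕ → Ω → Prop} (hQ : Tight Pr Q) (hR : Tight Pr R) :
    Tight Pr (fun K n ω => Q K n ω ∧ R K n ω) := by
  intro ε hε
  obtain ⟨K₁, h₁⟩ := hQ (ε / 2) (ENNReal.half_pos hε.ne')
  obtain ⟨K₂, h₂⟩ := hR (ε / 2) (ENNReal.half_pos hε.ne')
  refine ⟨max K₁ K₂, fun K hK => ?_⟩
  filter_upwards [h₁ K (le_trans (le_max_left _ _) hK), h₂ K (le_trans (le_max_right _ _) hK)]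
    with n hn₁ hn₂
  calc Pr {ω | ¬ (Q K n ω ∧ R K n ω)} ≤ Pr ({ω | ¬ Q K n ω} ∪ {ω | ¬ R K n ω}) := by
        refine measure_mono fun ω hω => ?_
        simp only [Set.mem_union, Set.mem_ofPred_eq] at hω ⊢
        tauto
    _ ≤ _ := measure_union_le _ _
    _ ≤ ε / 2 + ε / 2 := add_le_add hn₁ hn₂
    _ = ε := ENNReal.add_halves ε

theorem Tight.mono {Q R : ℝ → ℕ → Ω → Prop} (hQ : Tight Pr Q)
    (h : ∀ K > 0, ∀ n > 0, ∀ ω, Q K n ω → R K n ω) : Tight Pr R := by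
  intro ε hε
  obtain ⟨K₁, h₁⟩ := hQ ε hε
  refine ⟨max K₁ 1, fun K hK => ?_⟩
  filter_upwards [h₁ K (le_trans (le_max_left _ _) hK), eventually_gt_atTop 0] with n hn hn0
  refine (measure_mono fun ω hω => ?_).trans hn
  have hK0 : 0 < K := lt_of_lt_of_le one_pos ((le_max_right _ _).trans hK)
  exact fun hq => hω (h K hK0 n hn0 ω hq)

theorem Tight.of_ae {R : ℕ → Ω → Prop} (h : ∀ n, ∀ᵐ ω ∂Pr, R n ω) :
    Tight Pr (fun _ n ω => R n ω) := fun ε _ =>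
  ⟨0, fun _ _ => Eventually.of_forall fun n => by
    have : Pr {ω | ¬ R n ω} = 0 := h n
    simp [this]⟩

theorem Tight.forall_finset {ι : Type*} (s : Finset ι) {Q : ι → ℝ → ℕ → Ω → Prop}
    (h : ∀ i, Tight Pr (Q i)) : Tight Pr (fun K n ω => ∀ i ∈ s, Q i K n ω) := by
  classical
  induction s using Finset.induction_on with
  | empty => exact (Tight.of_ae (R := fun _ _ => True) (by simp)).mono (by simp)
  | insert a s _ ih =>
    refine ((h a).and ih).mono fun K _ n _ ω hq => ?_
    simp only [Finset.mem_insert, forall_eq_or_imp]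
    exact hq

theorem Tight.forall_fintype {ι : Type*} [Fintype ι] {Q : ι → ℝ → ℕ → Ω → Prop}
    (h : ∀ i, Tight Pr (Q i)) : Tight Pr (fun K n ω => ∀ i, Q i K n ω) :=
  (Tight.forall_finset Finset.univ h).mono fun _ _ _ _ _ hq i => hq i (Finset.mem_univ i)

/-- A stochastic bound along every consistent random sequence is uniform in a neighbourhood. -/
theorem tight_of_forall_seq {V : Type*} [NormedAddCommGroup V] {Θ : Set V} {θ₀ : V}
    (hθ₀ : θ₀ ∈ Θ) (T a : ℕ → Ω → V → ℝ) (ha : ∀ n ω θ, 0 ≤ a n ω θ)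
    (h : ∀ θt : ℕ → Ω → V, (∀ n ω, θt n ω ∈ Θ) →
      TendstoInMeasure Pr θt atTop (fun _ => θ₀) →
      IsBigOP Pr (fun n ω => T n ω (θt n ω)) (fun n ω => a n ω (θt n ω))) :
    Tight Pr (fun K n ω => ∀ θ ∈ Θ, ‖θ - θ₀‖ < K⁻¹ → |T n ω θ| ≤ K * a n ω θ) := by
  set Q : ℝ → ℕ → Ω → Prop := fun K n ω => ∀ θ ∈ Θ, ‖θ - θ₀‖ < K⁻¹ → |T n ω θ| ≤ K * a n ω θ
    with hQ
  by_contra hcon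
  simp only [Tight, not_forall, not_exists] at hcon
  obtain ⟨ε, hε, hcon⟩ := hcon
  -- If the uniform bound fails, each m gives a constant at least m + 1 that fails with probability
  -- above ε for infinitely many n. Violating parameters at increasing sample sizes φ m are glued
  -- into one random sequence, which is consistent but breaks the assumed bound.
  have hK : ∀ m : ℕ, ∃ K : ℝ, (m : ℝ) + 1 ≤ K ∧ ∃ᶠ n in atTop, ε < Pr {ω | ¬ Q K n ω} := by
    intro m
    obtain ⟨K, hK, hn⟩ := hcon (m + 1)
    exact ⟨K, hK, by simpa only [not_eventually, not_le] using hn⟩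
  choose k hk hfreq using hK
  obtain ⟨φ, hφ, hφε⟩ := extraction_forall_of_frequently hfreq
  have hpick : ∀ (K : ℝ) (n : ℕ) (ω : Ω), ∃ θ ∈ Θ, (‖θ - θ₀‖ < K⁻¹ ∨ θ = θ₀) ∧
      (¬ Q K n ω → K * a n ω θ < |T n ω θ|) := by
    intro K n ω
    by_cases hq : Q K n ω
    · exact ⟨θ₀, hθ₀, Or.inr rfl, fun h => absurd hq h⟩
    · have hq' := hq
      simp only [hQ, not_forall, not_le] at hq'
      obtain ⟨θ, h1, h2, h3⟩ := hq'
      exact ⟨θ, h1, Or.inl h2, fun _ => h3⟩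
  choose g hgΘ hgn hgT using hpick
  classical
  -- Off the range of φ the default n + 1 still diverges, so the radius κ⁻¹ shrinks along all n and
  -- the glued sequence is consistent.
  let κ : ℕ → ℝ := fun n => if h : ∃ m, φ m = n then k h.choose else n + 1
  have hκφ : ∀ m, κ (φ m) = k m := by
    intro m
    have hex : ∃ m', φ m' = φ m := ⟨m, rfl⟩
    have : hex.choose = m := hφ.injective hex.choose_spec
    simp only [κ, dif_pos hex, this]
  have hκ : Tendsto κ atTop atTop := by
    refine tendsto_atTop.2 fun B => ?_
    obtain ⟨N, hN⟩ := exists_nat_ge B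
    filter_upwards [eventually_ge_atTop (max N (φ N))] with n hn
    by_cases hex : ∃ m, φ m = n
    · obtain ⟨m, rfl⟩ := hex
      have hm : N ≤ m := hφ.le_iff_le.1 ((le_max_right _ _).trans hn)
      rw [hκφ]
      have := hk m
      have : (N : ℝ) ≤ m := by exact_mod_cast hm
      linarith
    · simp only [κ, dif_neg hex]
      have : (N : ℝ) ≤ n := by exact_mod_cast (le_max_left _ _).trans hn
      linarith
  have hcons : TendstoInMeasure Pr (fun n ω => g (κ n) n ω) atTop (fun _ => θ₀) := by
    intro e he
    refine tendsto_const_nhds.congr' ?_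
    have hlim : Tendsto (fun n => ENNReal.ofReal (κ n)⁻¹) atTop (𝓝 0) := by
      have := ENNReal.tendsto_ofReal hκ.inv_tendsto_atTop
      simpa using this
    filter_upwards [hlim.eventually (gt_mem_nhds he)] with n hn
    symm
    convert measure_empty (μ := Pr)
    rw [Set.eq_empty_iff_forall_notMem]
    intro ω hω
    simp only [Set.mem_ofPred_eq] at hω
    rcases hgn (κ n) n ω with h1 | h1
    · rw [edist_dist, dist_eq_norm] at hω
      exact absurd (hω.trans (ENNReal.ofReal_le_ofReal h1.le)) (not_le.2 hn)
    · rw [h1, edist_self] at hω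
      exact absurd hω (not_le.2 he)
  obtain ⟨K, hK⟩ := h _ (fun n ω => hgΘ _ _ _) hcons ε hε
  have hev := (hφ.tendsto_atTop.eventually hK).and
    ((hκ.comp hφ.tendsto_atTop).eventually_ge_atTop K)
  obtain ⟨m, hm1, hm2⟩ := hev.exists
  simp only [Function.comp] at hm2
  refine absurd ((measure_mono fun ω hω => ?_).trans hm1) (not_le.2 (hφε m))
  have := hgT (k m) (φ m) ω hω
  rw [hκφ] at hm2
  simp only [Set.mem_ofPred_eq, hκφ]
  exact lt_of_le_of_lt (mul_le_mul_of_nonneg_right hm2 (ha _ _ _)) this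

/-- If every random sequence with vanishing gap `D n ω θ ≤ o(1)` is consistent, then the gap is
bounded away from zero outside a neighbourhood, with large probability. -/
theorem exists_gap_of_forall_seq {V : Type*} [NormedAddCommGroup V] {Θ : Set V} {θ₀ : V}
    (D : ℝ → ℕ → Ω → V → Prop) (θh : ℕ → Ω → V) (hθh : ∀ n ω, θh n ω ∈ Θ)
    (hD0 : ∀ e > 0, ∀ n, Pr {ω | ¬ D e n ω (θh n ω)} = 0)
    (hDmono : ∀ e e', e ≤ e' → ∀ n ω θ, D e n ω θ → D e' n ω θ)
    (h : ∀ θt : ℕ → Ω → V, (∀ n ω, θt n ω ∈ Θ) →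
      (∀ e : ℝ, 0 < e → Tendsto (fun n => Pr {ω | ¬ D e n ω (θt n ω)}) atTop (𝓝 0)) →
      TendstoInMeasure Pr θt atTop (fun _ => θ₀))
    {δ : ℝ} (hδ : 0 < δ) {ε : ℝ≥0∞} (hε : 0 < ε) :
    ∃ c : ℝ, 0 < c ∧ ∀ᶠ n in atTop, Pr {ω | ∃ θ ∈ Θ, δ ≤ ‖θ - θ₀‖ ∧ D c n ω θ} ≤ ε := by
  by_contra hcon
  push Not at hcon
  have hfreq : ∀ m : ℕ, ∃ᶠ n in atTop,
      ε < Pr {ω | ∃ θ ∈ Θ, δ ≤ ‖θ - θ₀‖ ∧ D ((m : ℝ) + 1)⁻¹ n ω θ} :=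
    fun m => hcon _ (by positivity)
  obtain ⟨φ, hφ, hφε⟩ := extraction_forall_of_frequently hfreq
  -- Where no distant point satisfies the gap condition, the choice falls back on θh, which
  -- satisfies it almost surely. The chosen sequence then has a vanishing gap, yet stays δ away with
  -- probability above ε along φ.
  have hpick : ∀ (e : ℝ) (n : ℕ) (ω : Ω), ∃ θ ∈ Θ,
      ((∃ θ ∈ Θ, δ ≤ ‖θ - θ₀‖ ∧ D e n ω θ) → δ ≤ ‖θ - θ₀‖) ∧ (D e n ω (θh n ω) → D e n ω θ) := by
    intro e n ω
    by_cases hq : ∃ θ ∈ Θ, δ ≤ ‖θ - θ₀‖ ∧ D e n ω θ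
    · obtain ⟨θ, h1, h2, h3⟩ := hq
      exact ⟨θ, h1, fun _ => h2, fun _ => h3⟩
    · exact ⟨θh n ω, hθh n ω, fun h => absurd h hq, fun h => h⟩
  choose g hgΘ hgδ hgD using hpick
  classical
  let κ : ℕ → ℝ := fun n => if h : ∃ m, φ m = n then ((h.choose : ℝ) + 1)⁻¹ else ((n : ℝ) + 1)⁻¹
  have hκφ : ∀ m, κ (φ m) = ((m : ℝ) + 1)⁻¹ := by
    intro m
    have hex : ∃ m', φ m' = φ m := ⟨m, rfl⟩
    have : hex.choose = m := hφ.injective hex.choose_spec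
    simp only [κ, dif_pos hex, this]
  have hκpos : ∀ n, 0 < κ n := by
    intro n
    simp only [κ]
    split_ifs <;> positivity
  have hκ : ∀ e : ℝ, 0 < e → ∀ᶠ n in atTop, κ n ≤ e := by
    intro e he
    obtain ⟨N, hN⟩ := exists_nat_ge e⁻¹
    have key : ∀ m : ℕ, N ≤ m → ((m : ℝ) + 1)⁻¹ ≤ e := by
      intro m hm
      have : (N : ℝ) ≤ m := by exact_mod_cast hm
      exact inv_le_of_inv_le₀ he (by linarith)
    filter_upwards [eventually_ge_atTop (max N (φ N))] with n hn
    by_cases hex : ∃ m, φ m = n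
    · obtain ⟨m, rfl⟩ := hex
      rw [hκφ]
      exact key m (hφ.le_iff_le.1 ((le_max_right _ _).trans hn))
    · simp only [κ, dif_neg hex]
      exact key n ((le_max_left _ _).trans hn)
  have hcons := h (fun n ω => g (κ n) n ω) (fun n ω => hgΘ _ _ _) (by
    intro e he
    refine tendsto_const_nhds.congr' ?_
    filter_upwards [hκ e he] with n hn
    symm
    refine measure_mono_null (fun ω hω => ?_) (hD0 (κ n) (hκpos n) n)
    exact fun hd => hω (hDmono _ _ hn _ _ _ (hgD _ _ _ hd)))
  have h1 := hcons (ENNReal.ofReal δ) (by simpa using hδ)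
  have h2 := (h1.comp hφ.tendsto_atTop).eventually (gt_mem_nhds hε)
  obtain ⟨m, hm⟩ := h2.exists
  refine absurd (lt_of_le_of_lt (measure_mono fun ω hω => ?_) hm) (not_lt.2 (hφε m).le)
  simp only [Set.mem_ofPred_eq, hκφ, edist_dist, dist_eq_norm]
  exact ENNReal.ofReal_le_ofReal (hgδ _ _ _ hω)

end Tight

/-! ### Empirical averages -/

section Averages

variable {Ω 𝒳 : Type*} [MeasurableSpace Ω] [MeasurableSpace 𝒳] {Pr : Measure Ω}
  {P : Measure 𝒳} {X : ℕ → Ω → 𝒳}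

theorem ae_comp_of_ae (hXm : ∀ k, Measurable (X k)) (hXlaw : ∀ k, Measure.map (X k) Pr = P)
    {p : 𝒳 → Prop} (hp : ∀ᵐ x ∂P, p x) : ∀ᵐ ω ∂Pr, ∀ k, p (X k ω) := by
  rw [ae_all_iff]
  intro k
  rw [← hXlaw k] at hp
  exact ae_of_ae_map (hXm k).aemeasurable hp

/-- Markov's inequality for the average of |F|, whose expectation is P|F| for every positive n; only
the common marginal law matters. -/
theorem tight_empMean [IsProbabilityMeasure Pr] (hXm : ∀ k, Measurable (X k))
    (hXlaw : ∀ k, Measure.map (X k) Pr = P)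
    {F : 𝒳 → ℝ} (hF : Integrable F P) :
    Tight Pr (fun K n ω => empMean n (fun k => X k ω) F ≤ K) := by
  have hint : ∀ k, Integrable (fun ω => F (X k ω)) Pr := fun k => by
    rw [← hXlaw k] at hF
    exact hF.comp_measurable (hXm k)
  have heq : ∀ k, ∫ ω, |F (X k ω)| ∂Pr = ∫ x, |F x| ∂P := fun k => by
    have := hF.abs
    rw [← hXlaw k] at this ⊢
    exact (integral_map (hXm k).aemeasurable this.aestronglyMeasurable).symm
  intro ε hε
  by_cases hεt : ε = ⊤
  · exact ⟨0, fun _ _ => by simp [hεt]⟩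
  have hεr : 0 < ε.toReal := ENNReal.toReal_pos hε.ne' hεt
  refine ⟨max 1 ((∫ x, |F x| ∂P) / ε.toReal), fun K hK => ?_⟩
  have hK0 : 0 < K := lt_of_lt_of_le one_pos ((le_max_left _ _).trans hK)
  have hK1 : (∫ x, |F x| ∂P) / ε.toReal ≤ K := (le_max_right _ _).trans hK
  filter_upwards [eventually_gt_atTop 0] with n hn
  have hn' : (0 : ℝ) < n := by exact_mod_cast hn
  set S : Ω → ℝ := fun ω => (n : ℝ)⁻¹ * ∑ i ∈ Finset.range n, |F (X i ω)| with hS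
  have hSint : Integrable S Pr := by
    refine Integrable.const_mul (integrable_finsetSum _ fun i _ => (hint i).abs) _
  have hSval : ∫ ω, S ω ∂Pr = ∫ x, |F x| ∂P := by
    simp only [hS]
    rw [integral_const_mul, integral_finsetSum _ fun i _ => (hint i).abs]
    simp only [heq, Finset.sum_const, Finset.card_range, nsmul_eq_mul]
    field_simp
  have hmar := mul_meas_ge_le_integral_of_nonneg (μ := Pr) (f := S)
    (Eventually.of_forall fun ω => by positivity) hSint K
  rw [hSval] at hmar
  have hsub : {ω | ¬ empMean n (fun k => X k ω) F ≤ K} ⊆ {ω | K ≤ S ω} := by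
    intro ω hω
    simp only [Set.mem_ofPred_eq, not_le, empMean] at hω ⊢
    refine hω.le.trans ?_
    simp only [hS]
    gcongr
    exact le_abs_self _
  refine (measure_mono hsub).trans ?_
  rw [← ENNReal.ofReal_toReal (measure_ne_top Pr {ω | K ≤ S ω}), ← ENNReal.ofReal_toReal hεt]
  apply ENNReal.ofReal_le_ofReal
  rw [div_le_iff₀ hεr] at hK1
  have h2 : K * Pr.real {ω | K ≤ S ω} ≤ K * ε.toReal := hmar.trans hK1
  exact le_of_mul_le_mul_left h2 hK0

/-- Chebyshev's inequality: by independence the variance of the sum is n times that of one term,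
which cancels the scaling of 𝔾_n. -/
theorem tight_empProc [IsProbabilityMeasure Pr] (hXm : ∀ k, Measurable (X k)) (hXind : iIndepFun X Pr)
    (hXlaw : ∀ k, Measure.map (X k) Pr = P) {g : 𝒳 → ℝ} (hg : MemLp g 2 P) :
    Tight Pr (fun K n ω => |empProc P n (fun k => X k ω) g| ≤ K) := by
  -- replace `g` by a measurable version
  obtain ⟨g', hg'm, hgg'⟩ : ∃ g', Measurable g' ∧ g =ᵐ[P] g' :=
    ⟨hg.aestronglyMeasurable.mk g, hg.aestronglyMeasurable.stronglyMeasurable_mk.measurable,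
      hg.aestronglyMeasurable.ae_eq_mk⟩
  have hg2 : MemLp g' 2 P := (memLp_congr_ae hgg').1 hg
  have hXg : ∀ k, MemLp (fun ω => g' (X k ω)) 2 Pr := fun k => by
    have := hg2
    rw [← hXlaw k] at this
    exact this.comp_measurePreserving ⟨hXm k, rfl⟩
  have hid : ∀ k, ∫ ω, g' (X k ω) ∂Pr = ∫ x, g x ∂P := fun k => by
    rw [integral_congr_ae hgg', ← hXlaw k]
    exact (integral_map (hXm k).aemeasurable hg'm.aestronglyMeasurable).symm
  have hvar : ∀ k, Var[fun ω => g' (X k ω); Pr] = Var[g'; P] := fun k => by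
    rw [← hXlaw k]
    exact (variance_map hg'm.aemeasurable (hXm k).aemeasurable).symm
  have hgX : ∀ᵐ ω ∂Pr, ∀ k, g (X k ω) = g' (X k ω) := ae_comp_of_ae hXm hXlaw hgg'
  intro ε hε
  by_cases hεt : ε = ⊤
  · exact ⟨0, fun _ _ => by simp [hεt]⟩
  have hεr : 0 < ε.toReal := ENNReal.toReal_pos hε.ne' hεt
  set v := Var[g'; P] with hv
  have hv0 : 0 ≤ v := variance_nonneg _ _
  -- Because 1 ≤ K, the Chebyshev bound v / K² is at most v / K ≤ ε.
  refine ⟨max 1 (v / ε.toReal), fun K hK => ?_⟩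
  have hK1 : 1 ≤ K := (le_max_left _ _).trans hK
  have hK0 : 0 < K := lt_of_lt_of_le one_pos hK1
  have hK2 : v / ε.toReal ≤ K := (le_max_right _ _).trans hK
  filter_upwards [eventually_gt_atTop 0] with n hn
  have hn' : (0 : ℝ) < n := by exact_mod_cast hn
  have hs : 0 < √(n : ℝ) := Real.sqrt_pos.2 hn'
  set S : Ω → ℝ := ∑ i ∈ Finset.range n, (fun ω => g' (X i ω)) with hS
  have hS2 : MemLp S 2 Pr := memLp_finsetSum' _ fun i _ => hXg i
  have hSvar : Var[S; Pr] = n * v := by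
    rw [hS, IndepFun.variance_sum (fun i _ => hXg i)]
    · simp [hvar]
    · intro i _ j _ hij
      exact (hXind.indepFun hij).comp hg'm hg'm
  have hSE : ∫ ω, S ω ∂Pr = n * ∫ x, g x ∂P := by
    simp only [hS, Finset.sum_apply]
    rw [integral_finsetSum _ fun i _ => (hXg i).integrable one_le_two]
    simp [hid]
  have hch := meas_ge_le_variance_div_sq hS2 (c := K * √n) (by positivity)
  have hsub : Pr {ω | ¬ |empProc P n (fun k => X k ω) g| ≤ K} ≤
      Pr {ω | K * √n ≤ |S ω - ∫ ω, S ω ∂Pr|} := by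
    refine measure_mono_ae ?_
    filter_upwards [hgX] with ω hω hbad
    simp only [not_le] at hbad ⊢
    change K < _ at hbad
    change K * √n ≤ _
    have hsum : S ω = ∑ i ∈ Finset.range n, g (X i ω) := by
      simp [hS, hω]
    have : empProc P n (fun k => X k ω) g = (√n)⁻¹ * (S ω - ∫ ω, S ω ∂Pr) := by
      rw [hSE, hsum, empProc, empMean]
      have h2 : (n : ℝ) = √n * √n := (Real.mul_self_sqrt hn'.le).symm
      rw [mul_sub, mul_sub]
      congr 1
      · rw [← mul_assoc]; congr 1
        rw [inv_eq_one_div, inv_eq_one_div]; field_simp; nlinarith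
      · rw [← mul_assoc]; congr 1
        field_simp; nlinarith
    rw [this, abs_mul, abs_of_pos (inv_pos.2 hs), inv_mul_eq_div, lt_div_iff₀ hs] at hbad
    exact hbad.le
  refine hsub.trans (hch.trans ?_)
  rw [← ENNReal.ofReal_toReal hεt]
  apply ENNReal.ofReal_le_ofReal
  rw [hSvar, mul_pow, Real.sq_sqrt hn'.le, div_le_iff₀ (by positivity)]
  rw [div_le_iff₀ hεr] at hK2
  nlinarith [mul_le_mul_of_nonneg_left hK1 (mul_nonneg hK0.le hεr.le)]

end Averages

/-! ### Boundedness of the empirical process over a Donsker class -/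

section Donsker

variable {Ω 𝒳 : Type*} [MeasurableSpace Ω] [MeasurableSpace 𝒳] {Pr : Measure Ω}
  {P : Measure 𝒳} {X : ℕ → Ω → 𝒳}

/-- Markov's inequality for a measurable majorant nearly attaining the infimum. The bound h ≤ 1
makes the set of majorants nonempty, so that the infimum is not the default value 0. -/
theorem measure_le_outerExp {S : Type*} [MeasurableSpace S] (Q : Measure S)
    [IsProbabilityMeasure Q] {h : S → ℝ} (h0 : ∀ s, 0 ≤ h s) {c : ℝ} (hc : outerExp Q h < c)
    (h1 : ∀ s, h s ≤ 1) : Q {s | 1 ≤ h s} ≤ ENNReal.ofReal c := by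
  have hne : {c | ∃ U : S → ℝ, Measurable U ∧ Integrable U Q ∧ (∀ s, h s ≤ U s) ∧
      c = ∫ s, U s ∂Q}.Nonempty :=
    ⟨_, fun _ => 1, measurable_const, integrable_const _, h1, rfl⟩
  obtain ⟨_, ⟨U, hUm, hUi, hU, rfl⟩, hlt⟩ := exists_lt_of_csInf_lt hne hc
  have hmar := mul_meas_ge_le_integral_of_nonneg (μ := Q) (f := U)
    (Eventually.of_forall fun s => (h0 s).trans (hU s)) hUi 1
  rw [one_mul] at hmar
  calc Q {s | 1 ≤ h s} ≤ Q {s | 1 ≤ U s} := measure_mono fun s hs => le_trans hs (hU s)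
    _ = ENNReal.ofReal (Q.real {s | 1 ≤ U s}) := by
        rw [measureReal_def, ENNReal.ofReal_toReal (measure_ne_top _ _)]
    _ ≤ ENNReal.ofReal c := ENNReal.ofReal_le_ofReal (hmar.trans hlt.le)

/-- Boundedness over the class at each observation passes to the average. It ensures that
`empProcLInfty` is the genuine process and not its default value zero. -/
theorem bddAbove_empProc {𝓕 : Set (𝒳 → ℝ)} {x : ℕ → 𝒳}
    (hx : ∀ k, ∃ C : ℝ, ∀ f ∈ 𝓕, |f (x k) - ∫ y, f y ∂P| ≤ C) (n : ℕ) :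
    ∃ C : ℝ, ∀ f ∈ 𝓕, |empProc P n x f| ≤ C := by
  choose C hC using hx
  refine ⟨√(n : ℝ) * ((n : ℝ)⁻¹ * ∑ i ∈ Finset.range n, C i), fun f hf => ?_⟩
  rcases Nat.eq_zero_or_pos n with rfl | hn
  · simp [empProc]
  have hn' : (0 : ℝ) < n := by exact_mod_cast hn
  have : empMean n x f - ∫ y, f y ∂P
      = (n : ℝ)⁻¹ * ∑ i ∈ Finset.range n, (f (x i) - ∫ y, f y ∂P) := by
    rw [empMean, Finset.sum_sub_distrib, mul_sub]
    simp only [Finset.sum_const, Finset.card_range, nsmul_eq_mul]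
    field_simp
  rw [empProc, this, abs_mul, abs_of_nonneg (Real.sqrt_nonneg _), abs_mul,
    abs_of_pos (inv_pos.2 hn')]
  gcongr
  exact (Finset.abs_sum_le_sum_abs _ _).trans (Finset.sum_le_sum fun i _ => hC i f hf)

theorem abs_le_norm_empProcLInfty {𝓕 : Set (𝒳 → ℝ)} {x : ℕ → 𝒳} {n : ℕ}
    (hb : ∃ C : ℝ, ∀ f ∈ 𝓕, |empProc P n x f| ≤ C) {f : 𝒳 → ℝ} (hf : f ∈ 𝓕) :
    |empProc P n x f| ≤ ‖empProcLInfty P 𝓕 n x‖ := by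
  obtain ⟨C, hC⟩ := hb
  have hmem : Memℓp (fun f : 𝓕 => empProc P n x (f : 𝒳 → ℝ)) ∞ := by
    refine memℓp_infty ⟨C, ?_⟩
    rintro _ ⟨f, rfl⟩
    exact hC f f.2
  have := lp.norm_apply_le_norm (p := ∞) (by simp) (empProcLInfty P 𝓕 n x) ⟨f, hf⟩
  rw [empProcLInfty, dif_pos hmem] at this ⊢
  exact this

/-- The norm, truncated to vanish below `K` and to be one above `K + 1`. -/
noncomputable def truncNorm (V : Type*) [NormedAddCommGroup V] (K : ℝ) :
    BoundedContinuousFunction V ℝ :=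
  BoundedContinuousFunction.mkOfBound ⟨fun v => min 1 (max 0 (‖v‖ - K)), by fun_prop⟩ 1 (by
    intro v w
    have h : ∀ u : V, min 1 (max 0 (‖u‖ - K)) ∈ Set.Icc (0 : ℝ) 1 := fun u =>
      ⟨le_min zero_le_one (le_max_left _ _), min_le_left _ _⟩
    simpa using Real.dist_le_of_mem_Icc_01 (h v) (h w))

theorem truncNorm_apply {V : Type*} [NormedAddCommGroup V] (K : ℝ) (v : V) :
    truncNorm V K v = min 1 (max 0 (‖v‖ - K)) := rfl

theorem integral_truncNorm_le {V : Type*} [NormedAddCommGroup V] [mV : MeasurableSpace V]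
    [BorelSpace V] (ν : Measure V) [IsFiniteMeasure ν] {C : Set V} (hC : IsCompact C) {K : ℝ}
    (hK : ∀ v ∈ C, ‖v‖ ≤ K) : ∫ v, truncNorm V K v ∂ν ≤ ν.real Cᶜ := by
  have hCm : MeasurableSet C := hC.isClosed.measurableSet
  have : ∫ v, Cᶜ.indicator (fun _ => (1 : ℝ)) v ∂ν = ν.real Cᶜ := by
    rw [integral_indicator_const _ hCm.compl]; simp
  rw [← this]
  refine integral_mono_of_nonneg (Eventually.of_forall fun v => ?_) ?_
    (Eventually.of_forall fun v => ?_)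
  · exact le_min zero_le_one (le_max_left _ _)
  · exact (integrable_const (1 : ℝ)).indicator hCm.compl
  · by_cases hv : v ∈ C
    · simp only [Set.indicator, Set.mem_compl_iff, hv, not_true_eq_false, if_false,
        truncNorm_apply]
      refine (min_le_right _ _).trans ?_
      simp [hK v hv]
    · simp [Set.indicator, hv, truncNorm_apply]

/-- A one-sided portmanteau argument: the tight limit law lives, up to ε, on a norm-bounded compact
set; a truncated norm vanishing there has a small integral, and weak convergence carries this to the
outer expectations of the empirical process. -/
theorem IsDonsker.exists_bound [IsProbabilityMeasure P] {𝓕 : Set (𝒳 → ℝ)}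
    (h : IsDonsker P 𝓕) {ε : ℝ≥0∞} (hε : 0 < ε) :
    ∃ K₀ : ℝ, ∀ K ≥ K₀, ∀ᶠ n in atTop,
      (Measure.infinitePi fun _ : ℕ => P) {x | ∃ f ∈ 𝓕, K < |empProc P n x f|} ≤ ε := by
  obtain ⟨-, hbd, ν, hν1, htight, hconv⟩ := h
  set Q := Measure.infinitePi fun _ : ℕ => P with hQ
  obtain ⟨e, he0, heε⟩ : ∃ e : ℝ, 0 < e ∧ ENNReal.ofReal e ≤ ε := by
    by_cases hεt : ε = ⊤
    · exact ⟨1, one_pos, by simp [hεt]⟩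
    · exact ⟨ε.toReal, ENNReal.toReal_pos hε.ne' hεt, by rw [ENNReal.ofReal_toReal hεt]⟩
  let _ : MeasurableSpace (EllInfty 𝓕) := borel _
  have : BorelSpace (EllInfty 𝓕) := ⟨rfl⟩
  have : IsProbabilityMeasure ν := ⟨hν1⟩
  obtain ⟨C, hC, hνC⟩ := htight (ENNReal.ofReal (e / 2)) (by simpa using he0)
  obtain ⟨K₀, hK₀⟩ := hC.isBounded.exists_norm_le
  have hbdae : ∀ᵐ x ∂Q, ∀ k, ∃ C : ℝ, ∀ f ∈ 𝓕, |f (x k) - ∫ y, f y ∂P| ≤ C := by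
    refine ae_comp_of_ae (X := fun k (x : ℕ → 𝒳) => x k) (fun k => measurable_pi_apply k)
      (fun k => ?_) hbd
    exact (measurePreserving_eval_infinitePi (fun _ : ℕ => P) k).map_eq
  -- The truncation starting at K − 1 reaches one at norm K; the shift by one keeps its start above
  -- all norms in C.
  refine ⟨K₀ + 1, fun K hK => ?_⟩
  have hKC : ∀ v ∈ C, ‖v‖ ≤ K - 1 := fun v hv => (hK₀ v hv).trans (by linarith)
  have hlim := hconv (truncNorm _ (K - 1))
  have hint : ∫ v, truncNorm _ (K - 1) v ∂ν < e := by
    refine (integral_truncNorm_le ν hC hKC).trans_lt ?_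
    rw [measureReal_def]
    refine (ENNReal.toReal_mono (by simp) hνC).trans_lt ?_
    rw [ENNReal.toReal_ofReal (by positivity)]
    linarith
  filter_upwards [hlim.eventually (gt_mem_nhds hint)] with n hn
  refine le_trans ?_ heε
  refine le_trans ?_ (measure_le_outerExp Q (fun s => ?_) hn (fun s => min_le_left _ _))
  · refine measure_mono_ae ?_
    filter_upwards [hbdae] with x hx hbad
    obtain ⟨f, hf, hKf⟩ := hbad
    have h1 := abs_le_norm_empProcLInfty (bddAbove_empProc hx n) hf
    change 1 ≤ truncNorm _ (K - 1) _
    rw [truncNorm_apply]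
    refine le_min le_rfl (le_max_of_le_right ?_)
    linarith
  · exact le_min zero_le_one (le_max_left _ _)

/-- Under Pr the whole sequence has the infinite product law, so the canonical bound transfers. The
failure event need not be measurable, and the inequality of outer measures in `Measure.le_map_apply`
points the right way. -/
theorem IsDonsker.tight [IsProbabilityMeasure Pr] [IsProbabilityMeasure P] {𝓕 : Set (𝒳 → ℝ)}
    (h : IsDonsker P 𝓕) (hXm : ∀ k, Measurable (X k))
    (hXind : iIndepFun X Pr) (hXlaw : ∀ k, Measure.map (X k) Pr = P) :
    Tight Pr (fun K n ω => ∀ f ∈ 𝓕, |empProc P n (fun k => X k ω) f| ≤ K) := by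
  intro ε hε
  obtain ⟨K₀, hK₀⟩ := h.exists_bound hε
  have hmap : Measure.map (fun ω k => X k ω) Pr = Measure.infinitePi fun _ : ℕ => P := by
    rw [(iIndepFun_iff_map_fun_eq_infinitePi_map hXm).1 hXind]
    simp only [hXlaw]
  refine ⟨K₀, fun K hK => ?_⟩
  filter_upwards [hK₀ K hK] with n hn
  rw [← hmap] at hn
  have hle := Measure.le_map_apply (μ := Pr) (f := fun ω k => X k ω)
    (measurable_pi_lambda _ hXm).aemeasurable {x | ∃ f ∈ 𝓕, K < |empProc P n x f|}
  refine le_trans (measure_mono fun ω hω => ?_) (hle.trans hn)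
  simpa using hω

end Donsker


/-! ### Taylor expansions with bounded remainder -/

/-- The parameter space `ℝ^d`. -/
abbrev Vec (d : ℕ) : Type := EuclideanSpace ℝ (Fin d)

section Taylor

theorem abs_sub_le_of_deriv_bound {f f₁ : ℝ → ℝ} {C : ℝ}
    (h : ∀ s ∈ Set.Icc (0 : ℝ) 1, HasDerivAt f (f₁ s) s)
    (hC : ∀ s ∈ Set.Icc (0 : ℝ) 1, |f₁ s| ≤ C) {s : ℝ} (hs : s ∈ Set.Icc (0 : ℝ) 1) :
    |f s - f 0| ≤ C := by
  have h0 : (0 : ℝ) ∈ Set.Icc (0 : ℝ) 1 := ⟨le_rfl, zero_le_one⟩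
  have := (convex_Icc (0 : ℝ) 1).norm_image_sub_le_of_norm_hasDerivWithin_le
    (fun x hx => (h x hx).hasDerivWithinAt) hC h0 hs
  refine this.trans ?_
  have hC0 : 0 ≤ C := (abs_nonneg _).trans (hC 0 h0)
  rw [sub_zero, Real.norm_of_nonneg hs.1]
  exact mul_le_of_le_one_right hC0 hs.2

/-- Subtracting the linear part reduces the claim to the mean value bound. The constant is not
sharp, as only the order of the remainder matters below. -/
theorem abs_taylor_two_le {f f₁ f₂ : ℝ → ℝ} {C : ℝ}
    (h : ∀ s ∈ Set.Icc (0 : ℝ) 1, HasDerivAt f (f₁ s) s)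
    (h₁ : ∀ s ∈ Set.Icc (0 : ℝ) 1, HasDerivAt f₁ (f₂ s) s)
    (hC : ∀ s ∈ Set.Icc (0 : ℝ) 1, |f₂ s| ≤ C) {s : ℝ} (hs : s ∈ Set.Icc (0 : ℝ) 1) :
    |f s - f 0 - s * f₁ 0| ≤ C := by
  have := abs_sub_le_of_deriv_bound (f := fun s => f s - s * f₁ 0) (f₁ := fun s => f₁ s - f₁ 0)
    (C := C) (fun s hs => by
      simpa using (h s hs).fun_sub ((hasDerivAt_id s).mul_const (f₁ 0)))
    (fun s hs => abs_sub_le_of_deriv_bound h₁ hC hs) hs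
  simpa [sub_right_comm] using this

theorem abs_taylor_three_le {f f₁ f₂ f₃ : ℝ → ℝ} {C : ℝ}
    (h : ∀ s ∈ Set.Icc (0 : ℝ) 1, HasDerivAt f (f₁ s) s)
    (h₁ : ∀ s ∈ Set.Icc (0 : ℝ) 1, HasDerivAt f₁ (f₂ s) s)
    (h₂ : ∀ s ∈ Set.Icc (0 : ℝ) 1, HasDerivAt f₂ (f₃ s) s)
    (hC : ∀ s ∈ Set.Icc (0 : ℝ) 1, |f₃ s| ≤ C) :
    |f 1 - f 0 - f₁ 0 - f₂ 0 / 2| ≤ C := by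
  have := abs_sub_le_of_deriv_bound (f := fun s => f s - s * f₁ 0 - s ^ 2 / 2 * f₂ 0)
    (f₁ := fun s => f₁ s - f₁ 0 - s * f₂ 0) (C := C) (fun s hs => by
      have h2 : HasDerivAt (fun s : ℝ => s ^ 2 / 2 * f₂ 0) (s * f₂ 0) s := by
        refine (((hasDerivAt_pow 2 s).div_const 2).mul_const (f₂ 0)).congr_deriv ?_
        simp
      simpa using ((h s hs).fun_sub ((hasDerivAt_id s).mul_const (f₁ 0))).fun_sub h2)
    (fun s hs => abs_taylor_two_le h₁ h₂ hC hs) (s := 1) ⟨zero_le_one, le_rfl⟩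
  have e : f 1 - f 0 - f₁ 0 - f₂ 0 / 2
      = f 1 - 1 * f₁ 0 - 1 ^ 2 / 2 * f₂ 0 - (f 0 - 0 * f₁ 0 - 0 ^ 2 / 2 * f₂ 0) := by ring
  rw [e]
  exact this

variable {d : ℕ}

theorem clm_apply_eq_sum (L : Vec d →L[ℝ] ℝ) (v : Vec d) :
    L v = ∑ i, L (EuclideanSpace.single i 1) * v i := by
  conv_lhs => rw [← (EuclideanSpace.basisFun (Fin d) ℝ).sum_repr v]
  simp [mul_comm]

theorem abs_apply_le_norm (v : Vec d) (i : Fin d) : |v i| ≤ ‖v‖ := by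
  simpa using PiLp.norm_apply_le v i

theorem abs_sum_mul_le {a : Fin d → ℝ} {C : ℝ} (ha : ∀ i, |a i| ≤ C) (v : Vec d) :
    |∑ i, a i * v i| ≤ d * C * ‖v‖ := by
  calc |∑ i, a i * v i| ≤ ∑ i, |a i * v i| := Finset.abs_sum_le_sum_abs _ _
    _ ≤ ∑ _i : Fin d, C * ‖v‖ := Finset.sum_le_sum fun i _ => by
        rw [abs_mul]
        exact mul_le_mul (ha i) (abs_apply_le_norm v i) (abs_nonneg _)
          ((abs_nonneg _).trans (ha i))
    _ = d * C * ‖v‖ := by simp; ring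

theorem segment_mem_ball {θ₀ p v : Vec d} {δ : ℝ} (hp : p ∈ Metric.ball θ₀ δ)
    (hq : p + v ∈ Metric.ball θ₀ δ) {s : ℝ} (hs : s ∈ Set.Icc (0 : ℝ) 1) :
    p + s • v ∈ Metric.ball θ₀ δ :=
  (convex_ball θ₀ δ).add_smul_mem hp hq hs

theorem hasDerivAt_line {g : Vec d → ℝ} {p v : Vec d} {s : ℝ} (h : DifferentiableAt ℝ g (p + s • v)) :
    HasDerivAt (fun s : ℝ => g (p + s • v))
      (∑ i, fderiv ℝ g (p + s • v) (EuclideanSpace.single i 1) * v i) s := by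
  rw [← clm_apply_eq_sum]
  have hl : HasDerivAt (fun s : ℝ => p + s • v) v s := by
    simpa using ((hasDerivAt_id s).smul_const v).const_add p
  exact h.hasFDerivAt.comp_hasDerivAt s hl

variable {θ₀ : Vec d} {δ C : ℝ}

theorem abs_sub_le_of_partials {g : Vec d → ℝ} (hg : DifferentiableOn ℝ g (Metric.ball θ₀ δ))
    (hC : ∀ p ∈ Metric.ball θ₀ δ, ∀ i, |fderiv ℝ g p (EuclideanSpace.single i 1)| ≤ C)
    {p q : Vec d} (hp : p ∈ Metric.ball θ₀ δ) (hq : q ∈ Metric.ball θ₀ δ) :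
    |g q - g p| ≤ d * C * ‖q - p‖ := by
  have hq' : p + (q - p) ∈ Metric.ball θ₀ δ := by simpa using hq
  have := abs_sub_le_of_deriv_bound (f := fun s : ℝ => g (p + s • (q - p)))
    (fun s hs => hasDerivAt_line (hg.differentiableAt
      (Metric.isOpen_ball.mem_nhds (segment_mem_ball hp hq' hs))))
    (fun s hs => abs_sum_mul_le (hC _ (segment_mem_ball hp hq' hs)) _)
    (s := 1) ⟨zero_le_one, le_rfl⟩
  simpa using this

theorem abs_taylor_two_le_of_partials {g : Vec d → ℝ} {g₁ : Fin d → Vec d → ℝ}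
    {g₂ : Fin d → Fin d → Vec d → ℝ} (hg : DifferentiableOn ℝ g (Metric.ball θ₀ δ))
    (hg₁ : ∀ i, DifferentiableOn ℝ (g₁ i) (Metric.ball θ₀ δ))
    (e₁ : ∀ i p, g₁ i p = fderiv ℝ g p (EuclideanSpace.single i 1))
    (e₂ : ∀ i j p, g₂ i j p = fderiv ℝ (g₁ i) p (EuclideanSpace.single j 1))
    (hC : ∀ p ∈ Metric.ball θ₀ δ, ∀ i j, |g₂ i j p| ≤ C)
    {p q : Vec d} (hp : p ∈ Metric.ball θ₀ δ) (hq : q ∈ Metric.ball θ₀ δ) :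
    |g q - g p - ∑ i, g₁ i p * (q - p) i| ≤ d ^ 2 * C * ‖q - p‖ ^ 2 := by
  have hq' : p + (q - p) ∈ Metric.ball θ₀ δ := by simpa using hq
  have hd : ∀ {f : Vec d → ℝ}, DifferentiableOn ℝ f (Metric.ball θ₀ δ) →
      ∀ s ∈ Set.Icc (0 : ℝ) 1, DifferentiableAt ℝ f (p + s • (q - p)) := fun hf s hs =>
    hf.differentiableAt (Metric.isOpen_ball.mem_nhds (segment_mem_ball hp hq' hs))
  have := abs_taylor_two_le (f := fun s : ℝ => g (p + s • (q - p)))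
    (f₁ := fun s : ℝ => ∑ i, g₁ i (p + s • (q - p)) * (q - p) i)
    (f₂ := fun s : ℝ => ∑ i, (∑ j, g₂ i j (p + s • (q - p)) * (q - p) j) * (q - p) i)
    (C := d * (d * C * ‖q - p‖) * ‖q - p‖)
    (fun s hs => by simpa only [e₁] using hasDerivAt_line (hd hg s hs))
    (fun s hs => HasDerivAt.fun_sum fun i _ => by
      simpa only [e₂] using (hasDerivAt_line (hd (hg₁ i) s hs)).mul_const ((q - p) i))
    (fun s hs => abs_sum_mul_le (fun i => abs_sum_mul_le
      (hC _ (segment_mem_ball hp hq' hs) i) _) _)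
    (s := 1) ⟨zero_le_one, le_rfl⟩
  simp only [one_smul, zero_smul, add_zero, add_sub_cancel, one_mul] at this
  refine this.trans_eq (by ring)

theorem abs_taylor_three_le_of_partials {g : Vec d → ℝ} {g₁ : Fin d → Vec d → ℝ}
    {g₂ : Fin d → Fin d → Vec d → ℝ} {g₃ : Fin d → Fin d → Fin d → Vec d → ℝ}
    (hg : DifferentiableOn ℝ g (Metric.ball θ₀ δ))
    (hg₁ : ∀ i, DifferentiableOn ℝ (g₁ i) (Metric.ball θ₀ δ))
    (hg₂ : ∀ i j, DifferentiableOn ℝ (g₂ i j) (Metric.ball θ₀ δ))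
    (e₁ : ∀ i p, g₁ i p = fderiv ℝ g p (EuclideanSpace.single i 1))
    (e₂ : ∀ i j p, g₂ i j p = fderiv ℝ (g₁ i) p (EuclideanSpace.single j 1))
    (e₃ : ∀ i j k p, g₃ i j k p = fderiv ℝ (g₂ i j) p (EuclideanSpace.single k 1))
    (hC : ∀ p ∈ Metric.ball θ₀ δ, ∀ i j k, |g₃ i j k p| ≤ C)
    {p q : Vec d} (hp : p ∈ Metric.ball θ₀ δ) (hq : q ∈ Metric.ball θ₀ δ) :
    |g q - g p - ∑ i, g₁ i p * (q - p) i - (∑ i, (∑ j, g₂ i j p * (q - p) j) * (q - p) i) / 2|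
      ≤ d ^ 3 * C * ‖q - p‖ ^ 3 := by
  have hq' : p + (q - p) ∈ Metric.ball θ₀ δ := by simpa using hq
  have hd : ∀ {f : Vec d → ℝ}, DifferentiableOn ℝ f (Metric.ball θ₀ δ) →
      ∀ s ∈ Set.Icc (0 : ℝ) 1, DifferentiableAt ℝ f (p + s • (q - p)) := fun hf s hs =>
    hf.differentiableAt (Metric.isOpen_ball.mem_nhds (segment_mem_ball hp hq' hs))
  have := abs_taylor_three_le (f := fun s : ℝ => g (p + s • (q - p)))
    (f₁ := fun s : ℝ => ∑ i, g₁ i (p + s • (q - p)) * (q - p) i)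
    (f₂ := fun s : ℝ => ∑ i, (∑ j, g₂ i j (p + s • (q - p)) * (q - p) j) * (q - p) i)
    (f₃ := fun s : ℝ => ∑ i, (∑ j, (∑ k, g₃ i j k (p + s • (q - p)) * (q - p) k) * (q - p) j)
      * (q - p) i)
    (C := d * (d * (d * C * ‖q - p‖) * ‖q - p‖) * ‖q - p‖)
    (fun s hs => by simpa only [e₁] using hasDerivAt_line (hd hg s hs))
    (fun s hs => HasDerivAt.fun_sum fun i _ => by
      simpa only [e₂] using (hasDerivAt_line (hd (hg₁ i) s hs)).mul_const ((q - p) i))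
    (fun s hs => HasDerivAt.fun_sum fun i _ => HasDerivAt.mul_const
      (HasDerivAt.fun_sum fun j _ => by
        simpa only [e₃] using (hasDerivAt_line (hd (hg₂ i j) s hs)).mul_const ((q - p) j)) _)
    (fun s hs => abs_sum_mul_le (fun i => abs_sum_mul_le (fun j => abs_sum_mul_le
      (hC _ (segment_mem_ball hp hq' hs) i j) _) _) _)
  simp only [one_smul, zero_smul, add_zero, add_sub_cancel] at this
  refine this.trans_eq (by ring)

end Taylor

/-! ### Partial derivatives of functions of two vector variables -/

section Partial

variable {V W : Type*} [NormedAddCommGroup V] [NormedSpace ℝ V] [NormedAddCommGroup W]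
  [NormedSpace ℝ W] {G : V × W → ℝ} {z : V × W}

theorem fderiv_partial_fst (h : DifferentiableAt ℝ G z) (v : V) :
    fderiv ℝ (fun s => G (s, z.2)) z.1 v = fderiv ℝ G z (v, 0) := by
  have h1 : HasFDerivAt (fun s : V => (s, z.2)) (ContinuousLinearMap.inl ℝ V W) z.1 :=
    hasFDerivAt_prodMk_left _ _
  have h2 : HasFDerivAt G (fderiv ℝ G z) ((fun s : V => (s, z.2)) z.1) := h.hasFDerivAt
  have h3 : HasFDerivAt (fun s => G (s, z.2)) _ z.1 := h2.comp z.1 h1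
  rw [h3.fderiv]
  simp

theorem fderiv_partial_snd (h : DifferentiableAt ℝ G z) (v : W) :
    fderiv ℝ (fun s => G (z.1, s)) z.2 v = fderiv ℝ G z (0, v) := by
  have h1 : HasFDerivAt (fun s : W => (z.1, s)) (ContinuousLinearMap.inr ℝ V W) z.2 :=
    hasFDerivAt_prodMk_right _ _
  have h2 : HasFDerivAt G (fderiv ℝ G z) ((fun s : W => (z.1, s)) z.2) := h.hasFDerivAt
  have h3 : HasFDerivAt (fun s => G (z.1, s)) _ z.2 := h2.comp z.2 h1
  rw [h3.fderiv]
  simp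

theorem _root_.DifferentiableOn.partial_fst {s : Set V} {t : Set W} (h : DifferentiableOn ℝ G (s ×ˢ t))
    {w : W} (hw : w ∈ t) : DifferentiableOn ℝ (fun v => G (v, w)) s := by
  have := h.comp (f := fun v : V => (v, w)) (s := s) (by fun_prop) (fun v hv => ⟨hv, hw⟩)
  exact this

theorem _root_.DifferentiableOn.partial_snd {s : Set V} {t : Set W} (h : DifferentiableOn ℝ G (s ×ˢ t))
    {v : V} (hv : v ∈ s) : DifferentiableOn ℝ (fun w => G (v, w)) t := by
  have := h.comp (f := fun w : W => (v, w)) (s := t) (by fun_prop) (fun w hw => ⟨hv, hw⟩)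
  exact this

theorem differentiableOn_fderiv_apply {S : Set (V × W)} (hS : IsOpen S) (h : ContDiffOn ℝ 2 G S)
    (u : V × W) : DifferentiableOn ℝ (fun z => fderiv ℝ G z u) S := by
  have h1 : ContDiffOn ℝ 1 (fderiv ℝ G) S := h.fderiv_of_isOpen hS (by norm_num)
  exact (h1.differentiableOn one_ne_zero).clm_apply (differentiableOn_const u)

theorem differentiableOn_partial_fst {s : Set V} {t : Set W} (hs : IsOpen s) (ht : IsOpen t)
    (h : ContDiffOn ℝ 2 G (s ×ˢ t)) (u : V) :
    DifferentiableOn ℝ (fun z : V × W => fderiv ℝ (fun v => G (v, z.2)) z.1 u) (s ×ˢ t) := by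
  refine (differentiableOn_fderiv_apply (hs.prod ht) h (u, 0)).congr fun z hz => ?_
  exact fderiv_partial_fst ((h.differentiableOn two_ne_zero).differentiableAt
    ((hs.prod ht).mem_nhds hz)) u

theorem differentiableOn_partial_snd {s : Set V} {t : Set W} (hs : IsOpen s) (ht : IsOpen t)
    (h : ContDiffOn ℝ 2 G (s ×ˢ t)) (u : W) :
    DifferentiableOn ℝ (fun z : V × W => fderiv ℝ (fun v => G (z.1, v)) z.2 u) (s ×ˢ t) := by
  refine (differentiableOn_fderiv_apply (hs.prod ht) h (0, u)).congr fun z hz => ?_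
  exact fderiv_partial_snd ((h.differentiableOn two_ne_zero).differentiableAt
    ((hs.prod ht).mem_nhds hz)) u

end Partial

/-- The derivative is an almost everywhere limit of difference quotients along 1/(n + N + 1), where
N skips the steps at which the functions may fail to be measurable. This gives measurability of the
scores, which is nowhere assumed separately. -/
theorem aemeasurable_of_hasDerivAt {𝒳 : Type*} [MeasurableSpace 𝒳] {μ : Measure 𝒳}
    {f : ℝ → 𝒳 → ℝ} {f' : 𝒳 → ℝ} (hf : ∀ᶠ s in 𝓝 0, AEMeasurable (f s) μ)
    (h : ∀ᵐ x ∂μ, HasDerivAt (fun s => f s x) (f' x) 0) : AEMeasurable f' μ := by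
  have hs0 : Tendsto (fun n : ℕ => ((n : ℝ) + 1)⁻¹) atTop (𝓝 0) := by
    simpa [one_div] using tendsto_one_div_add_atTop_nhds_zero_nat (𝕜 := ℝ)
  obtain ⟨N, hN⟩ := eventually_atTop.1 (hs0.eventually hf)
  have hf0 : AEMeasurable (f 0) μ := hf.self_of_nhds
  set s : ℕ → ℝ := fun n => (((n + N : ℕ) : ℝ) + 1)⁻¹ with hs
  refine aemeasurable_of_tendsto_metrizable_ae atTop
    (f := fun n x => (s n)⁻¹ * (f (s n) x - f 0 x)) (fun n => ?_) ?_
  · exact ((hN (n + N) (Nat.le_add_left _ _)).sub hf0).const_mul _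
  · filter_upwards [h] with x hx
    have h1 := hasDerivAt_iff_tendsto_slope_zero.1 hx
    have h2 : Tendsto s atTop (𝓝[≠] 0) := by
      refine tendsto_nhdsWithin_iff.2 ⟨hs0.comp (tendsto_add_atTop_nat N), ?_⟩
      exact Eventually.of_forall fun n => by
        simp only [hs, Set.mem_compl_iff, Set.mem_singleton_iff]; positivity
    simpa [Function.comp_def] using h1.comp h2

/-! ### Smoothness of the submodel at one observation -/

section SmoothAt

variable {d : ℕ} {𝒳 E : Type*} [MeasurableSpace 𝒳] [SeminormedAddCommGroup E]

/-- Smoothness of the submodel at the observation `x`, with all derivatives bounded by `C`. -/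
structure SmoothAt (M : Model d 𝒳 E) (sub : Vec d → Vec d → E → E) (θ₀ : Vec d) (η₀ : E) (δ C : ℝ) (x : 𝒳) :
    Prop where
  pos : ∀ η ∈ M.H, ‖η - η₀‖ < δ → ∀ t ∈ Metric.ball θ₀ δ, ∀ θ ∈ Metric.ball θ₀ δ,
    0 < M.lik t (sub t θ η) x
  diff : ∀ η ∈ M.H, ‖η - η₀‖ < δ → ∀ θ ∈ Metric.ball θ₀ δ,
    DifferentiableOn ℝ (fun t => M.ell sub t θ η x) (Metric.ball θ₀ δ)
  contDiff : ∀ η ∈ M.H, ‖η - η₀‖ < δ → ∀ i, ContDiffOn ℝ 2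
    (fun p : Vec d × Vec d => M.ellT sub i p.1 p.2 η x) (Metric.ball θ₀ δ ×ˢ Metric.ball θ₀ δ)
  bound : ∀ η ∈ M.H, ‖η - η₀‖ < δ → ∀ t ∈ Metric.ball θ₀ δ, ∀ θ ∈ Metric.ball θ₀ δ,
    (∀ i, |M.ellT sub i t θ η x| ≤ C) ∧
    (∀ i j, |M.ellTT sub i j t θ η x| ≤ C) ∧
    (∀ i j k, |M.ellTTT sub i j k t θ η x| ≤ C) ∧
    (∀ i j, |M.ellTθ sub i j t θ η x| ≤ C) ∧
    (∀ i j k, |M.ellTθθ sub i j k t θ η x| ≤ C) ∧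
    (∀ i j k, |M.ellTTθ sub i j k t θ η x| ≤ C)

/-- The null set is fixed before the radius δ', so later arguments may shrink the radius while
keeping the same observations and envelope. -/
theorem Model.AssumptionB1.exists_smoothAt {M : Model d 𝒳 E} {sub : Vec d → Vec d → E → E} {θ₀ : Vec d}
    {η₀ : E} (h : M.AssumptionB1 sub θ₀ η₀) :
    ∃ δ > 0, Metric.ball θ₀ δ ⊆ M.Θ ∧
      (∀ t ∈ Metric.ball θ₀ δ, ∀ θ ∈ Metric.ball θ₀ δ, ∀ η ∈ M.H, ‖η - η₀‖ < δ →
        sub t θ η ∈ M.H) ∧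
      ∃ F : 𝒳 → ℝ, Integrable F (M.law θ₀ η₀) ∧
        ∀ᵐ x ∂(M.law θ₀ η₀), ∀ δ' ≤ δ, SmoothAt M sub θ₀ η₀ δ' (F x) x := by
  obtain ⟨δ, hδ, hball, hsub, hsm, F, hF, hbd⟩ := h
  have hmem : ∀ δ' ≤ δ, ∀ t ∈ Metric.ball θ₀ δ', ∀ θ ∈ Metric.ball θ₀ δ', ∀ η ∈ M.H,
      ‖η - η₀‖ < δ' → (t, θ, η) ∈ M.nbhd θ₀ η₀ δ := by
    intro δ' hδ' t ht θ hθ η hη hηd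
    have ht' := Metric.ball_subset_ball hδ' ht
    have hθ' := Metric.ball_subset_ball hδ' hθ
    exact ⟨⟨hball ht', by simpa [dist_eq_norm] using ht'⟩,
      ⟨hball hθ', by simpa [dist_eq_norm] using hθ'⟩, hη, hηd.trans_le hδ'⟩
  refine ⟨δ, hδ, hball, fun t ht θ hθ η hη hηd => hsub _ (hmem δ le_rfl t ht θ hθ η hη hηd), F, hF,
    ?_⟩
  filter_upwards [hsm, hbd] with x hx hxb
  intro δ' hδ'
  have hbb := Metric.ball_subset_ball (x := θ₀) hδ'
  refine ⟨fun η hη hηd t ht θ hθ => (hx η hη (hηd.trans_le hδ')).1 t (hbb ht) θ (hbb hθ),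
    fun η hη hηd θ hθ => ((hx η hη (hηd.trans_le hδ')).2.1 θ (hbb hθ)).mono hbb,
    fun η hη hηd i => ((hx η hη (hηd.trans_le hδ')).2.2 i).mono (Set.prod_mono hbb hbb),
    fun η hη hηd t ht θ hθ => (hxb _ (hmem δ' hδ' t ht θ hθ η hη hηd)).2⟩

namespace SmoothAt

variable {M : Model d 𝒳 E} {sub : Vec d → Vec d → E → E} {θ₀ : Vec d} {η₀ : E} {δ C : ℝ} {x : 𝒳} {η : E}

theorem differentiableOn_ellT (h : SmoothAt M sub θ₀ η₀ δ C x) (hη : η ∈ M.H)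
    (hηd : ‖η - η₀‖ < δ) (i : Fin d) : DifferentiableOn ℝ
      (fun p : Vec d × Vec d => M.ellT sub i p.1 p.2 η x) (Metric.ball θ₀ δ ×ˢ Metric.ball θ₀ δ) :=
  (h.contDiff η hη hηd i).differentiableOn two_ne_zero

theorem differentiableOn_ellTT (h : SmoothAt M sub θ₀ η₀ δ C x) (hη : η ∈ M.H)
    (hηd : ‖η - η₀‖ < δ) (i j : Fin d) : DifferentiableOn ℝ
      (fun p : Vec d × Vec d => M.ellTT sub i j p.1 p.2 η x) (Metric.ball θ₀ δ ×ˢ Metric.ball θ₀ δ) :=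
  differentiableOn_partial_fst Metric.isOpen_ball Metric.isOpen_ball (h.contDiff η hη hηd i) _

theorem differentiableOn_ellTθ (h : SmoothAt M sub θ₀ η₀ δ C x) (hη : η ∈ M.H)
    (hηd : ‖η - η₀‖ < δ) (i j : Fin d) : DifferentiableOn ℝ
      (fun p : Vec d × Vec d => M.ellTθ sub i j p.1 p.2 η x) (Metric.ball θ₀ δ ×ˢ Metric.ball θ₀ δ) :=
  differentiableOn_partial_snd Metric.isOpen_ball Metric.isOpen_ball (h.contDiff η hη hηd i) _

theorem ell_taylor (h : SmoothAt M sub θ₀ η₀ δ C x) (hη : η ∈ M.H) (hηd : ‖η - η₀‖ < δ)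
    {t t' θ : Vec d} (ht : t ∈ Metric.ball θ₀ δ) (ht' : t' ∈ Metric.ball θ₀ δ)
    (hθ : θ ∈ Metric.ball θ₀ δ) :
    |M.ell sub t' θ η x - M.ell sub t θ η x - ∑ i, M.ellT sub i t θ η x * (t' - t) i
      - (∑ i, (∑ j, M.ellTT sub i j t θ η x * (t' - t) j) * (t' - t) i) / 2|
      ≤ d ^ 3 * C * ‖t' - t‖ ^ 3 :=
  abs_taylor_three_le_of_partials (g := fun s => M.ell sub s θ η x)
    (g₁ := fun i s => M.ellT sub i s θ η x) (g₂ := fun i j s => M.ellTT sub i j s θ η x)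
    (g₃ := fun i j k s => M.ellTTT sub i j k s θ η x)
    (h.diff η hη hηd θ hθ) (fun i => (h.differentiableOn_ellT hη hηd i).partial_fst hθ)
    (fun i j => (h.differentiableOn_ellTT hη hηd i j).partial_fst hθ)
    (fun _ _ => rfl) (fun _ _ _ => rfl) (fun _ _ _ _ => rfl)
    (fun p hp => (h.bound η hη hηd p hp θ hθ).2.2.1) ht ht'

theorem ellT_taylor (h : SmoothAt M sub θ₀ η₀ δ C x) (hη : η ∈ M.H) (hηd : ‖η - η₀‖ < δ)
    {t t' θ : Vec d} (ht : t ∈ Metric.ball θ₀ δ) (ht' : t' ∈ Metric.ball θ₀ δ)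
    (hθ : θ ∈ Metric.ball θ₀ δ) (i : Fin d) :
    |M.ellT sub i t' θ η x - M.ellT sub i t θ η x - ∑ j, M.ellTT sub i j t θ η x * (t' - t) j|
      ≤ d ^ 2 * C * ‖t' - t‖ ^ 2 :=
  abs_taylor_two_le_of_partials (g := fun s => M.ellT sub i s θ η x)
    (g₁ := fun j s => M.ellTT sub i j s θ η x) (g₂ := fun j k s => M.ellTTT sub i j k s θ η x)
    ((h.differentiableOn_ellT hη hηd i).partial_fst hθ)
    (fun j => (h.differentiableOn_ellTT hη hηd i j).partial_fst hθ)
    (fun _ _ => rfl) (fun _ _ _ => rfl)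
    (fun p hp j k => (h.bound η hη hηd p hp θ hθ).2.2.1 i j k) ht ht'

theorem ellTT_lipschitz (h : SmoothAt M sub θ₀ η₀ δ C x) (hη : η ∈ M.H) (hηd : ‖η - η₀‖ < δ)
    {t θ θ' : Vec d} (ht : t ∈ Metric.ball θ₀ δ) (hθ : θ ∈ Metric.ball θ₀ δ)
    (hθ' : θ' ∈ Metric.ball θ₀ δ) (i j : Fin d) :
    |M.ellTT sub i j t θ' η x - M.ellTT sub i j t θ η x| ≤ d * C * ‖θ' - θ‖ :=
  abs_sub_le_of_partials (g := fun s => M.ellTT sub i j t s η x)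
    ((h.differentiableOn_ellTT hη hηd i j).partial_snd ht)
    (fun p hp k => (h.bound η hη hηd t ht p hp).2.2.2.2.2 i j k) hθ hθ'

theorem ellTθ_lipschitz (h : SmoothAt M sub θ₀ η₀ δ C x) (hη : η ∈ M.H) (hηd : ‖η - η₀‖ < δ)
    {t θ θ' : Vec d} (ht : t ∈ Metric.ball θ₀ δ) (hθ : θ ∈ Metric.ball θ₀ δ)
    (hθ' : θ' ∈ Metric.ball θ₀ δ) (i j : Fin d) :
    |M.ellTθ sub i j t θ' η x - M.ellTθ sub i j t θ η x| ≤ d * C * ‖θ' - θ‖ :=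
  abs_sub_le_of_partials (g := fun s => M.ellTθ sub i j t s η x)
    ((h.differentiableOn_ellTθ hη hηd i j).partial_snd ht)
    (fun p hp k => (h.bound η hη hηd t ht p hp).2.2.2.2.1 i j k) hθ hθ'

theorem hasDerivAt_ellT_snd (h : SmoothAt M sub θ₀ η₀ δ C x) (hη : η ∈ M.H) (hηd : ‖η - η₀‖ < δ)
    {t θ v : Vec d} {s : ℝ} (ht : t ∈ Metric.ball θ₀ δ) (hθ : θ + s • v ∈ Metric.ball θ₀ δ)
    (i : Fin d) :
    HasDerivAt (fun s : ℝ => M.ellT sub i t (θ + s • v) η x)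
      (∑ j, M.ellTθ sub i j t (θ + s • v) η x * v j) s :=
  hasDerivAt_line (g := fun q => M.ellT sub i t q η x)
    (((h.differentiableOn_ellT hη hηd i).partial_snd ht).differentiableAt
      (Metric.isOpen_ball.mem_nhds hθ))

theorem hasDerivAt_ell_fst (h : SmoothAt M sub θ₀ η₀ δ C x) (hη : η ∈ M.H) (hηd : ‖η - η₀‖ < δ)
    {t θ : Vec d} (ht : t ∈ Metric.ball θ₀ δ) (hθ : θ ∈ Metric.ball θ₀ δ) (i : Fin d) :
    HasDerivAt (fun s : ℝ => M.ell sub (t + s • EuclideanSpace.single i 1) θ η x)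
      (M.ellT sub i t θ η x) 0 := by
  have h1 := hasDerivAt_line (g := fun q => M.ell sub q θ η x) (p := t) (s := 0)
    (v := EuclideanSpace.single i 1) (by
      simpa using (h.diff η hη hηd θ hθ).differentiableAt (Metric.isOpen_ball.mem_nhds ht))
  rw [← clm_apply_eq_sum] at h1
  simpa [Model.ellT] using h1

end SmoothAt

end SmoothAt


/-! ### Information identities -/

/-- A jointly continuous family that vanishes almost everywhere for each parameter value in an
open set vanishes almost everywhere simultaneously. -/
theorem ae_forall_eq_zero_of_continuousOn {𝒳 W : Type*} [MeasurableSpace 𝒳]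
    [NormedAddCommGroup W] [SecondCountableTopology W] {μ : Measure 𝒳} {f : W → 𝒳 → ℝ} {U : Set W}
    (hU : IsOpen U) {p : 𝒳 → Prop} (hf : ∀ᵐ x ∂μ, ContinuousOn (fun z => f z x) U)
    (h : ∀ z ∈ U, ∀ᵐ x ∂μ, p x → f z x = 0) : ∀ᵐ x ∂μ, p x → ∀ z ∈ U, f z x = 0 := by
  -- Countably many parameters leave a single null set; by continuity a nonzero value would persist
  -- on an open set, which the dense sequence meets.
  have hD : ∀ᵐ x ∂μ, ∀ k, TopologicalSpace.denseSeq W k ∈ U → p x →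
      f (TopologicalSpace.denseSeq W k) x = 0 := by
    rw [ae_all_iff]
    intro k
    by_cases hk : TopologicalSpace.denseSeq W k ∈ U
    · filter_upwards [h _ hk] with x hx _ hp using hx hp
    · exact Eventually.of_forall fun x hk' => absurd hk' hk
  filter_upwards [hD, hf] with x hx hc hp z hz
  by_contra hne
  have hopen : IsOpen (U ∩ (fun z => f z x) ⁻¹' {0}ᶜ) :=
    hc.isOpen_inter_preimage hU isOpen_compl_singleton
  obtain ⟨k, hkU, hk⟩ := (TopologicalSpace.denseRange_denseSeq W).exists_mem_open hopen ⟨z, hz, hne⟩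
  exact hk (hx k hkU hp)

/-! ### Differentiation under the integral sign -/

section DiffIntegral

variable {𝒳 W : Type*} [MeasurableSpace 𝒳] [NormedAddCommGroup W] [NormedSpace ℝ W]
  {μ : Measure 𝒳}

/-- Differentiating the identity `∫ g z dμ = c` under the integral sign. -/
theorem integral_fderiv_eq_zero {g : W → 𝒳 → ℝ} {U : Set W} (hU : IsOpen U) {c : ℝ} {G : 𝒳 → ℝ}
    (hG : Integrable G μ) (hgi : ∀ z ∈ U, Integrable (g z) μ) (hgc : ∀ z ∈ U, ∫ x, g z x ∂μ = c)
    (hgd : ∀ᵐ x ∂μ, DifferentiableOn ℝ (fun z => g z x) U)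
    (hgb : ∀ᵐ x ∂μ, ∀ z ∈ U, ‖fderiv ℝ (fun z => g z x) z‖ ≤ G x) (u : W) {z : W} (hz : z ∈ U) :
    Integrable (fun x => fderiv ℝ (fun z => g z x) z u) μ ∧
      ∫ x, fderiv ℝ (fun z => g z x) z u ∂μ = 0 := by
  have hcont : Continuous fun s : ℝ => z + s • u := by fun_prop
  have hnhds : (fun s : ℝ => z + s • u) ⁻¹' U ∈ 𝓝 (0 : ℝ) :=
    hcont.continuousAt.preimage_mem_nhds (hU.mem_nhds (by simpa using hz))
  have hder : ∀ᵐ x ∂μ, ∀ s ∈ (fun s : ℝ => z + s • u) ⁻¹' U,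
      HasDerivAt (fun s : ℝ => g (z + s • u) x) (fderiv ℝ (fun z => g z x) (z + s • u) u) s := by
    filter_upwards [hgd] with x hx s hs
    have hl : HasDerivAt (fun s : ℝ => z + s • u) u s := by
      simpa using ((hasDerivAt_id s).smul_const u).const_add z
    exact (hx.differentiableAt (hU.mem_nhds hs)).hasFDerivAt.comp_hasDerivAt s hl
  have hmeas : AEMeasurable (fun x => fderiv ℝ (fun z => g z x) (z + (0 : ℝ) • u) u) μ := by
    refine aemeasurable_of_hasDerivAt (f := fun s x => g (z + s • u) x) ?_ ?_
    · filter_upwards [hnhds] with s hs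
      exact (hgi _ hs).aestronglyMeasurable.aemeasurable
    · filter_upwards [hder] with x hx
      exact hx 0 (mem_of_mem_nhds hnhds)
  obtain ⟨h1, h2⟩ := hasDerivAt_integral_of_dominated_loc_of_deriv_le (μ := μ) (x₀ := (0 : ℝ))
    (F := fun s x => g (z + s • u) x)
    (F' := fun s x => fderiv ℝ (fun z => g z x) (z + s • u) u) (bound := fun x => G x * ‖u‖)
    hnhds (by
      filter_upwards [hnhds] with s hs
      exact (hgi _ hs).aestronglyMeasurable)
    (by simpa using hgi z hz) hmeas.aestronglyMeasurable (by
      filter_upwards [hgb] with x hx s hs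
      exact (ContinuousLinearMap.le_opNorm _ _).trans
        (mul_le_mul_of_nonneg_right (hx _ hs) (norm_nonneg _)))
    (hG.mul_const _) hder
  have h3 : HasDerivAt (fun s : ℝ => ∫ x, g (z + s • u) x ∂μ) 0 0 := by
    refine (hasDerivAt_const (0 : ℝ) c).congr_of_eventuallyEq ?_
    filter_upwards [hnhds] with s hs using hgc _ hs
  have h4 := h2.unique h3
  simp only [zero_smul, add_zero] at h1 h4
  exact ⟨h1, h4⟩

/-- The first-order lemma applies twice, the second time to the directional derivatives, whose
integral is constantly zero. -/
theorem integral_fderiv_fderiv_eq_zero {f : W → 𝒳 → ℝ} {U : Set W} (hU : IsOpen U) {c : ℝ}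
    {G : 𝒳 → ℝ} (hG : Integrable G μ) (hfi : ∀ z ∈ U, Integrable (f z) μ)
    (hfc : ∀ z ∈ U, ∫ x, f z x ∂μ = c) (hfd : ∀ᵐ x ∂μ, ContDiffOn ℝ 2 (fun z => f z x) U)
    (hfb : ∀ᵐ x ∂μ, ∀ z ∈ U, ∀ m : ℕ, 1 ≤ m → m ≤ 2 →
      ‖iteratedFDeriv ℝ m (fun z => f z x) z‖ ≤ G x) (u v : W) {z : W} (hz : z ∈ U) :
    ∫ x, fderiv ℝ (fun z => fderiv ℝ (fun z => f z x) z u) z v ∂μ = 0 := by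
  have hb1 : ∀ᵐ x ∂μ, ∀ z ∈ U, ‖fderiv ℝ (fun z => f z x) z‖ ≤ G x := by
    filter_upwards [hfb] with x hx z hz
    have := hx z hz 1 le_rfl one_le_two
    rwa [norm_iteratedFDeriv_one] at this
  have hd1 : ∀ᵐ x ∂μ, DifferentiableOn ℝ (fun z => f z x) U := by
    filter_upwards [hfd] with x hx using hx.differentiableOn two_ne_zero
  have step : ∀ z ∈ U, Integrable (fun x => fderiv ℝ (fun z => f z x) z u) μ ∧
      ∫ x, fderiv ℝ (fun z => f z x) z u ∂μ = 0 := fun z hz =>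
    integral_fderiv_eq_zero hU hG hfi hfc hd1 hb1 u hz
  refine (integral_fderiv_eq_zero (g := fun z x => fderiv ℝ (fun z => f z x) z u) hU
    (hG.mul_const ‖u‖) (fun z hz => (step z hz).1) (fun z hz => (step z hz).2) ?_ ?_ v hz).2
  · filter_upwards [hfd] with x hx
    exact ((hx.fderiv_of_isOpen hU (m := 1) (by norm_num)).differentiableOn one_ne_zero).clm_apply
      (differentiableOn_const u)
  · filter_upwards [hfd, hfb] with x hx hxb z hz
    have hdd : DifferentiableAt ℝ (fderiv ℝ fun z => f z x) z :=
      ((hx.fderiv_of_isOpen hU (m := 1) (by norm_num)).differentiableOn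
        one_ne_zero).differentiableAt (hU.mem_nhds hz)
    have h2 := hxb z hz 2 one_le_two le_rfl
    rw [← norm_iteratedFDeriv_fderiv, norm_iteratedFDeriv_one] at h2
    have hfd' : HasFDerivAt (fun z => fderiv ℝ (fun z => f z x) z u)
        ((fderiv ℝ (fderiv ℝ fun z => f z x) z).flip u) z := by
      have := hdd.hasFDerivAt.clm_apply (hasFDerivAt_const u z)
      refine this.congr_fderiv ?_
      ext w
      simp
    rw [hfd'.fderiv]
    calc _ ≤ ‖(fderiv ℝ (fderiv ℝ fun z => f z x) z).flip‖ * ‖u‖ :=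
          ContinuousLinearMap.le_opNorm _ _
      _ ≤ G x * ‖u‖ := by
          rw [ContinuousLinearMap.opNorm_flip]
          exact mul_le_mul_of_nonneg_right h2 (norm_nonneg _)

end DiffIntegral

theorem Model.integral_law {d : ℕ} {𝒳 E : Type*} [MeasurableSpace 𝒳] {M : Model d 𝒳 E} (θ : Vec d) (η : E) (hm : Measurable (M.lik θ η))
    (h0 : ∀ x, 0 ≤ M.lik θ η x) (R : 𝒳 → ℝ) :
    ∫ x, R x ∂(M.law θ η) = ∫ x, M.lik θ η x * R x ∂M.μ := by
  rw [Model.law, integral_withDensity_eq_integral_toReal_smul hm.ennreal_ofReal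
    (Eventually.of_forall fun x => ENNReal.ofReal_lt_top)]
  refine integral_congr_ae (Eventually.of_forall fun x => ?_)
  simp only [ENNReal.toReal_ofReal (h0 x), smul_eq_mul]

/-! ### Bartlett identities for the least favorable submodel -/

section Information

variable {d : ℕ} {𝒳 E : Type*} [MeasurableSpace 𝒳] [SeminormedAddCommGroup E]
  {M : Model d 𝒳 E} {sub : Vec d → Vec d → E → E} {θ₀ : Vec d} {η₀ : E}

theorem SmoothAt.fderiv_lik {δ C : ℝ} {x : 𝒳} (h : SmoothAt M sub θ₀ η₀ δ C x) (hη₀ : η₀ ∈ M.H)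
    (hδ : 0 < δ) (hc : ContDiffOn ℝ 2 (fun p : Vec d × Vec d => M.lik p.1 (sub p.1 p.2 η₀) x)
      (Metric.ball θ₀ δ ×ˢ Metric.ball θ₀ δ)) (i : Fin d) {z : Vec d × Vec d}
    (hz : z ∈ Metric.ball θ₀ δ ×ˢ Metric.ball θ₀ δ) :
    fderiv ℝ (fun p : Vec d × Vec d => M.lik p.1 (sub p.1 p.2 η₀) x) z
        (EuclideanSpace.single i 1, 0)
      = M.lik z.1 (sub z.1 z.2 η₀) x * M.ellT sub i z.1 z.2 η₀ x := by
  have hpos : 0 < M.lik z.1 (sub z.1 z.2 η₀) x := h.pos η₀ hη₀ (by simpa) z.1 hz.1 z.2 hz.2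
  have hd : DifferentiableAt ℝ (fun p : Vec d × Vec d => M.lik p.1 (sub p.1 p.2 η₀) x) z :=
    (hc.differentiableOn two_ne_zero).differentiableAt
      ((Metric.isOpen_ball.prod Metric.isOpen_ball).mem_nhds hz)
  have hl := hd.hasFDerivAt.log hpos.ne'
  have : M.ellT sub i z.1 z.2 η₀ x = fderiv ℝ (fun p : Vec d × Vec d =>
      Real.log (M.lik p.1 (sub p.1 p.2 η₀) x)) z (EuclideanSpace.single i 1, 0) :=
    fderiv_partial_fst hl.differentiableAt _
  rw [this, hl.fderiv]
  simp only [_root_.smul_apply, smul_eq_mul]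
  field_simp

/-- On the diagonal t = θ the submodel is t ↦ lik(t, η₀), so the derivative in direction (e_i, e_i)
is lik times the ordinary score. Subtracting the derivative in direction (e_i, 0), which is lik
times ℓ̇, leaves direction (0, e_i). -/
theorem SmoothAt.fderiv_lik_diag {δ C : ℝ} {x : 𝒳} (h : SmoothAt M sub θ₀ η₀ δ C x)
    (hη₀ : η₀ ∈ M.H) (hδ : 0 < δ) (hball : Metric.ball θ₀ δ ⊆ M.Θ)
    (hA2 : ∀ θ ∈ M.Θ, ∀ η ∈ M.H, sub θ θ η = η)
    (hc : ContDiffOn ℝ 2 (fun p : Vec d × Vec d => M.lik p.1 (sub p.1 p.2 η₀) x)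
      (Metric.ball θ₀ δ ×ˢ Metric.ball θ₀ δ)) (i : Fin d) :
    fderiv ℝ (fun p : Vec d × Vec d => M.lik p.1 (sub p.1 p.2 η₀) x) (θ₀, θ₀)
        (0, EuclideanSpace.single i 1)
      = M.lik θ₀ η₀ x * (M.scoreθ θ₀ η₀ i x - M.ellT sub i θ₀ θ₀ η₀ x) := by
  have hθ₀ : θ₀ ∈ Metric.ball θ₀ δ := Metric.mem_ball_self hδ
  have hs0 : sub θ₀ θ₀ η₀ = η₀ := hA2 _ (hball hθ₀) _ hη₀
  have hpos : 0 < M.lik θ₀ η₀ x := by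
    have := h.pos η₀ hη₀ (by simpa) θ₀ hθ₀ θ₀ hθ₀
    rwa [hs0] at this
  have hd : DifferentiableAt ℝ (fun p : Vec d × Vec d => M.lik p.1 (sub p.1 p.2 η₀) x) (θ₀, θ₀) :=
    (hc.differentiableOn two_ne_zero).differentiableAt
      ((Metric.isOpen_ball.prod Metric.isOpen_ball).mem_nhds ⟨hθ₀, hθ₀⟩)
  have hdiag : HasFDerivAt (fun t : Vec d => (t, t))
      ((ContinuousLinearMap.id ℝ (Vec d)).prod (ContinuousLinearMap.id ℝ (Vec d))) θ₀ :=
    (hasFDerivAt_id θ₀).prodMk (hasFDerivAt_id θ₀)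
  have hd' : HasFDerivAt (fun p : Vec d × Vec d => M.lik p.1 (sub p.1 p.2 η₀) x)
      (fderiv ℝ (fun p : Vec d × Vec d => M.lik p.1 (sub p.1 p.2 η₀) x) (θ₀, θ₀))
      ((fun t : Vec d => (t, t)) θ₀) := hd.hasFDerivAt
  have hcomp : HasFDerivAt (fun t : Vec d => M.lik t (sub t t η₀) x) _ θ₀ :=
    HasFDerivAt.comp (f := fun t : Vec d => (t, t)) θ₀ hd' hdiag
  have hcomp' := hcomp.congr_of_eventuallyEq (f₁ := fun t => M.lik t η₀ x) (by
    filter_upwards [Metric.isOpen_ball.mem_nhds hθ₀] with t ht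
    rw [hA2 t (hball ht) η₀ hη₀])
  have hl := hcomp'.log hpos.ne'
  have hscore : M.lik θ₀ η₀ x * M.scoreθ θ₀ η₀ i x
      = fderiv ℝ (fun p : Vec d × Vec d => M.lik p.1 (sub p.1 p.2 η₀) x) (θ₀, θ₀)
        (EuclideanSpace.single i 1, EuclideanSpace.single i 1) := by
    rw [Model.scoreθ, hl.fderiv]
    simp only [_root_.smul_apply, smul_eq_mul, ContinuousLinearMap.comp_apply,
      ContinuousLinearMap.prod_apply, ContinuousLinearMap.id_apply]
    field_simp
  have h1 := h.fderiv_lik hη₀ hδ hc i (z := (θ₀, θ₀)) ⟨hθ₀, hθ₀⟩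
  simp only [hs0] at h1
  rw [mul_sub, hscore, ← h1, ← map_sub]
  simp

/-- The identity ∫ lik(t, η_t(θ, η₀)) dμ = 1 is differentiated twice: first in t_i, which gives lik
times ℓ̇_i, then by the product rule in t_j for the first claim and in θ_j for the second. -/
theorem Model.integral_eq_zero_of_diff (hη₀ : η₀ ∈ M.H)
    (hA2 : ∀ θ ∈ M.Θ, ∀ η ∈ M.H, sub θ θ η = η)
    (hreg : M.DiffUnderIntegral sub θ₀ η₀) {δ₁ : ℝ} (hδ₁ : 0 < δ₁) {F : 𝒳 → ℝ}
    (hsm : ∀ᵐ x ∂(M.law θ₀ η₀), ∀ δ' ≤ δ₁, SmoothAt M sub θ₀ η₀ δ' (F x) x) (i j : Fin d) :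
    ∫ x, (M.ellT sub i θ₀ θ₀ η₀ x * M.ellT sub j θ₀ θ₀ η₀ x + M.ellTT sub i j θ₀ θ₀ η₀ x)
        ∂(M.law θ₀ η₀) = 0 ∧
    ∫ x, (M.ellT sub i θ₀ θ₀ η₀ x * (M.scoreθ θ₀ η₀ j x - M.ellT sub j θ₀ θ₀ η₀ x)
      + M.ellTθ sub i j θ₀ θ₀ η₀ x) ∂(M.law θ₀ η₀) = 0 := by
  obtain ⟨δ₂, hδ₂, hball₂, hsub, G, hG, hGx⟩ := hreg
  set δ := min δ₁ δ₂ with hδdef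
  have hδ : 0 < δ := lt_min hδ₁ hδ₂
  have hbb : Metric.ball θ₀ δ ⊆ Metric.ball θ₀ δ₂ := Metric.ball_subset_ball (min_le_right _ _)
  have hball : Metric.ball θ₀ δ ⊆ M.Θ := hbb.trans hball₂
  have hθ₀ : θ₀ ∈ Metric.ball θ₀ δ := Metric.mem_ball_self hδ
  have hs0 : sub θ₀ θ₀ η₀ = η₀ := hA2 _ (hball hθ₀) _ hη₀
  have hlm : Measurable (M.lik θ₀ η₀) := M.lik_measurable _ (hball hθ₀) _ hη₀
  have hl0 : ∀ x, 0 ≤ M.lik θ₀ η₀ x := M.lik_nonneg _ (hball hθ₀) _ hη₀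
  set U : Set (Vec d × Vec d) := Metric.ball θ₀ δ ×ˢ Metric.ball θ₀ δ with hU
  have hUo : IsOpen U := Metric.isOpen_ball.prod Metric.isOpen_ball
  have hz₀ : ((θ₀, θ₀) : Vec d × Vec d) ∈ U := ⟨hθ₀, hθ₀⟩
  set f : Vec d × Vec d → 𝒳 → ℝ := fun p x => M.lik p.1 (sub p.1 p.2 η₀) x with hf
  have hUsub : ∀ z ∈ U, z.1 ∈ M.Θ ∧ sub z.1 z.2 η₀ ∈ M.H ∧
      M.law z.1 (sub z.1 z.2 η₀) ≪ M.law θ₀ η₀ := fun z hz =>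
    ⟨hball hz.1, hsub _ (hbb hz.1) _ (hbb hz.2)⟩
  have hfm : ∀ z ∈ U, Measurable (f z) := fun z hz =>
    M.lik_measurable _ (hUsub z hz).1 _ (hUsub z hz).2.1
  have hf0 : ∀ z ∈ U, ∀ x, 0 ≤ f z x := fun z hz =>
    M.lik_nonneg _ (hUsub z hz).1 _ (hUsub z hz).2.1
  have hfl : ∀ z ∈ U, ∫⁻ x, ENNReal.ofReal (f z x) ∂M.μ = 1 := fun z hz =>
    M.lik_lintegral _ (hUsub z hz).1 _ (hUsub z hz).2.1
  have hfi : ∀ z ∈ U, Integrable (f z) M.μ := fun z hz => by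
    refine ⟨(hfm z hz).aestronglyMeasurable, ?_⟩
    rw [hasFiniteIntegral_iff_ofReal (Eventually.of_forall (hf0 z hz)), hfl z hz]
    exact ENNReal.one_lt_top
  have hfc : ∀ z ∈ U, ∫ x, f z x ∂M.μ = 1 := fun z hz => by
    rw [integral_eq_lintegral_of_nonneg_ae (Eventually.of_forall (hf0 z hz))
      (hfm z hz).aestronglyMeasurable, hfl z hz, ENNReal.toReal_one]
  have hfd : ∀ᵐ x ∂M.μ, ContDiffOn ℝ 2 (fun z => f z x) U := by
    filter_upwards [hGx] with x hx using hx.1.mono (Set.prod_mono hbb hbb)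
  have hfb : ∀ᵐ x ∂M.μ, ∀ z ∈ U, ∀ m : ℕ, 1 ≤ m → m ≤ 2 →
      ‖iteratedFDeriv ℝ m (fun z => f z x) z‖ ≤ G x := by
    filter_upwards [hGx] with x hx z hz using hx.2 z ⟨hbb hz.1, hbb hz.2⟩
  -- The log-likelihood calculus is only valid where the true density is positive. Where it
  -- vanishes, absolute continuity makes all nearby densities vanish too, so their second
  -- derivatives contribute nothing to the integral over μ.
  have hzero : ∀ᵐ x ∂M.μ, M.lik θ₀ η₀ x = 0 → ∀ z ∈ U, f z x = 0 := by
    refine ae_forall_eq_zero_of_continuousOn hUo ?_ fun z hz => ?_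
    · filter_upwards [hfd] with x hx using hx.continuousOn
    · have hne : ∀ᵐ x ∂(M.law θ₀ η₀), M.lik θ₀ η₀ x ≠ 0 := by
        rw [Model.law, ae_withDensity_iff hlm.ennreal_ofReal]
        filter_upwards with x hx h
        simp [h] at hx
      have : ∀ᵐ x ∂(M.law z.1 (sub z.1 z.2 η₀)), M.lik θ₀ η₀ x ≠ 0 := (hUsub z hz).2.2.ae_le hne
      rw [Model.law, ae_withDensity_iff (hfm z hz).ennreal_ofReal] at this
      filter_upwards [this] with x hx h0
      by_contra hfz
      exact hx (by simpa using lt_of_le_of_ne (hf0 z hz x) (Ne.symm hfz)) h0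
  have hpos : ∀ᵐ x ∂M.μ, M.lik θ₀ η₀ x ≠ 0 → SmoothAt M sub θ₀ η₀ δ (F x) x := by
    have := hsm
    rw [Model.law, ae_withDensity_iff hlm.ennreal_ofReal] at this
    filter_upwards [this] with x hx h0
    exact hx (by simpa using lt_of_le_of_ne (hl0 x) (Ne.symm h0)) δ (min_le_left _ _)
  have hvanish : ∀ x, (∀ z ∈ U, f z x = 0) → ∀ u v : Vec d × Vec d,
      fderiv ℝ (fun z => fderiv ℝ (fun z => f z x) z u) (θ₀, θ₀) v = 0 := by
    intro x hx u v
    have : (fun z => fderiv ℝ (fun z => f z x) z u) =ᶠ[𝓝 (θ₀, θ₀)] fun _ => 0 := by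
      filter_upwards [hUo.mem_nhds hz₀] with z hz
      have : (fun z => f z x) =ᶠ[𝓝 z] fun _ => 0 := by
        filter_upwards [hUo.mem_nhds hz] with w hw using hx w hw
      rw [this.fderiv_eq]; simp
    rw [this.fderiv_eq]; simp
  -- the second derivative in the direction `(e_i, 0)`, then `v`
  have hprod : ∀ x, SmoothAt M sub θ₀ η₀ δ (F x) x → ContDiffOn ℝ 2 (fun z => f z x) U →
      ∀ v : Vec d × Vec d, fderiv ℝ (fun z => fderiv ℝ (fun z => f z x) z
        (EuclideanSpace.single i 1, 0)) (θ₀, θ₀) v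
      = M.lik θ₀ η₀ x * fderiv ℝ (fun p : Vec d × Vec d => M.ellT sub i p.1 p.2 η₀ x) (θ₀, θ₀) v
        + M.ellT sub i θ₀ θ₀ η₀ x * fderiv ℝ (fun z => f z x) (θ₀, θ₀) v := by
    intro x hx hxc v
    have hev : (fun z => fderiv ℝ (fun z => f z x) z (EuclideanSpace.single i 1, 0))
        =ᶠ[𝓝 (θ₀, θ₀)] fun z => f z x * M.ellT sub i z.1 z.2 η₀ x := by
      filter_upwards [hUo.mem_nhds hz₀] with z hz using hx.fderiv_lik hη₀ hδ hxc i hz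
    have hd1 : DifferentiableAt ℝ (fun z => f z x) (θ₀, θ₀) :=
      (hxc.differentiableOn two_ne_zero).differentiableAt (hUo.mem_nhds hz₀)
    have hd2 : DifferentiableAt ℝ (fun p : Vec d × Vec d => M.ellT sub i p.1 p.2 η₀ x) (θ₀, θ₀) :=
      (hx.differentiableOn_ellT hη₀ (by simpa) i).differentiableAt (hUo.mem_nhds hz₀)
    rw [hev.fderiv_eq, fderiv_fun_mul hd1 hd2]
    simp [hf, hs0]
  have key : ∀ v : Vec d × Vec d, ∀ R : 𝒳 → ℝ,
      (∀ x, SmoothAt M sub θ₀ η₀ δ (F x) x → ContDiffOn ℝ 2 (fun z => f z x) U →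
        fderiv ℝ (fun z => fderiv ℝ (fun z => f z x) z (EuclideanSpace.single i 1, 0)) (θ₀, θ₀) v
          = M.lik θ₀ η₀ x * R x) → ∫ x, R x ∂(M.law θ₀ η₀) = 0 := by
    intro v R hR
    rw [Model.integral_law θ₀ η₀ hlm hl0, ← integral_fderiv_fderiv_eq_zero hUo hG hfi hfc hfd hfb
      (EuclideanSpace.single i 1, 0) v hz₀]
    refine integral_congr_ae ?_
    filter_upwards [hfd, hzero, hpos] with x hxc hxz hxp
    by_cases h0 : M.lik θ₀ η₀ x = 0
    · simp only [h0, zero_mul]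
      exact (hvanish x (hxz h0) _ _).symm
    · exact (hR x (hxp h0) hxc).symm
  constructor
  · refine key (EuclideanSpace.single j 1, 0) _ fun x hx hxc => ?_
    have hd2 : DifferentiableAt ℝ (fun p : Vec d × Vec d => M.ellT sub i p.1 p.2 η₀ x) (θ₀, θ₀) :=
      (hx.differentiableOn_ellT hη₀ (by simpa) i).differentiableAt (hUo.mem_nhds hz₀)
    have e1 := hx.fderiv_lik hη₀ hδ hxc j hz₀
    simp only [hs0] at e1
    have e2 : M.ellTT sub i j θ₀ θ₀ η₀ x = _ := fderiv_partial_fst hd2 (EuclideanSpace.single j 1)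
    rw [hprod x hx hxc, e1, ← e2]
    ring
  · refine key (0, EuclideanSpace.single j 1) _ fun x hx hxc => ?_
    have hd2 : DifferentiableAt ℝ (fun p : Vec d × Vec d => M.ellT sub i p.1 p.2 η₀ x) (θ₀, θ₀) :=
      (hx.differentiableOn_ellT hη₀ (by simpa) i).differentiableAt (hUo.mem_nhds hz₀)
    have e1 := hx.fderiv_lik_diag hη₀ hδ hball hA2 hxc j
    have e2 : M.ellTθ sub i j θ₀ θ₀ η₀ x = _ := fderiv_partial_snd hd2 (EuclideanSpace.single j 1)
    rw [hprod x hx hxc, e1, ← e2]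
    ring

theorem Model.memLp_ellT {𝒟 : Set (ℝ → E)}
    {hscore : ∀ i, MemLp (M.scoreθ θ₀ η₀ i) 2 (M.law θ₀ η₀)}
    (hlf : M.IsLeastFavorable sub θ₀ η₀ 𝒟 hscore) (i : Fin d) :
    MemLp (M.ellT sub i θ₀ θ₀ η₀) 2 (M.law θ₀ η₀) :=
  (memLp_congr_ae (hlf i)).2 (Lp.memLp _)

/-- The second-order Bartlett identities: the expected second derivative of the least favorable
submodel is minus the efficient information, and the expected mixed derivative vanishes. -/
theorem Model.information_identities (hη₀ : η₀ ∈ M.H)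
    (hA2 : ∀ θ ∈ M.Θ, ∀ η ∈ M.H, sub θ θ η = η) {𝒟 : Set (ℝ → E)}
    {hscore : ∀ i, MemLp (M.scoreθ θ₀ η₀ i) 2 (M.law θ₀ η₀)}
    (hlf : M.IsLeastFavorable sub θ₀ η₀ 𝒟 hscore)
    (hreg : M.DiffUnderIntegral sub θ₀ η₀) {δ₁ : ℝ} (hδ₁ : 0 < δ₁) {F : 𝒳 → ℝ}
    (hsm : ∀ᵐ x ∂(M.law θ₀ η₀), ∀ δ' ≤ δ₁, SmoothAt M sub θ₀ η₀ δ' (F x) x) (i j : Fin d)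
    (hTT : Integrable (M.ellTT sub i j θ₀ θ₀ η₀) (M.law θ₀ η₀))
    (hTθ : Integrable (M.ellTθ sub i j θ₀ θ₀ η₀) (M.law θ₀ η₀)) :
    ∫ x, M.ellTT sub i j θ₀ θ₀ η₀ x ∂(M.law θ₀ η₀) = - M.effInfo θ₀ η₀ 𝒟 hscore i j ∧
    ∫ x, M.ellTθ sub i j θ₀ θ₀ η₀ x ∂(M.law θ₀ η₀) = 0 := by
  obtain ⟨h1, h2⟩ := Model.integral_eq_zero_of_diff hη₀ hA2 hreg hδ₁ hsm i j
  have hi := Model.memLp_ellT hlf i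
  have hj := Model.memLp_ellT hlf j
  have hij : Integrable (fun x => M.ellT sub i θ₀ θ₀ η₀ x * M.ellT sub j θ₀ θ₀ η₀ x)
      (M.law θ₀ η₀) := hi.integrable_mul hj
  have hijs : Integrable (fun x => M.ellT sub i θ₀ θ₀ η₀ x *
      (M.scoreθ θ₀ η₀ j x - M.ellT sub j θ₀ θ₀ η₀ x)) (M.law θ₀ η₀) :=
    hi.integrable_mul ((hscore j).sub hj)
  rw [integral_add hij hTT] at h1
  rw [integral_add hijs hTθ] at h2
  have e1 : ∫ x, M.ellT sub i θ₀ θ₀ η₀ x * M.ellT sub j θ₀ θ₀ η₀ x ∂(M.law θ₀ η₀)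
      = M.effInfo θ₀ η₀ 𝒟 hscore i j := by
    simp only [Model.effInfo, Matrix.of_apply]
    refine integral_congr_ae ?_
    filter_upwards [hlf i, hlf j] with x hxi hxj
    rw [hxi, hxj]
  -- The difference of score and efficient score is the projection on the nuisance tangent space, to
  -- which the efficient score is orthogonal. This is where least favorability makes the mixed
  -- derivative centred.
  have e2 : ∫ x, M.ellT sub i θ₀ θ₀ η₀ x * (M.scoreθ θ₀ η₀ j x - M.ellT sub j θ₀ θ₀ η₀ x)
      ∂(M.law θ₀ η₀) = 0 := by
    have : CompleteSpace (M.nuisanceTangent θ₀ η₀ 𝒟) :=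
      Submodule.topologicalClosure.completeSpace _
    have hor : inner ℝ (M.effScore θ₀ η₀ 𝒟 hscore i)
        ((M.nuisanceTangent θ₀ η₀ 𝒟).starProjection (hscore j).toLp) = 0 :=
      Submodule.starProjection_inner_eq_zero _ _ (Submodule.starProjection_apply_mem _ _)
    rw [L2.inner_def] at hor
    rw [← hor]
    refine integral_congr_ae ?_
    have hdec : (M.nuisanceTangent θ₀ η₀ 𝒟).starProjection (hscore j).toLp
        = (hscore j).toLp - M.effScore θ₀ η₀ 𝒟 hscore j := by
      rw [Model.effScore, sub_sub_cancel]
    rw [hdec]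
    filter_upwards [hlf i, hlf j, (hscore j).coeFn_toLp,
      Lp.coeFn_sub (hscore j).toLp (M.effScore θ₀ η₀ 𝒟 hscore j)] with x hxi hxj hs hsub
    rw [hsub, Pi.sub_apply, hs, hxi, hxj]
    simp [mul_comm]
  constructor
  · linarith
  · linarith

end Information


/-! ### The rate -/

section Rate

variable {n : ℕ} {r : ℝ}

theorem sqrt_natCast_eq_rpow (n : ℕ) : √(n : ℝ) = (n : ℝ) ^ (1 / 2 : ℝ) := Real.sqrt_eq_rpow _

theorem rateM_nonneg (r : ℝ) (n : ℕ) : 0 ≤ rateM r n := by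
  unfold rateM; positivity

theorem inv_sqrt_le_rateM (r : ℝ) (n : ℕ) : (√(n : ℝ))⁻¹ ≤ rateM r n := by
  rw [sqrt_natCast_eq_rpow, ← Real.rpow_neg n.cast_nonneg, rateM]
  have : 0 ≤ (n : ℝ) ^ (-2 * r + 1 / 2) := by positivity
  linarith

theorem one_le_sqrt_mul_rateM (hn : 0 < n) : 1 ≤ √(n : ℝ) * rateM r n := by
  have hs : 0 < √(n : ℝ) := Real.sqrt_pos.2 (by exact_mod_cast hn)
  calc (1 : ℝ) = √(n : ℝ) * (√(n : ℝ))⁻¹ := (mul_inv_cancel₀ hs.ne').symm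
    _ ≤ _ := mul_le_mul_of_nonneg_left (inv_sqrt_le_rateM r n) hs.le

theorem sqrt_mul_rpow_sq_le_rateM (hn : 0 < n) :
    √(n : ℝ) * ((n : ℝ) ^ (-r)) ^ 2 ≤ rateM r n := by
  have hn' : (0 : ℝ) < n := by exact_mod_cast hn
  have h : √(n : ℝ) * ((n : ℝ) ^ (-r)) ^ 2 = (n : ℝ) ^ (-2 * r + 1 / 2) := by
    rw [sqrt_natCast_eq_rpow, ← Real.rpow_natCast, ← Real.rpow_mul hn'.le, ← Real.rpow_add hn']
    congr 1
    push_cast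
    ring
  rw [h, rateM]
  have : 0 ≤ (n : ℝ) ^ (-(1 / 2) : ℝ) := by positivity
  linarith

/-- The left side is the geometric mean of the two summands n^{-1/2} and n^{-2r+1/2} of the rate. -/
theorem rpow_le_rateM (hn : 0 < n) : (n : ℝ) ^ (-r) ≤ rateM r n := by
  have hm := rateM_nonneg r n
  refine (sq_le_sq₀ (by positivity) hm).1 ?_
  have hs : 0 < √(n : ℝ) := Real.sqrt_pos.2 (by exact_mod_cast hn)
  calc ((n : ℝ) ^ (-r)) ^ 2 = (√(n : ℝ))⁻¹ * (√(n : ℝ) * ((n : ℝ) ^ (-r)) ^ 2) := by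
        field_simp
    _ ≤ rateM r n * rateM r n := mul_le_mul (inv_sqrt_le_rateM r n)
        (sqrt_mul_rpow_sq_le_rateM hn) (by positivity) hm
    _ = _ := by ring

/-- The slope allowed to the stochastic increments of the score is thereby absorbed into √n M_n(r).
-/
theorem max_rpow_le_sqrt_mul_rateM (hn : 0 < n) :
    max ((n : ℝ) ^ (1 / 2 - r)) 1 ≤ √(n : ℝ) * rateM r n := by
  have hn' : (0 : ℝ) < n := by exact_mod_cast hn
  refine max_le ?_ (one_le_sqrt_mul_rateM hn)
  rw [sub_eq_add_neg, Real.rpow_add hn', ← sqrt_natCast_eq_rpow]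
  exact mul_le_mul_of_nonneg_left (rpow_le_rateM hn) (Real.sqrt_nonneg _)

/-- The condition 1/4 < r says exactly that the exponent −2r + 1/2 is negative. -/
theorem tendsto_rateM (hr : 1 / 4 < r) : Tendsto (rateM r) atTop (𝓝 0) := by
  have h1 := (tendsto_rpow_neg_atTop (y := 1 / 2) (by norm_num)).comp tendsto_natCast_atTop_atTop
  have h2 := (tendsto_rpow_neg_atTop (y := 2 * r - 1 / 2) (by linarith)).comp
    tendsto_natCast_atTop_atTop
  have := h1.add h2
  simp only [add_zero] at this
  refine this.congr fun n => ?_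
  simp only [Function.comp, rateM]
  congr 2
  ring

end Rate

/-! ### Bounds for the expected derivatives -/

section Population

variable {d : ℕ} {𝒳 E : Type*} [MeasurableSpace 𝒳] [SeminormedAddCommGroup E]

/-- The expected derivatives of the log-likelihood of the submodel at `(θ₀, θ, η)` are close to
those at the truth. -/
structure PopulationBound (M : Model d 𝒳 E) (sub : Vec d → Vec d → E → E) (θ₀ : Vec d) (η₀ : E)
    (I : Matrix (Fin d) (Fin d) ℝ) (δ C : ℝ) : Prop where
  TT : ∀ η ∈ M.H, ‖η - η₀‖ < δ → ∀ θ ∈ Metric.ball θ₀ δ, ∀ i j,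
    |∫ x, M.ellTT sub i j θ₀ θ η x ∂(M.law θ₀ η₀) + I i j| ≤ C * (‖θ - θ₀‖ + ‖η - η₀‖)
  Tθ : ∀ η ∈ M.H, ‖η - η₀‖ < δ → ∀ θ ∈ Metric.ball θ₀ δ, ∀ i j,
    |∫ x, M.ellTθ sub i j θ₀ θ η x ∂(M.law θ₀ η₀)| ≤ C * (‖θ - θ₀‖ + ‖η - η₀‖)
  T : ∀ η ∈ M.H, ‖η - η₀‖ < δ → ∀ i, Integrable (M.ellT sub i θ₀ θ₀ η) (M.law θ₀ η₀) ∧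
    |∫ x, M.ellT sub i θ₀ θ₀ η x ∂(M.law θ₀ η₀)| ≤ C * ‖η - η₀‖ ^ 2

theorem exists_bound_of_isBigO {ι : Type*} [Fintype ι] {H : Set E} {η₀ : E} {f : E → ι → ℝ}
    {g : E → ℝ} (hg : ∀ η, 0 ≤ g η) (h : ∀ i, (fun η => f η i) =O[𝓝[H] η₀] g) :
    ∃ C ≥ 0, ∃ δ > 0, ∀ η ∈ H, ‖η - η₀‖ < δ → ∀ i, |f η i| ≤ C * g η := by
  obtain ⟨C, hC, hb⟩ := (isBigO_pi.2 h).exists_nonneg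
  obtain ⟨δ, hδ, hδb⟩ := Metric.mem_nhdsWithin_iff.1 hb.bound
  refine ⟨C, hC, δ, hδ, fun η hη hηd i => ?_⟩
  have h1 : ‖f η‖ ≤ C * ‖g η‖ := hδb ⟨by simpa [dist_eq_norm] using hηd, hη⟩
  rw [Real.norm_of_nonneg (hg η)] at h1
  exact (norm_le_pi_norm (f η) i).trans h1

theorem abs_integral_sub_le {P : Measure 𝒳} {f g F : 𝒳 → ℝ} {c : ℝ} (hf : Integrable f P)
    (hg : Integrable g P) (hF : Integrable F P) (h : ∀ᵐ x ∂P, |f x - g x| ≤ c * F x) :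
    |∫ x, f x ∂P - ∫ x, g x ∂P| ≤ c * ∫ x, F x ∂P := by
  rw [← integral_sub hf hg, ← integral_const_mul]
  exact norm_integral_le_of_norm_le (f := fun x => f x - g x) (hF.const_mul c) h

variable {M : Model d 𝒳 E} {sub : Vec d → Vec d → E → E} {θ₀ : Vec d} {η₀ : E}

/-- The envelope gives the bound; measurability comes from difference quotients of the measurable
log-likelihoods. -/
theorem Model.integrable_ellT {δ : ℝ} (hδ : 0 < δ) (hball : Metric.ball θ₀ δ ⊆ M.Θ)
    (hsub : ∀ t ∈ Metric.ball θ₀ δ, ∀ θ ∈ Metric.ball θ₀ δ, ∀ η ∈ M.H, ‖η - η₀‖ < δ →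
        sub t θ η ∈ M.H) {F : 𝒳 → ℝ} (hF : Integrable F (M.law θ₀ η₀))
    (hsm : ∀ᵐ x ∂(M.law θ₀ η₀), SmoothAt M sub θ₀ η₀ δ (F x) x) {η : E} (hη : η ∈ M.H)
    (hηd : ‖η - η₀‖ < δ) (i : Fin d) :
    Integrable (M.ellT sub i θ₀ θ₀ η) (M.law θ₀ η₀) := by
  have hθ₀ : θ₀ ∈ Metric.ball θ₀ δ := Metric.mem_ball_self hδ
  have hm : AEMeasurable (M.ellT sub i θ₀ θ₀ η) (M.law θ₀ η₀) := by
    refine aemeasurable_of_hasDerivAt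
      (f := fun s x => M.ell sub (θ₀ + s • EuclideanSpace.single i 1) θ₀ η x) ?_ ?_
    · have hcont : Continuous fun s : ℝ => θ₀ + s • (EuclideanSpace.single i 1 : Vec d) := by
        fun_prop
      have hnhds : (fun s : ℝ => θ₀ + s • (EuclideanSpace.single i 1 : Vec d)) ⁻¹'
          Metric.ball θ₀ δ ∈ 𝓝 (0 : ℝ) :=
        hcont.continuousAt.preimage_mem_nhds (Metric.isOpen_ball.mem_nhds (by simpa using hθ₀))
      filter_upwards [hnhds] with s hs
      exact (M.lik_measurable _ (hball hs) _ (hsub _ hs _ hθ₀ η hη hηd)).log.aemeasurable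
    · filter_upwards [hsm] with x hx
      exact hx.hasDerivAt_ell_fst hη hηd hθ₀ hθ₀ i
  refine Integrable.mono' hF hm.aestronglyMeasurable ?_
  filter_upwards [hsm] with x hx
  exact (hx.bound η hη hηd θ₀ hθ₀ θ₀ hθ₀).1 i

/-- For the second derivatives, the move from θ to θ₀ is Lipschitz by the integrable envelope of the
third derivatives, and the move from η to η₀ is the bias assumption. The score is only needed at θ₀,
so its quadratic bias is taken over directly. -/
theorem Model.exists_populationBound {I : Matrix (Fin d) (Fin d) ℝ} {δ : ℝ}
    (hδ : 0 < δ) (hball : Metric.ball θ₀ δ ⊆ M.Θ)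
    (hsub : ∀ t ∈ Metric.ball θ₀ δ, ∀ θ ∈ Metric.ball θ₀ δ, ∀ η ∈ M.H, ‖η - η₀‖ < δ →
        sub t θ η ∈ M.H) {F : 𝒳 → ℝ} (hF : Integrable F (M.law θ₀ η₀))
    (hsm : ∀ᵐ x ∂(M.law θ₀ η₀), ∀ δ' ≤ δ, SmoothAt M sub θ₀ η₀ δ' (F x) x)
    (hTTi : ∀ η ∈ M.H, ‖η - η₀‖ < δ → ∀ θ ∈ Metric.ball θ₀ δ, ∀ i j,
      Integrable (M.ellTT sub i j θ₀ θ η) (M.law θ₀ η₀))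
    (hTθi : ∀ η ∈ M.H, ‖η - η₀‖ < δ → ∀ θ ∈ Metric.ball θ₀ δ, ∀ i j,
      Integrable (M.ellTθ sub i j θ₀ θ η) (M.law θ₀ η₀))
    (hTT0 : ∀ i j, ∫ x, M.ellTT sub i j θ₀ θ₀ η₀ x ∂(M.law θ₀ η₀) = - I i j)
    (hTθ0 : ∀ i j, ∫ x, M.ellTθ sub i j θ₀ θ₀ η₀ x ∂(M.law θ₀ η₀) = 0)
    (hB2 : M.AssumptionB2Bias sub θ₀ η₀) :
    ∃ C ≥ 0, ∃ δ' > 0, δ' ≤ δ ∧ PopulationBound M sub θ₀ η₀ I δ' C := by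
  obtain ⟨hb1, hb2, hb3⟩ := hB2
  obtain ⟨C₁, hC₁, δ₁, hδ₁, h₁⟩ := exists_bound_of_isBigO (ι := Fin d × Fin d)
    (f := fun η p => ∫ x, M.ellTT sub p.1 p.2 θ₀ θ₀ η x ∂(M.law θ₀ η₀)
      - ∫ x, M.ellTT sub p.1 p.2 θ₀ θ₀ η₀ x ∂(M.law θ₀ η₀)) (g := fun η => ‖η - η₀‖)
    (fun _ => norm_nonneg _) (fun p => hb1 p.1 p.2)
  obtain ⟨C₂, hC₂, δ₂, hδ₂, h₂⟩ := exists_bound_of_isBigO (ι := Fin d × Fin d)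
    (f := fun η p => ∫ x, M.ellTθ sub p.1 p.2 θ₀ θ₀ η x ∂(M.law θ₀ η₀)
      - ∫ x, M.ellTθ sub p.1 p.2 θ₀ θ₀ η₀ x ∂(M.law θ₀ η₀)) (g := fun η => ‖η - η₀‖)
    (fun _ => norm_nonneg _) (fun p => hb2 p.1 p.2)
  obtain ⟨C₃, hC₃, δ₃, hδ₃, h₃⟩ := exists_bound_of_isBigO
    (f := fun η i => ∫ x, M.ellT sub i θ₀ θ₀ η x ∂(M.law θ₀ η₀)) (g := fun η => ‖η - η₀‖ ^ 2)
    (fun _ => sq_nonneg _) hb3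
  set A := ∫ x, |F x| ∂(M.law θ₀ η₀) with hA
  have hA0 : 0 ≤ A := integral_nonneg fun x => abs_nonneg _
  have hsmδ : ∀ᵐ x ∂(M.law θ₀ η₀), SmoothAt M sub θ₀ η₀ δ (F x) x := by
    filter_upwards [hsm] with x hx using hx δ le_rfl
  have hθ₀ : θ₀ ∈ Metric.ball θ₀ δ := Metric.mem_ball_self hδ
  set δ' := min δ (min δ₁ (min δ₂ δ₃)) with hδ'
  have l0 : δ' ≤ δ := min_le_left _ _
  have l1 : δ' ≤ δ₁ := (min_le_right _ _).trans (min_le_left _ _)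
  have l2 : δ' ≤ δ₂ := (min_le_right _ _).trans ((min_le_right _ _).trans (min_le_left _ _))
  have l3 : δ' ≤ δ₃ := (min_le_right _ _).trans ((min_le_right _ _).trans (min_le_right _ _))
  have comb : ∀ {a b c w e C' : ℝ}, |a - b| ≤ d * w * A → |b - c| ≤ C' * e → 0 ≤ w → 0 ≤ e →
      C' ≤ C₁ + C₂ + C₃ → |a - c| ≤ (d * A + C₁ + C₂ + C₃) * (w + e) := by
    intro a b c w e C' hab hbc hw he hC'
    have hdA : 0 ≤ (d : ℝ) * A := by positivity
    calc |a - c| ≤ |a - b| + |b - c| := abs_sub_le _ _ _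
      _ ≤ d * w * A + (C₁ + C₂ + C₃) * e := by
          exact add_le_add hab (hbc.trans (mul_le_mul_of_nonneg_right hC' he))
      _ ≤ _ := by
          have := mul_nonneg hdA he
          have := mul_nonneg (add_nonneg (add_nonneg hC₁ hC₂) hC₃) hw
          nlinarith
  refine ⟨d * A + C₁ + C₂ + C₃, by positivity, δ',
    lt_min hδ (lt_min hδ₁ (lt_min hδ₂ hδ₃)), l0, ?_, ?_, ?_⟩
  · intro η hη hηd θ hθ i j
    have hηδ := hηd.trans_le l0
    have hθδ := Metric.ball_subset_ball l0 hθ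
    have e1 := abs_integral_sub_le (c := d * ‖θ - θ₀‖) (hTTi η hη hηδ θ hθδ i j)
      (hTTi η hη hηδ θ₀ hθ₀ i j) hF.abs (by
        filter_upwards [hsmδ] with x hx
        refine (hx.ellTT_lipschitz hη hηδ hθ₀ hθ₀ hθδ i j).trans ?_
        calc (d : ℝ) * F x * ‖θ - θ₀‖ = d * ‖θ - θ₀‖ * F x := by ring
          _ ≤ _ := mul_le_mul_of_nonneg_left (le_abs_self _) (by positivity))
    have e2 := h₁ η hη (hηd.trans_le l1) (i, j)
    have := comb e1 e2 (norm_nonneg _) (norm_nonneg _) (by linarith)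
    rwa [hTT0, sub_neg_eq_add] at this
  · intro η hη hηd θ hθ i j
    have hηδ := hηd.trans_le l0
    have hθδ := Metric.ball_subset_ball l0 hθ
    have e1 := abs_integral_sub_le (c := d * ‖θ - θ₀‖) (hTθi η hη hηδ θ hθδ i j)
      (hTθi η hη hηδ θ₀ hθ₀ i j) hF.abs (by
        filter_upwards [hsmδ] with x hx
        refine (hx.ellTθ_lipschitz hη hηδ hθ₀ hθ₀ hθδ i j).trans ?_
        calc (d : ℝ) * F x * ‖θ - θ₀‖ = d * ‖θ - θ₀‖ * F x := by ring
          _ ≤ _ := mul_le_mul_of_nonneg_left (le_abs_self _) (by positivity))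
    have e2 := h₂ η hη (hηd.trans_le l2) (i, j)
    have := comb e1 e2 (norm_nonneg _) (norm_nonneg _) (by linarith)
    rwa [hTθ0, sub_zero] at this
  · intro η hη hηd i
    have hηδ := hηd.trans_le l0
    refine ⟨Model.integrable_ellT hδ hball hsub hF hsmδ hη hηδ i,
      (h₃ η hη (hηd.trans_le l3) i).trans ?_⟩
    have : 0 ≤ (d : ℝ) * A := by positivity
    exact mul_le_mul_of_nonneg_right (by linarith) (sq_nonneg _)

end Population


/-! ### Algebra of empirical means -/

section EmpMean

variable {𝒳 : Type*} {n : ℕ} {x : ℕ → 𝒳}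

theorem empMean_sub (f g : 𝒳 → ℝ) :
    empMean n x (fun y => f y - g y) = empMean n x f - empMean n x g := by
  simp only [empMean, Finset.sum_sub_distrib, mul_sub]

theorem empMean_mul_const (f : 𝒳 → ℝ) (c : ℝ) :
    empMean n x (fun y => f y * c) = empMean n x f * c := by
  simp only [empMean, ← Finset.sum_mul, mul_assoc]

theorem empMean_sum {ι : Type*} (t : Finset ι) (f : ι → 𝒳 → ℝ) :
    empMean n x (fun y => ∑ i ∈ t, f i y) = ∑ i ∈ t, empMean n x (f i) := by
  simp only [empMean]
  rw [Finset.sum_comm, Finset.mul_sum]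

theorem abs_empMean_le {f F : 𝒳 → ℝ} {c : ℝ} (h : ∀ k, |f (x k)| ≤ c * F (x k)) :
    |empMean n x f| ≤ c * empMean n x F := by
  have : c * empMean n x F = (n : ℝ)⁻¹ * ∑ i ∈ Finset.range n, c * F (x i) := by
    rw [empMean, ← Finset.mul_sum]; ring
  rw [this, empMean, abs_mul, abs_of_nonneg (by positivity : (0 : ℝ) ≤ (n : ℝ)⁻¹)]
  exact mul_le_mul_of_nonneg_left ((Finset.abs_sum_le_sum_abs _ _).trans
    (Finset.sum_le_sum fun i _ => h i)) (by positivity)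

theorem empMean_eq_empProc [MeasurableSpace 𝒳] {P : Measure 𝒳} (hn : 0 < n) (f : 𝒳 → ℝ) :
    empMean n x f = (√(n : ℝ))⁻¹ * empProc P n x f + ∫ y, f y ∂P := by
  have hs : 0 < √(n : ℝ) := Real.sqrt_pos.2 (by exact_mod_cast hn)
  rw [empProc]
  field_simp
  ring

end EmpMean

/-! ### The profile likelihood at one sample -/

/-- The constant in the expansion of the score. -/
def scoreConst (d : ℕ) (C K : ℝ) : ℝ := (d + 1) * (K + C * (1 + K)) + 2 * C * K ^ 2 + K

/-- Here s = √n, m = M_n(r), w = ‖θ − θ₀‖, e = ‖η̂_θ − η₀‖, a = n^{-r} and b = max(n^{1/2−r}, 1).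
The three summands on the left are the costs of moving θ, of the stochastic increment in η and of
the bias. -/
theorem score_remainder_le {d : ℕ} {K C s m w e a b : ℝ} (hK : 0 ≤ K) (hC : 0 ≤ C) (hs : 0 ≤ s)
    (hm0 : 0 ≤ m) (hw0 : 0 ≤ w) (he0 : 0 ≤ e) (hsm : 1 ≤ s * m)
    (hsa : s * a ^ 2 ≤ m) (ham : a ≤ m) (h3 : e ≤ K * (w + a)) (hb : b ≤ s * m) :
    d * (K * w + s * C * (w + e) * w) + K * (m + b * w) + s * (C * e ^ 2)
      ≤ scoreConst d C K * (m + s * m * w + s * w ^ 2) := by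
  have hD : (0 : ℝ) ≤ d := by positivity
  have hw1 : w ≤ s * m * w := le_mul_of_one_le_left hw0 hsm
  have hbound1 : K * w + s * C * (w + e) * w ≤ (K + C * (1 + K)) * (s * m * w + s * w ^ 2) := by
    have he' : s * C * (w + e) * w ≤ C * ((1 + K) * (s * w ^ 2) + K * (s * m * w)) := by
      have : w + e ≤ w + K * (w + m) :=
        add_le_add le_rfl (h3.trans (mul_le_mul_of_nonneg_left (add_le_add le_rfl ham) hK))
      calc s * C * (w + e) * w = C * (s * w) * (w + e) := by ring
        _ ≤ C * (s * w) * (w + K * (w + m)) := mul_le_mul_of_nonneg_left this (by positivity)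
        _ = _ := by ring
    have h4 : K * w ≤ K * (s * m * w) := mul_le_mul_of_nonneg_left hw1 hK
    have h5 : 0 ≤ K * (s * w ^ 2) := by positivity
    have h6 : 0 ≤ C * (s * m * w) := by positivity
    linarith [h4, h5, h6, he']
  have hbound3 : s * (C * e ^ 2) ≤ 2 * C * K ^ 2 * (m + s * w ^ 2) := by
    have : e ^ 2 ≤ K ^ 2 * (2 * w ^ 2 + 2 * a ^ 2) := by
      calc e ^ 2 ≤ (K * (w + a)) ^ 2 := pow_le_pow_left₀ he0 h3 2
        _ ≤ _ := by
          have := mul_nonneg (sq_nonneg K) (sq_nonneg (w - a))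
          linarith
    calc s * (C * e ^ 2) = C * s * e ^ 2 := by ring
      _ ≤ C * s * (K ^ 2 * (2 * w ^ 2 + 2 * a ^ 2)) :=
        mul_le_mul_of_nonneg_left this (by positivity)
      _ = 2 * C * K ^ 2 * (s * a ^ 2 + s * w ^ 2) := by ring
      _ ≤ _ := mul_le_mul_of_nonneg_left (add_le_add hsa le_rfl) (by positivity)
  have hbound2 : K * (m + b * w) ≤ K * (m + s * m * w) :=
    mul_le_mul_of_nonneg_left (add_le_add le_rfl (mul_le_mul_of_nonneg_right hb hw0)) hK
  have hbound4 := mul_le_mul_of_nonneg_left hbound1 hD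
  unfold scoreConst
  have k1 : 0 ≤ (d : ℝ) * (K + C * (1 + K)) * m := by positivity
  have k2 : 0 ≤ (K + C * (1 + K)) * (m + s * m * w + s * w ^ 2) := by positivity
  have k3 : 0 ≤ 2 * C * K ^ 2 * (s * m * w) := by positivity
  have k4 : 0 ≤ K * (s * w ^ 2) := by positivity
  linarith [k1, k2, k3, k4]

section Sample

variable {d : ℕ} {𝒳 E : Type*} [MeasurableSpace 𝒳]

theorem Model.likn_le_profLik {M : Model d 𝒳 E} {n : ℕ} {x : ℕ → 𝒳} {θ : Vec d} {η' : E}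
    (hmax : IsMaxOn (fun η => M.likn n x θ η) M.H η') {η : E} (hη : η ∈ M.H) :
    M.likn n x θ η ≤ M.profLik n x θ := by
  refine le_csSup ⟨M.likn n x θ η', ?_⟩ ⟨η, hη, rfl⟩
  rintro _ ⟨η, hη, rfl⟩
  exact hmax hη

theorem Model.profLik_eq_likn {M : Model d 𝒳 E} {n : ℕ} {x : ℕ → 𝒳} {θ : Vec d} {η' : E}
    (hmax : IsMaxOn (fun η => M.likn n x θ η) M.H η') (hη' : η' ∈ M.H) :
    M.profLik n x θ = M.likn n x θ η' := by
  refine IsGreatest.csSup_eq ⟨⟨η', hη', rfl⟩, ?_⟩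
  rintro _ ⟨η, hη, rfl⟩
  exact hmax hη

theorem Model.profLik_nonneg {M : Model d 𝒳 E} {n : ℕ} {x : ℕ → 𝒳} {θ : Vec d}
    (hθ : θ ∈ M.Θ) : 0 ≤ M.profLik n x θ := by
  refine Real.sSup_nonneg ?_
  rintro _ ⟨η, hη, rfl⟩
  exact Finset.prod_nonneg fun i _ => M.lik_nonneg θ hθ η hη _

theorem Model.log_likn {M : Model d 𝒳 E} {sub : Vec d → Vec d → E → E} {n : ℕ} {x : ℕ → 𝒳}
    {t θ : Vec d} {η : E} (hn : 0 < n)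
    (hpos : ∀ k, 0 < M.lik t (sub t θ η) (x k)) :
    0 < M.likn n x t (sub t θ η) ∧
      Real.log (M.likn n x t (sub t θ η)) = n * empMean n x (M.ell sub t θ η) := by
  refine ⟨Finset.prod_pos fun i _ => hpos i, ?_⟩
  have hn' : (n : ℝ) ≠ 0 := by exact_mod_cast hn.ne'
  rw [Model.likn, Real.log_prod fun i _ => (hpos i).ne', empMean, ← mul_assoc,
    mul_inv_cancel₀ hn', one_mul]
  rfl

variable [SeminormedAddCommGroup E]

/-- The properties of the sample `x` of size `n` on which the expansion of the profile likelihood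
is based; all of them hold with large probability for a large constant `K`. -/
structure GoodSample (M : Model d 𝒳 E) (sub : Vec d → Vec d → E → E) (θ₀ : Vec d) (η₀ : E)
    (F : 𝒳 → ℝ) (r δ K : ℝ) (n : ℕ) (x : ℕ → 𝒳) (ηh : Vec d → E) : Prop where
  smooth : ∀ k, SmoothAt M sub θ₀ η₀ δ (F (x k)) (x k)
  mean : empMean n x F ≤ K
  mem : ∀ θ, ηh θ ∈ M.H
  max : ∀ θ ∈ M.Θ, IsMaxOn (fun η => M.likn n x θ η) M.H (ηh θ)
  score : ∀ i, |empProc (M.law θ₀ η₀) n x (M.ellT sub i θ₀ θ₀ η₀)| ≤ K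
  TT : ∀ i j, ∀ η ∈ M.H, ‖η - η₀‖ < δ → ∀ θ ∈ Metric.ball θ₀ δ,
    |empProc (M.law θ₀ η₀) n x (M.ellTT sub i j θ₀ θ η)| ≤ K
  Tθ : ∀ i j, ∀ η ∈ M.H, ‖η - η₀‖ < δ → ∀ θ ∈ Metric.ball θ₀ δ,
    |empProc (M.law θ₀ η₀) n x (M.ellTθ sub i j θ₀ θ η)| ≤ K
  rate : ∀ θ ∈ M.Θ, ‖θ - θ₀‖ < K⁻¹ → ‖ηh θ - η₀‖ ≤ K * (‖θ - θ₀‖ + (n : ℝ) ^ (-r))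
  incr : ∀ i, ∀ θ ∈ M.Θ, ‖θ - θ₀‖ < K⁻¹ →
    |empProc (M.law θ₀ η₀) n x
        (fun y => M.ellT sub i θ₀ θ₀ (ηh θ) y - M.ellT sub i θ₀ θ₀ η₀ y)|
      ≤ K * (rateM r n + Max.max ((n : ℝ) ^ (1 / 2 - r)) 1 * ‖θ - θ₀‖)

variable {M : Model d 𝒳 E} {sub : Vec d → Vec d → E → E} {θ₀ : Vec d} {η₀ : E}
  {I : Matrix (Fin d) (Fin d) ℝ} {F : 𝒳 → ℝ} {r δ C K : ℝ} {n : ℕ} {x : ℕ → 𝒳} {ηh : Vec d → E}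

namespace GoodSample

variable (hg : GoodSample M sub θ₀ η₀ F r δ K n x ηh) (hp : PopulationBound M sub θ₀ η₀ I δ C)

include hg hp

/-- The empirical mean is n^{-1/2} 𝔾_n plus the expectation: the Donsker bound handles the first
part, the population bound and the rate of η̂_θ the second. -/
theorem abs_empMean_ellTT_add_le (hn : 0 < n) (hK : 0 < K) (hC : 0 ≤ C) {θ : Vec d}
    (hθ : θ ∈ Metric.ball θ₀ δ) (hθΘ : θ ∈ M.Θ) (hθK : ‖θ - θ₀‖ < K⁻¹)
    (hη : ‖ηh θ - η₀‖ < δ) (i j : Fin d) :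
    |empMean n x (M.ellTT sub i j θ₀ θ (ηh θ)) + I i j|
      ≤ scoreConst d C K * (rateM r n + ‖θ - θ₀‖) := by
  set w := ‖θ - θ₀‖ with hw
  have hw0 : 0 ≤ w := norm_nonneg _
  have hs : 0 < √(n : ℝ) := Real.sqrt_pos.2 (by exact_mod_cast hn)
  have hm0 := rateM_nonneg r n
  rw [empMean_eq_empProc (P := M.law θ₀ η₀) hn, add_assoc]
  have h1 := hg.TT i j (ηh θ) (hg.mem θ) hη θ hθ
  have h2 := hp.TT (ηh θ) (hg.mem θ) hη θ hθ i j
  have h3 := hg.rate θ hθΘ hθK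
  have h4 : ‖ηh θ - η₀‖ ≤ K * (w + rateM r n) :=
    h3.trans (mul_le_mul_of_nonneg_left (add_le_add le_rfl (rpow_le_rateM hn)) hK.le)
  have h5 : |(√(n : ℝ))⁻¹ * empProc (M.law θ₀ η₀) n x (M.ellTT sub i j θ₀ θ (ηh θ))|
      ≤ rateM r n * K := by
    rw [abs_mul, abs_of_pos (inv_pos.2 hs)]
    exact mul_le_mul (inv_sqrt_le_rateM r n) h1 (abs_nonneg _) hm0
  calc _ ≤ rateM r n * K + C * (w + K * (w + rateM r n)) :=
        (abs_add_le _ _).trans (add_le_add h5 (h2.trans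
          (mul_le_mul_of_nonneg_left (add_le_add le_rfl h4) hC)))
    _ ≤ (K + C * (1 + K)) * (rateM r n + w) := by
        have := mul_nonneg hK.le hw0
        have := mul_nonneg hC hm0
        nlinarith
    _ ≤ _ := by
        refine mul_le_mul_of_nonneg_right ?_ (add_nonneg hm0 hw0)
        have : 0 ≤ (d : ℝ) * (K + C * (1 + K)) := by positivity
        have : 0 ≤ 2 * C * K ^ 2 := by positivity
        unfold scoreConst
        linarith

theorem abs_empMean_ellTθ_le (hn : 0 < n) {θ : Vec d}
    (hθ : θ ∈ Metric.ball θ₀ δ) {η : E} (hηH : η ∈ M.H) (hη : ‖η - η₀‖ < δ) (i j : Fin d) :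
    |empMean n x (M.ellTθ sub i j θ₀ θ η)|
      ≤ (√(n : ℝ))⁻¹ * K + C * (‖θ - θ₀‖ + ‖η - η₀‖) := by
  rw [empMean_eq_empProc (P := M.law θ₀ η₀) hn]
  refine (abs_add_le _ _).trans (add_le_add ?_ (hp.Tθ η hηH hη θ hθ i j))
  rw [abs_mul, abs_of_nonneg (by positivity : (0 : ℝ) ≤ (√(n : ℝ))⁻¹)]
  exact mul_le_mul_of_nonneg_left (hg.Tθ i j η hηH hη θ hθ) (by positivity)

/-- Mean value theorem for the empirical mean along the segment from θ₀ to θ with η held fixed. The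
derivative is an empirical mean of ℓ_{t,θ}, small because its expectation vanishes at the truth. -/
theorem abs_empMean_ellT_sub_le (hn : 0 < n) (hC : 0 ≤ C) {θ : Vec d}
    (hθ : θ ∈ Metric.ball θ₀ δ) {η : E} (hηH : η ∈ M.H) (hη : ‖η - η₀‖ < δ) (i : Fin d) :
    |empMean n x (M.ellT sub i θ₀ θ η) - empMean n x (M.ellT sub i θ₀ θ₀ η)|
      ≤ d * ((√(n : ℝ))⁻¹ * K + C * (‖θ - θ₀‖ + ‖η - η₀‖)) * ‖θ - θ₀‖ := by
  have hθ₀ : θ₀ ∈ Metric.ball θ₀ δ := Metric.mem_ball_self ((norm_nonneg _).trans_lt hη)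
  have hseg : ∀ s ∈ Set.Icc (0 : ℝ) 1, θ₀ + s • (θ - θ₀) ∈ Metric.ball θ₀ δ := fun s hs =>
    segment_mem_ball hθ₀ (by simpa using hθ) hs
  have := abs_sub_le_of_deriv_bound
    (f := fun s : ℝ => empMean n x (M.ellT sub i θ₀ (θ₀ + s • (θ - θ₀)) η))
    (f₁ := fun s : ℝ => ∑ j, empMean n x (M.ellTθ sub i j θ₀ (θ₀ + s • (θ - θ₀)) η) * (θ - θ₀) j)
    (C := d * ((√(n : ℝ))⁻¹ * K + C * (‖θ - θ₀‖ + ‖η - η₀‖)) * ‖θ - θ₀‖)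
    (fun s hs => by
      have h1 : HasDerivAt (fun s : ℝ => empMean n x (M.ellT sub i θ₀ (θ₀ + s • (θ - θ₀)) η))
          ((n : ℝ)⁻¹ * ∑ k ∈ Finset.range n,
            ∑ j, M.ellTθ sub i j θ₀ (θ₀ + s • (θ - θ₀)) η (x k) * (θ - θ₀) j) s :=
        (HasDerivAt.fun_sum fun k _ =>
          (hg.smooth k).hasDerivAt_ellT_snd hηH hη hθ₀ (hseg s hs) i).const_mul _
      refine h1.congr_deriv ?_
      simp only [← empMean_mul_const]
      rw [← empMean_sum]
      rfl)
    (fun s hs => by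
      refine abs_sum_mul_le (fun j => ?_) _
      refine (abs_empMean_ellTθ_le hg hp hn (hseg s hs) hηH hη i j).trans ?_
      have : ‖θ₀ + s • (θ - θ₀) - θ₀‖ ≤ ‖θ - θ₀‖ := by
        rw [add_sub_cancel_left, norm_smul, Real.norm_of_nonneg hs.1]
        exact mul_le_of_le_one_left (norm_nonneg _) hs.2
      gcongr)
    (s := 1) ⟨zero_le_one, le_rfl⟩
  simpa using this

/-- Plugging in η̂_θ does not change the leading term of the score: the error splits into a move of
θ at fixed nuisance, a stochastic increment at θ₀, and √n times a bias quadratic in ‖η̂_θ − η₀‖. -/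
theorem abs_sqrt_mul_empMean_ellT_sub_le (hη₀ : η₀ ∈ M.H) (hn : 0 < n) (hK : 0 < K) (hC : 0 ≤ C)
    {θ : Vec d} (hθ : θ ∈ Metric.ball θ₀ δ) (hθΘ : θ ∈ M.Θ) (hθK : ‖θ - θ₀‖ < K⁻¹)
    (hη : ‖ηh θ - η₀‖ < δ) (i : Fin d) :
    |√(n : ℝ) * empMean n x (M.ellT sub i θ₀ θ (ηh θ))
        - empProc (M.law θ₀ η₀) n x (M.ellT sub i θ₀ θ₀ η₀)|
      ≤ scoreConst d C K * (rateM r n + √(n : ℝ) * rateM r n * ‖θ - θ₀‖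
        + √(n : ℝ) * ‖θ - θ₀‖ ^ 2) := by
  have hδ : 0 < δ := (norm_nonneg _).trans_lt hη
  have hs : 0 < √(n : ℝ) := Real.sqrt_pos.2 (by exact_mod_cast hn)
  obtain ⟨hint, hT⟩ := hp.T (ηh θ) (hg.mem θ) hη i
  obtain ⟨hint0, hT0⟩ := hp.T η₀ hη₀ (by simpa) i
  -- The quadratic bias bound at η = η₀ says that the efficient score is centred.
  have hT0' : ∫ y, M.ellT sub i θ₀ θ₀ η₀ y ∂(M.law θ₀ η₀) = 0 := by simpa using hT0
  have h1 := abs_empMean_ellT_sub_le hg hp hn hC hθ (hg.mem θ) hη i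
  have h2 := hg.incr i θ hθΘ hθK
  have hsub : ∫ y, (M.ellT sub i θ₀ θ₀ (ηh θ) y - M.ellT sub i θ₀ θ₀ η₀ y) ∂(M.law θ₀ η₀)
      = ∫ y, M.ellT sub i θ₀ θ₀ (ηh θ) y ∂(M.law θ₀ η₀) := by
    rw [integral_sub hint hint0, hT0', sub_zero]
  have hdec : √(n : ℝ) * empMean n x (M.ellT sub i θ₀ θ (ηh θ))
        - empProc (M.law θ₀ η₀) n x (M.ellT sub i θ₀ θ₀ η₀)
      = √(n : ℝ) * (empMean n x (M.ellT sub i θ₀ θ (ηh θ))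
          - empMean n x (M.ellT sub i θ₀ θ₀ (ηh θ)))
        + empProc (M.law θ₀ η₀) n x
          (fun y => M.ellT sub i θ₀ θ₀ (ηh θ) y - M.ellT sub i θ₀ θ₀ η₀ y)
        + √(n : ℝ) * ∫ y, M.ellT sub i θ₀ θ₀ (ηh θ) y ∂(M.law θ₀ η₀) := by
    simp only [empProc, empMean_sub, hsub, hT0']
    ring
  rw [hdec]
  have hterm1 : |√(n : ℝ) * (empMean n x (M.ellT sub i θ₀ θ (ηh θ))
      - empMean n x (M.ellT sub i θ₀ θ₀ (ηh θ)))|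
      ≤ d * (K * ‖θ - θ₀‖ + √(n : ℝ) * C * (‖θ - θ₀‖ + ‖ηh θ - η₀‖) * ‖θ - θ₀‖) := by
    rw [abs_mul, abs_of_pos hs]
    refine (mul_le_mul_of_nonneg_left h1 hs.le).trans_eq ?_
    have : √(n : ℝ) * (√(n : ℝ))⁻¹ = 1 := mul_inv_cancel₀ hs.ne'
    linear_combination (d : ℝ) * K * ‖θ - θ₀‖ * this
  have hterm3 : |√(n : ℝ) * ∫ y, M.ellT sub i θ₀ θ₀ (ηh θ) y ∂(M.law θ₀ η₀)|
      ≤ √(n : ℝ) * (C * ‖ηh θ - η₀‖ ^ 2) := by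
    rw [abs_mul, abs_of_pos hs]
    exact mul_le_mul_of_nonneg_left hT hs.le
  refine ((abs_add_le _ _).trans (add_le_add ((abs_add_le _ _).trans
    (add_le_add hterm1 h2)) hterm3)).trans ?_
  exact score_remainder_le hK.le hC hs.le (rateM_nonneg r n) (norm_nonneg _) (norm_nonneg _)
    (one_le_sqrt_mul_rateM hn) (sqrt_mul_rpow_sq_le_rateM hn) (rpow_le_rateM hn)
    (hg.rate θ hθΘ hθK) (max_rpow_le_sqrt_mul_rateM hn)

end GoodSample

end Sample


/-! ### Quadratic expansion of the log profile likelihood -/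

section Expansion

variable {d : ℕ} {𝒳 E : Type*} [MeasurableSpace 𝒳] [SeminormedAddCommGroup E]

/-- The quadratic form of a matrix. -/
def quadForm (I : Matrix (Fin d) (Fin d) ℝ) (v : Vec d) : ℝ := ∑ i, (∑ j, I i j * v j) * v i

/-- The parameter `θ` and the corresponding nuisance estimator are close to the truth. -/
structure NearTruth (M : Model d 𝒳 E) (θ₀ : Vec d) (η₀ : E) (δ K : ℝ) (ηh : Vec d → E)
    (θ : Vec d) : Prop where
  ball : θ ∈ Metric.ball θ₀ δ
  mem : θ ∈ M.Θ
  inv : ‖θ - θ₀‖ < K⁻¹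
  nuisance : ‖ηh θ - η₀‖ < δ

/-- The constant in the expansion of the log profile likelihood. -/
def expansionConst (d : ℕ) (C K : ℝ) : ℝ :=
  d * scoreConst d C K + d ^ 2 * scoreConst d C K + d ^ 3 * K

theorem scoreConst_nonneg {C K : ℝ} (hC : 0 ≤ C) (hK : 0 ≤ K) : 0 ≤ scoreConst d C K := by
  unfold scoreConst; positivity

theorem expansionConst_nonneg {C K : ℝ} (hC : 0 ≤ C) (hK : 0 ≤ K) :
    0 ≤ expansionConst d C K := by
  have := scoreConst_nonneg (d := d) hC hK
  unfold expansionConst; positivity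

/-- With s = √n, m = M_n(r) and w = ‖θ − θ₀‖, the three summands are the cubic Taylor remainder, the
score error and the curvature error. -/
theorem expansion_remainder_le {D C₁ K s m w : ℝ} (hC₁ : 0 ≤ C₁)
    (hs : 0 ≤ s) (hm : 0 ≤ m) (hw : 0 ≤ w) :
    s ^ 2 * (D ^ 3 * K * w ^ 3) + s * (D * (C₁ * (m + s * m * w + s * w ^ 2)) * w)
      + s ^ 2 * (D * (D * (C₁ * (m + w)) * w) * w) / 2
      ≤ (D * C₁ + D ^ 2 * C₁ + D ^ 3 * K) * (s * m * w + s ^ 2 * m * w ^ 2 + s ^ 2 * w ^ 3)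
        - D ^ 3 * K * (s * m * w + s ^ 2 * m * w ^ 2) := by
  have h1 : 0 ≤ D ^ 2 * C₁ * (s * m * w) := by positivity
  have h2 : 0 ≤ D ^ 2 * C₁ * (s ^ 2 * m * w ^ 2) := by positivity
  have h3 : 0 ≤ D ^ 2 * C₁ * (s ^ 2 * w ^ 3) := by positivity
  linarith [h1, h2, h3]

variable {M : Model d 𝒳 E} {sub : Vec d → Vec d → E → E} {θ₀ : Vec d} {η₀ : E}
  {I : Matrix (Fin d) (Fin d) ℝ} {F : 𝒳 → ℝ} {r δ C K : ℝ} {n : ℕ} {x : ℕ → 𝒳} {ηh : Vec d → E}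

namespace GoodSample

variable (hg : GoodSample M sub θ₀ η₀ F r δ K n x ηh)

include hg

theorem empMean_ell_taylor {η : E} (hη : η ∈ M.H) (hηd : ‖η - η₀‖ < δ)
    {t t' θ : Vec d} (ht : t ∈ Metric.ball θ₀ δ) (ht' : t' ∈ Metric.ball θ₀ δ)
    (hθ : θ ∈ Metric.ball θ₀ δ) :
    |empMean n x (M.ell sub t' θ η) - empMean n x (M.ell sub t θ η)
      - ∑ i, empMean n x (M.ellT sub i t θ η) * (t' - t) i
      - (∑ i, (∑ j, empMean n x (M.ellTT sub i j t θ η) * (t' - t) j) * (t' - t) i) / 2|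
      ≤ d ^ 3 * K * ‖t' - t‖ ^ 3 := by
  have h := abs_empMean_le (n := n) (x := x) (F := F) (c := d ^ 3 * ‖t' - t‖ ^ 3)
    (f := fun y => M.ell sub t' θ η y - M.ell sub t θ η y
      - ∑ i, M.ellT sub i t θ η y * (t' - t) i
      - (∑ i, (∑ j, M.ellTT sub i j t θ η y * (t' - t) j) * (t' - t) i) / 2)
    (fun k => ((hg.smooth k).ell_taylor hη hηd ht ht' hθ).trans_eq (by ring))
  simp only [div_eq_mul_inv, empMean_sub, empMean_sum, empMean_mul_const] at h ⊢
  refine h.trans ?_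
  calc _ ≤ (d : ℝ) ^ 3 * ‖t' - t‖ ^ 3 * K := mul_le_mul_of_nonneg_left hg.mean (by positivity)
    _ = _ := by ring

theorem empMean_ellT_taylor {η : E} (hη : η ∈ M.H) (hηd : ‖η - η₀‖ < δ)
    {t t' θ : Vec d} (ht : t ∈ Metric.ball θ₀ δ) (ht' : t' ∈ Metric.ball θ₀ δ)
    (hθ : θ ∈ Metric.ball θ₀ δ) (i : Fin d) :
    |empMean n x (M.ellT sub i t' θ η) - empMean n x (M.ellT sub i t θ η)
      - ∑ j, empMean n x (M.ellTT sub i j t θ η) * (t' - t) j|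
      ≤ d ^ 2 * K * ‖t' - t‖ ^ 2 := by
  have h := abs_empMean_le (n := n) (x := x) (F := F) (c := d ^ 2 * ‖t' - t‖ ^ 2)
    (f := fun y => M.ellT sub i t' θ η y - M.ellT sub i t θ η y
      - ∑ j, M.ellTT sub i j t θ η y * (t' - t) j)
    (fun k => ((hg.smooth k).ellT_taylor hη hηd ht ht' hθ i).trans_eq (by ring))
  simp only [empMean_sub, empMean_sum, empMean_mul_const] at h ⊢
  refine h.trans ?_
  calc _ ≤ (d : ℝ) ^ 2 * ‖t' - t‖ ^ 2 * K := mul_le_mul_of_nonneg_left hg.mean (by positivity)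
    _ = _ := by ring

/-- The log-likelihood expands, along the submodel through `(ψ, ηh ψ)`, like the
log-likelihood of a Gaussian shift. -/
theorem abs_ell_sub_le (hp : PopulationBound M sub θ₀ η₀ I δ C) (hη₀ : η₀ ∈ M.H) (hn : 0 < n)
    (hK : 0 < K) (hC : 0 ≤ C) {θ ψ : Vec d} (hθ : θ ∈ Metric.ball θ₀ δ)
    (hψ : NearTruth M θ₀ η₀ δ K ηh ψ) (hψθ : ‖ψ - θ₀‖ ≤ ‖θ - θ₀‖) :
    |n * (empMean n x (M.ell sub θ ψ (ηh ψ)) - empMean n x (M.ell sub θ₀ ψ (ηh ψ)))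
      - (√(n : ℝ) * ∑ i, empProc (M.law θ₀ η₀) n x (M.ellT sub i θ₀ θ₀ η₀) * (θ - θ₀) i
        - n / 2 * quadForm I (θ - θ₀))|
      ≤ expansionConst d C K * (√(n : ℝ) * rateM r n * ‖θ - θ₀‖
        + √(n : ℝ) ^ 2 * rateM r n * ‖θ - θ₀‖ ^ 2 + √(n : ℝ) ^ 2 * ‖θ - θ₀‖ ^ 3) := by
  have hδ : 0 < δ := (norm_nonneg _).trans_lt hψ.nuisance
  have hθ₀ : θ₀ ∈ Metric.ball θ₀ δ := Metric.mem_ball_self hδ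
  have hn0 : (0 : ℝ) ≤ n := n.cast_nonneg
  have hs : 0 ≤ √(n : ℝ) := Real.sqrt_nonneg _
  have hss : √(n : ℝ) ^ 2 = n := Real.sq_sqrt hn0
  have hm0 := rateM_nonneg r n
  have hw0 : 0 ≤ ‖θ - θ₀‖ := norm_nonneg _
  have hC₁ := scoreConst_nonneg (d := d) hC hK.le
  have h1 := hg.empMean_ell_taylor (hg.mem ψ) hψ.nuisance hθ₀ hθ hψ.ball
  have h2 : ∀ i, |√(n : ℝ) * empMean n x (M.ellT sub i θ₀ ψ (ηh ψ))
        - empProc (M.law θ₀ η₀) n x (M.ellT sub i θ₀ θ₀ η₀)|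
      ≤ scoreConst d C K * (rateM r n + √(n : ℝ) * rateM r n * ‖θ - θ₀‖
        + √(n : ℝ) * ‖θ - θ₀‖ ^ 2) := fun i => by
    refine (hg.abs_sqrt_mul_empMean_ellT_sub_le hp hη₀ hn hK hC hψ.ball hψ.mem hψ.inv
      hψ.nuisance i).trans ?_
    gcongr
  have h3 : ∀ i j, |empMean n x (M.ellTT sub i j θ₀ ψ (ηh ψ)) + I i j|
      ≤ scoreConst d C K * (rateM r n + ‖θ - θ₀‖) := fun i j => by
    refine (hg.abs_empMean_ellTT_add_le hp hn hK hC hψ.ball hψ.mem hψ.inv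
      hψ.nuisance i j).trans ?_
    gcongr
  set R := empMean n x (M.ell sub θ ψ (ηh ψ)) - empMean n x (M.ell sub θ₀ ψ (ηh ψ))
      - ∑ i, empMean n x (M.ellT sub i θ₀ ψ (ηh ψ)) * (θ - θ₀) i
      - (∑ i, (∑ j, empMean n x (M.ellTT sub i j θ₀ ψ (ηh ψ)) * (θ - θ₀) j) * (θ - θ₀) i) / 2
    with hR
  have h2' := abs_sum_mul_le h2 (θ - θ₀)
  have h3' := abs_sum_mul_le (fun i => abs_sum_mul_le (h3 i) (θ - θ₀)) (θ - θ₀)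
  -- Replacing the empirical score and Hessian in the Taylor polynomial by 𝔾_n ℓ̇₀ and −I leaves
  -- exactly these three errors.
  have hdec : n * (empMean n x (M.ell sub θ ψ (ηh ψ)) - empMean n x (M.ell sub θ₀ ψ (ηh ψ)))
      - (√(n : ℝ) * ∑ i, empProc (M.law θ₀ η₀) n x (M.ellT sub i θ₀ θ₀ η₀) * (θ - θ₀) i
        - n / 2 * quadForm I (θ - θ₀))
      = √(n : ℝ) ^ 2 * R + √(n : ℝ) * (∑ i, (√(n : ℝ) * empMean n x (M.ellT sub i θ₀ ψ (ηh ψ))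
          - empProc (M.law θ₀ η₀) n x (M.ellT sub i θ₀ θ₀ η₀)) * (θ - θ₀) i)
        + √(n : ℝ) ^ 2 * (∑ i, (∑ j, (empMean n x (M.ellTT sub i j θ₀ ψ (ηh ψ)) + I i j)
          * (θ - θ₀) j) * (θ - θ₀) i) / 2 := by
    simp only [hR, quadForm, sub_mul, add_mul, Finset.sum_sub_distrib, Finset.sum_add_distrib,
      mul_assoc, ← Finset.mul_sum]
    rw [hss]
    linear_combination (-(∑ i, empMean n x (M.ellT sub i θ₀ ψ (ηh ψ)) * (θ - θ₀) i)) * hss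
  rw [hdec]
  have e1 : |√(n : ℝ) ^ 2 * R| ≤ √(n : ℝ) ^ 2 * (d ^ 3 * K * ‖θ - θ₀‖ ^ 3) := by
    rw [abs_mul, abs_of_nonneg (by positivity : 0 ≤ √(n : ℝ) ^ 2)]
    exact mul_le_mul_of_nonneg_left h1 (by positivity)
  have e2 := mul_le_mul_of_nonneg_left h2' hs
  rw [← abs_of_nonneg hs, ← abs_mul, abs_of_nonneg hs] at e2
  have e3 := mul_le_mul_of_nonneg_left h3' (by positivity : 0 ≤ √(n : ℝ) ^ 2)
  rw [← abs_of_nonneg (by positivity : 0 ≤ √(n : ℝ) ^ 2), ← abs_mul,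
    abs_of_nonneg (by positivity : 0 ≤ √(n : ℝ) ^ 2)] at e3
  have e3' := div_le_div_of_nonneg_right e3 zero_le_two
  rw [← abs_of_nonneg (zero_le_two (α := ℝ)), ← abs_div, abs_of_nonneg (zero_le_two (α := ℝ))]
    at e3'
  refine ((abs_add_le _ _).trans (add_le_add ((abs_add_le _ _).trans (add_le_add e1 e2))
    e3')).trans ((expansion_remainder_le hC₁ hs hm0 hw0).trans ?_)
  have : 0 ≤ (d : ℝ) ^ 3 * K * (√(n : ℝ) * rateM r n * ‖θ - θ₀‖
        + √(n : ℝ) ^ 2 * rateM r n * ‖θ - θ₀‖ ^ 2) := by positivity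
  unfold expansionConst
  linarith

/-- Quadratic expansion of the log profile likelihood around the truth. -/
theorem abs_log_profLik_sub_le (hp : PopulationBound M sub θ₀ η₀ I δ C) (hη₀ : η₀ ∈ M.H)
    (hA2 : ∀ θ ∈ M.Θ, ∀ η ∈ M.H, sub θ θ η = η)
    (hsub : ∀ t ∈ Metric.ball θ₀ δ, ∀ θ ∈ Metric.ball θ₀ δ, ∀ η ∈ M.H, ‖η - η₀‖ < δ →
        sub t θ η ∈ M.H) (hn : 0 < n)
    (hK : 0 < K) (hC : 0 ≤ C) {θ : Vec d} (hθ : NearTruth M θ₀ η₀ δ K ηh θ)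
    (hθ₀ : NearTruth M θ₀ η₀ δ K ηh θ₀) :
    0 < M.profLik n x θ ∧
    |Real.log (M.profLik n x θ) - Real.log (M.profLik n x θ₀)
      - (√(n : ℝ) * ∑ i, empProc (M.law θ₀ η₀) n x (M.ellT sub i θ₀ θ₀ η₀) * (θ - θ₀) i
        - n / 2 * quadForm I (θ - θ₀))|
      ≤ expansionConst d C K * (√(n : ℝ) * rateM r n * ‖θ - θ₀‖
        + √(n : ℝ) ^ 2 * rateM r n * ‖θ - θ₀‖ ^ 2 + √(n : ℝ) ^ 2 * ‖θ - θ₀‖ ^ 3) := by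
  have hlog : ∀ {t ψ : Vec d}, t ∈ Metric.ball θ₀ δ → NearTruth M θ₀ η₀ δ K ηh ψ →
      0 < M.likn n x t (sub t ψ (ηh ψ)) ∧
        Real.log (M.likn n x t (sub t ψ (ηh ψ))) = n * empMean n x (M.ell sub t ψ (ηh ψ)) :=
    fun ht hψ => Model.log_likn hn fun k =>
      (hg.smooth k).pos _ (hg.mem _) hψ.nuisance _ ht _ hψ.ball
  have hself : ∀ {ψ : Vec d}, NearTruth M θ₀ η₀ δ K ηh ψ →
      0 < M.profLik n x ψ ∧ Real.log (M.profLik n x ψ) = n * empMean n x (M.ell sub ψ ψ (ηh ψ)) :=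
    fun {ψ} hψ => by
      have := hlog hψ.ball hψ
      rw [Model.profLik_eq_likn (hg.max ψ hψ.mem) (hg.mem ψ)]
      rwa [hA2 ψ hψ.mem _ (hg.mem ψ)] at this
  -- The squeezing inequality: the submodel through (ψ, η̂_ψ) is a competitor in the supremum
  -- defining pl_n(t).
  have hcross : ∀ {t ψ : Vec d}, NearTruth M θ₀ η₀ δ K ηh t → NearTruth M θ₀ η₀ δ K ηh ψ →
      n * empMean n x (M.ell sub t ψ (ηh ψ)) ≤ Real.log (M.profLik n x t) := fun {t ψ} ht hψ => by
    have h := hlog ht.ball hψ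
    rw [← h.2]
    exact Real.log_le_log h.1 (Model.likn_le_profLik (hg.max t ht.mem)
      (hsub t ht.ball ψ hψ.ball _ (hg.mem ψ) hψ.nuisance))
  refine ⟨(hself hθ).1, ?_⟩
  -- The submodel based at θ bounds the difference from above, the one based at θ₀ from below, and
  -- both have the same quadratic part.
  have u := hg.abs_ell_sub_le hp hη₀ hn hK hC hθ.ball hθ le_rfl
  have l := hg.abs_ell_sub_le hp hη₀ hn hK hC hθ.ball hθ₀ (by simp)
  have c1 := hcross hθ₀ hθ
  have c2 := hcross hθ hθ₀
  have s1 := (hself hθ).2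
  have s2 := (hself hθ₀).2
  rw [abs_le] at u l ⊢
  constructor
  · linarith [l.1]
  · linarith [u.2]

/-- The score equation at the maximum profile likelihood estimator. -/
theorem empMean_ellT_eq_zero (hA2 : ∀ θ ∈ M.Θ, ∀ η ∈ M.H, sub θ θ η = η)
    (hsub : ∀ t ∈ Metric.ball θ₀ δ, ∀ θ ∈ Metric.ball θ₀ δ, ∀ η ∈ M.H, ‖η - η₀‖ < δ →
        sub t θ η ∈ M.H) (hball : Metric.ball θ₀ δ ⊆ M.Θ) (hn : 0 < n) {θh : Vec d}
    (hθh : NearTruth M θ₀ η₀ δ K ηh θh) (hmax : IsMaxOn (fun θ => M.profLik n x θ) M.Θ θh)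
    (i : Fin d) : empMean n x (M.ellT sub i θh θh (ηh θh)) = 0 := by
  have hn' : (0 : ℝ) < n := by exact_mod_cast hn
  have hlog : ∀ {t : Vec d}, t ∈ Metric.ball θ₀ δ → 0 < M.likn n x t (sub t θh (ηh θh)) ∧
        Real.log (M.likn n x t (sub t θh (ηh θh))) = n * empMean n x (M.ell sub t θh (ηh θh)) :=
    fun ht => Model.log_likn hn fun k =>
      (hg.smooth k).pos _ (hg.mem _) hθh.nuisance _ ht _ hθh.ball
  -- Along the submodel through (θh, η̂_θh) the likelihood lies below pl_n(t) ≤ pl_n(θh) and attains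
  -- this value at t = θh, so its derivative vanishes there.
  have hle : ∀ t ∈ Metric.ball θ₀ δ,
      empMean n x (M.ell sub t θh (ηh θh)) ≤ empMean n x (M.ell sub θh θh (ηh θh)) := by
    intro t ht
    refine le_of_mul_le_mul_left ?_ hn'
    rw [← (hlog ht).2, ← (hlog hθh.ball).2]
    refine Real.log_le_log (hlog ht).1 ?_
    rw [hA2 θh hθh.mem _ (hg.mem θh), ← Model.profLik_eq_likn (hg.max θh hθh.mem) (hg.mem θh)]
    exact (Model.likn_le_profLik (hg.max t (hball ht))
      (hsub t ht θh hθh.ball _ (hg.mem θh) hθh.nuisance)).trans (hmax (hball ht))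
  have hder : HasDerivAt (fun s : ℝ =>
      empMean n x (M.ell sub (θh + s • EuclideanSpace.single i 1) θh (ηh θh)))
      (empMean n x (M.ellT sub i θh θh (ηh θh))) 0 :=
    (HasDerivAt.fun_sum fun k _ => (hg.smooth k).hasDerivAt_ell_fst (hg.mem θh) hθh.nuisance
      hθh.ball hθh.ball i).const_mul _
  refine IsLocalMax.hasDerivAt_eq_zero ?_ hder
  have hcont : Continuous fun s : ℝ => θh + s • (EuclideanSpace.single i 1 : Vec d) := by fun_prop
  have hnhds : (fun s : ℝ => θh + s • (EuclideanSpace.single i 1 : Vec d)) ⁻¹'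
      Metric.ball θ₀ δ ∈ 𝓝 (0 : ℝ) :=
    hcont.continuousAt.preimage_mem_nhds (Metric.isOpen_ball.mem_nhds (by simpa using hθh.ball))
  filter_upwards [hnhds] with s hs
  simpa using hle _ hs

/-- Asymptotic linearity of the maximum profile likelihood estimator, in implicit form. -/
theorem abs_score_sub_le (hp : PopulationBound M sub θ₀ η₀ I δ C) (hη₀ : η₀ ∈ M.H)
    (hA2 : ∀ θ ∈ M.Θ, ∀ η ∈ M.H, sub θ θ η = η)
    (hsub : ∀ t ∈ Metric.ball θ₀ δ, ∀ θ ∈ Metric.ball θ₀ δ, ∀ η ∈ M.H, ‖η - η₀‖ < δ →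
        sub t θ η ∈ M.H) (hball : Metric.ball θ₀ δ ⊆ M.Θ) (hn : 0 < n)
    (hK : 0 < K) (hC : 0 ≤ C) {θh : Vec d} (hθh : NearTruth M θ₀ η₀ δ K ηh θh)
    (hmax : IsMaxOn (fun θ => M.profLik n x θ) M.Θ θh) (i : Fin d) :
    |empProc (M.law θ₀ η₀) n x (M.ellT sub i θ₀ θ₀ η₀)
        - √(n : ℝ) * ∑ j, I i j * (θh - θ₀) j|
      ≤ expansionConst d C K * (rateM r n + √(n : ℝ) * rateM r n * ‖θh - θ₀‖
        + √(n : ℝ) * ‖θh - θ₀‖ ^ 2) + scoreConst d C K * (rateM r n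
          + √(n : ℝ) * rateM r n * ‖θh - θ₀‖ + √(n : ℝ) * ‖θh - θ₀‖ ^ 2)
        + d ^ 2 * K * (√(n : ℝ) * ‖θh - θ₀‖ ^ 2) := by
  have hδ : 0 < δ := (norm_nonneg _).trans_lt hθh.nuisance
  have hθ₀ : θ₀ ∈ Metric.ball θ₀ δ := Metric.mem_ball_self hδ
  have hs : 0 ≤ √(n : ℝ) := Real.sqrt_nonneg _
  have hm0 := rateM_nonneg r n
  have hw0 : 0 ≤ ‖θh - θ₀‖ := norm_nonneg _
  have hC₁ := scoreConst_nonneg (d := d) hC hK.le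
  have h0 := hg.empMean_ellT_eq_zero hA2 hsub hball hn hθh hmax i
  have h1 := hg.empMean_ellT_taylor (hg.mem θh) hθh.nuisance hθ₀ hθh.ball hθh.ball i
  have h2 := hg.abs_sqrt_mul_empMean_ellT_sub_le hp hη₀ hn hK hC hθh.ball hθh.mem hθh.inv
      hθh.nuisance i
  have h3 := abs_sum_mul_le (fun j => hg.abs_empMean_ellTT_add_le hp hn hK hC hθh.ball hθh.mem
    hθh.inv hθh.nuisance i j) (θh - θ₀)
  rw [h0] at h1
  have h1' := mul_le_mul_of_nonneg_left h1 hs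
  rw [← abs_of_nonneg hs, ← abs_mul, abs_of_nonneg hs] at h1'
  have h3' := mul_le_mul_of_nonneg_left h3 hs
  rw [← abs_of_nonneg hs, ← abs_mul, abs_of_nonneg hs] at h3'
  -- The zero inside the last bracket is the score at θh; the brackets are the errors of the
  -- Hessian, of the score at θ₀ and of the Taylor expansion from θ₀ to θh.
  have hdec : empProc (M.law θ₀ η₀) n x (M.ellT sub i θ₀ θ₀ η₀)
        - √(n : ℝ) * ∑ j, I i j * (θh - θ₀) j
      = -(√(n : ℝ) * (∑ j, (empMean n x (M.ellTT sub i j θ₀ θh (ηh θh)) + I i j) * (θh - θ₀) j))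
        - (√(n : ℝ) * empMean n x (M.ellT sub i θ₀ θh (ηh θh))
          - empProc (M.law θ₀ η₀) n x (M.ellT sub i θ₀ θ₀ η₀))
        - √(n : ℝ) * (0 - empMean n x (M.ellT sub i θ₀ θh (ηh θh))
          - ∑ j, empMean n x (M.ellTT sub i j θ₀ θh (ηh θh)) * (θh - θ₀) j) := by
    simp only [add_mul, Finset.sum_add_distrib]
    ring
  rw [hdec]
  have habs : ∀ a b c : ℝ, |-a - b - c| ≤ |a| + |b| + |c| := fun a b c =>
    (abs_sub _ _).trans (add_le_add ((abs_sub _ _).trans (by rw [abs_neg])) le_rfl)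
  refine (habs _ _ _).trans ?_
  have k1 : √(n : ℝ) * (d * (scoreConst d C K * (rateM r n + ‖θh - θ₀‖)) * ‖θh - θ₀‖)
      ≤ expansionConst d C K * (rateM r n + √(n : ℝ) * rateM r n * ‖θh - θ₀‖
        + √(n : ℝ) * ‖θh - θ₀‖ ^ 2) := by
    have hE : (d : ℝ) * scoreConst d C K ≤ expansionConst d C K := by
      have : 0 ≤ (d : ℝ) ^ 2 * scoreConst d C K + d ^ 3 * K := by positivity
      unfold expansionConst
      linarith
    calc _ = d * scoreConst d C K * (√(n : ℝ) * rateM r n * ‖θh - θ₀‖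
          + √(n : ℝ) * ‖θh - θ₀‖ ^ 2) := by ring
      _ ≤ expansionConst d C K * (√(n : ℝ) * rateM r n * ‖θh - θ₀‖
          + √(n : ℝ) * ‖θh - θ₀‖ ^ 2) := mul_le_mul_of_nonneg_right hE (by positivity)
      _ ≤ _ := by
        refine mul_le_mul_of_nonneg_left ?_ (expansionConst_nonneg hC hK.le)
        linarith
  linarith [k1, h1', h2, h3']

end GoodSample

end Expansion


/-! ### Expansion around the maximum profile likelihood estimator -/

section Recentred

variable {d : ℕ} {𝒳 E : Type*} [MeasurableSpace 𝒳] [SeminormedAddCommGroup E]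

theorem quadForm_add_eq {I : Matrix (Fin d) (Fin d) ℝ} (hI : ∀ i j, I i j = I j i)
    (u v : Vec d) :
    quadForm I (u + v) = quadForm I u + quadForm I v + 2 * ∑ i, (∑ j, I i j * v j) * u i := by
  have hsymm : ∑ i, (∑ j, I i j * u j) * v i = ∑ i, (∑ j, I i j * v j) * u i := by
    simp only [Finset.sum_mul]
    rw [Finset.sum_comm]
    refine Finset.sum_congr rfl fun i _ => Finset.sum_congr rfl fun j _ => ?_
    rw [hI j i]
    ring
  simp only [quadForm, PiLp.add_apply, mul_add, add_mul, Finset.sum_add_distrib]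
  rw [hsymm]
  ring

/-- After division by w, the two terms containing s w are each at most lam/4 times s w and are
absorbed on the left, which costs the factor 2. Applied with w = ‖θ̂_n − θ₀‖ it gives
√n-consistency. -/
theorem le_of_quadratic_bound {D K C₃ m w s lam : ℝ} (hD : 0 ≤ D) (hC₃ : 0 ≤ C₃)
    (hlam : 0 < lam) (hs : 0 ≤ s) (hw : 0 ≤ w) (hm1 : m ≤ 1) (hK : 0 ≤ K)
    (hm : D * C₃ * m ≤ lam / 4) (hw' : D * C₃ * w ≤ lam / 4)
    (h : s * (lam * w ^ 2) ≤ D * (K + C₃ * (m + s * m * w + s * w ^ 2)) * w) :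
    s * w ≤ 2 * D * (K + C₃) / lam := by
  rcases hw.eq_or_lt with rfl | hwpos
  · rw [mul_zero]; positivity
  have h1 : lam * (s * w) ≤ D * (K + C₃ * (m + s * m * w + s * w ^ 2)) := by
    refine le_of_mul_le_mul_right ?_ hwpos
    calc lam * (s * w) * w = s * (lam * w ^ 2) := by ring
      _ ≤ _ := h
  have hsw : 0 ≤ s * w := mul_nonneg hs hw
  have h2 := mul_le_mul_of_nonneg_right hm hsw
  have h3 := mul_le_mul_of_nonneg_right hw' hsw
  have h4 : D * C₃ * m ≤ D * C₃ := mul_le_of_le_one_right (by positivity) hm1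
  rw [le_div_iff₀ hlam]
  linarith [h1, h2, h3, h4]

/-- The constant in the expansion around the maximum profile likelihood estimator. -/
def recentredConst (D C₄ E₁ H : ℝ) : ℝ :=
  H + D * C₄ + E₁ * (5 + 2 * H + 5 * H ^ 2 + 3 * H ^ 3)

/-- Here w and wh are the distances of θ and θ̂_n from θ₀, and y = √n‖θ − θ̂_n‖. The cubic term is
kept as w y² and not as m y³, so that for small w it can later be absorbed into the Gaussian
exponent. -/
theorem recentred_remainder_le {D C₄ E₁ H m w s y wh : ℝ} (hD : 0 ≤ D) (hC₄ : 0 ≤ C₄)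
    (hE : 0 ≤ E₁) (hm : 0 ≤ m) (hw : 0 ≤ w) (hwh : 0 ≤ wh) (hs : 0 < s) (hy : 0 ≤ y)
    (hH : s * wh ≤ H) (hsm : s⁻¹ ≤ m) (h : s * w ≤ y + H) :
    E₁ * (s * m * w + s ^ 2 * m * w ^ 2 + s ^ 2 * w ^ 3)
      + E₁ * (s * m * wh + s ^ 2 * m * wh ^ 2 + s ^ 2 * wh ^ 3) + D * C₄ * m * y
      ≤ recentredConst D C₄ E₁ H * (m * (1 + y + y ^ 2) + w * y ^ 2) := by
  have hsw : 0 ≤ s * w := by positivity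
  have hswh : 0 ≤ s * wh := by positivity
  have hH0 : 0 ≤ H := hswh.trans hH
  have hdiv : ∀ {z B : ℝ}, s * z ≤ B → 0 ≤ B → z ≤ m * B := by
    intro z B hz hB
    calc z = s⁻¹ * (s * z) := by field_simp
      _ ≤ s⁻¹ * B := mul_le_mul_of_nonneg_left hz (by positivity)
      _ ≤ m * B := mul_le_mul_of_nonneg_right hsm hB
  have a1 : s * m * w ≤ m * (y + H) := by
    calc s * m * w = m * (s * w) := by ring
      _ ≤ _ := mul_le_mul_of_nonneg_left h hm
  have sq : (s * w) ^ 2 ≤ 2 * y ^ 2 + 2 * H ^ 2 :=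
    (pow_le_pow_left₀ hsw h 2).trans (by nlinarith [sq_nonneg (y - H)])
  have a2 : s ^ 2 * m * w ^ 2 ≤ m * (2 * y ^ 2 + 2 * H ^ 2) := by
    calc s ^ 2 * m * w ^ 2 = m * (s * w) ^ 2 := by ring
      _ ≤ _ := mul_le_mul_of_nonneg_left sq hm
  have a3 : s ^ 2 * w ^ 3 ≤ 2 * (w * y ^ 2) + 2 * H ^ 2 * (m * (y + H)) := by
    calc s ^ 2 * w ^ 3 = w * (s * w) ^ 2 := by ring
      _ ≤ w * (2 * y ^ 2 + 2 * H ^ 2) := mul_le_mul_of_nonneg_left sq hw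
      _ = 2 * (w * y ^ 2) + 2 * H ^ 2 * w := by ring
      _ ≤ _ := add_le_add le_rfl (mul_le_mul_of_nonneg_left (hdiv h (by positivity))
        (by positivity))
  have b1 : s * m * wh ≤ m * H := by
    calc s * m * wh = m * (s * wh) := by ring
      _ ≤ _ := mul_le_mul_of_nonneg_left hH hm
  have sq' : (s * wh) ^ 2 ≤ H ^ 2 := pow_le_pow_left₀ hswh hH 2
  have b2 : s ^ 2 * m * wh ^ 2 ≤ m * H ^ 2 := by
    calc s ^ 2 * m * wh ^ 2 = m * (s * wh) ^ 2 := by ring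
      _ ≤ _ := mul_le_mul_of_nonneg_left sq' hm
  have b3 : s ^ 2 * wh ^ 3 ≤ m * H * H ^ 2 := by
    calc s ^ 2 * wh ^ 3 = wh * (s * wh) ^ 2 := by ring
      _ ≤ wh * H ^ 2 := mul_le_mul_of_nonneg_left sq' hwh
      _ ≤ _ := mul_le_mul_of_nonneg_right (hdiv hH hH0) (by positivity)
  have e1 := mul_le_mul_of_nonneg_left (add_le_add (add_le_add a1 a2) a3) hE
  have e2 := mul_le_mul_of_nonneg_left (add_le_add (add_le_add b1 b2) b3) hE
  have hmy : 0 ≤ m * y := by positivity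
  have hmy2 : 0 ≤ m * y ^ 2 := by positivity
  have hwy2 : 0 ≤ w * y ^ 2 := by positivity
  have c0 : E₁ * (m * (2 * H + 3 * H ^ 2 + 3 * H ^ 3))
      ≤ recentredConst D C₄ E₁ H * m := by
    have : 0 ≤ (H + D * C₄ + E₁ * (5 + 2 * H ^ 2)) * m := by positivity
    unfold recentredConst
    linarith
  have c1 : (D * C₄ + E₁ * (1 + 2 * H ^ 2)) * (m * y) ≤ recentredConst D C₄ E₁ H * (m * y) := by
    refine mul_le_mul_of_nonneg_right ?_ hmy
    have : 0 ≤ H + E₁ * (4 + 2 * H + 3 * H ^ 2 + 3 * H ^ 3) := by positivity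
    unfold recentredConst
    linarith
  have c2' : E₁ * 2 ≤ recentredConst D C₄ E₁ H := by
    have : 0 ≤ H + D * C₄ + E₁ * (3 + 2 * H + 5 * H ^ 2 + 3 * H ^ 3) := by positivity
    unfold recentredConst
    linarith
  have c2 := mul_le_mul_of_nonneg_right c2' hmy2
  have c3 := mul_le_mul_of_nonneg_right c2' hwy2
  linarith [e1, e2, c0, c1, c2, c3]

/-- The expansion of the log profile likelihood around its maximizer. -/
structure RecentredExpansion (M : Model d 𝒳 E) (θ₀ : Vec d) (I : Matrix (Fin d) (Fin d) ℝ)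
    (r B δ : ℝ) (n : ℕ) (x : ℕ → 𝒳) (θh : Vec d) : Prop where
  close : √(n : ℝ) * ‖θh - θ₀‖ ≤ B
  pos_hat : 0 < M.profLik n x θh
  pos : ∀ θ, ‖θ - θ₀‖ < δ → 0 < M.profLik n x θ
  expansion : ∀ θ, ‖θ - θ₀‖ < δ →
    |Real.log (M.profLik n x θ) - Real.log (M.profLik n x θh) + n / 2 * quadForm I (θ - θh)|
      ≤ B * (rateM r n * (1 + √(n : ℝ) * ‖θ - θh‖ + (√(n : ℝ) * ‖θ - θh‖) ^ 2)
        + ‖θ - θ₀‖ * (√(n : ℝ) * ‖θ - θh‖) ^ 2)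

variable {M : Model d 𝒳 E} {sub : Vec d → Vec d → E → E} {θ₀ : Vec d} {η₀ : E}
  {I : Matrix (Fin d) (Fin d) ℝ} {F : 𝒳 → ℝ} {r δ C K : ℝ}

theorem exists_recentredExpansion (hp : PopulationBound M sub θ₀ η₀ I δ C) (hη₀ : η₀ ∈ M.H)
    (hA2 : ∀ θ ∈ M.Θ, ∀ η ∈ M.H, sub θ θ η = η)
    (hsub : ∀ t ∈ Metric.ball θ₀ δ, ∀ θ ∈ Metric.ball θ₀ δ, ∀ η ∈ M.H, ‖η - η₀‖ < δ →
        sub t θ η ∈ M.H) (hball : Metric.ball θ₀ δ ⊆ M.Θ) (hδ : 0 < δ) (hK : 0 < K) (hC : 0 ≤ C)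
    (hI : ∀ i j, I i j = I j i) {lam : ℝ} (hlam : 0 < lam)
    (hpd : ∀ v, lam * ‖v‖ ^ 2 ≤ quadForm I v) :
    ∃ B > 0, ∃ δ₁ > 0, ∃ ε₁ > 0, ∀ n > 0, rateM r n ≤ ε₁ → ∀ (x : ℕ → 𝒳) (ηh : Vec d → E)
      (θh : Vec d), GoodSample M sub θ₀ η₀ F r δ K n x ηh → θh ∈ M.Θ → ‖θh - θ₀‖ < δ₁ →
      IsMaxOn (fun θ => M.profLik n x θ) M.Θ θh → RecentredExpansion M θ₀ I r B δ₁ n x θh := by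
  set S := scoreConst d C K with hS
  set E₁ := expansionConst d C K with hE₁
  have hS0 : 0 ≤ S := scoreConst_nonneg hC hK.le
  have hE0 : 0 ≤ E₁ := expansionConst_nonneg hC hK.le
  set C₃ : ℝ := E₁ + S + d ^ 2 * K with hC₃
  have hC₃0 : 0 ≤ C₃ := by positivity
  set H : ℝ := 2 * d * (K + C₃) / lam with hH
  have hH0 : 0 ≤ H := by positivity
  set C₄ : ℝ := C₃ * (1 + H + H ^ 2) with hC₄
  have hC₄0 : 0 ≤ C₄ := by positivity
  have hR0 : 0 ≤ recentredConst d C₄ E₁ H := by unfold recentredConst; positivity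
  -- Below this threshold the error terms are absorbed by lam in the √n-consistency step; the added
  -- 1 avoids division by zero.
  set κ : ℝ := lam / (4 * (d * C₃ + 1)) with hκ
  have hκ0 : 0 < κ := by positivity
  have hκle : ∀ z : ℝ, z ≤ κ → d * C₃ * z ≤ lam / 4 := by
    intro z hz
    have h1 : d * C₃ * z ≤ d * C₃ * κ := mul_le_mul_of_nonneg_left hz (by positivity)
    have h2 : (d * C₃ + 1) * κ = lam / 4 := by rw [hκ]; field_simp
    linarith
  -- Adding 1 only serves positivity of B. The bounds δ/(2K) on ‖θ − θ₀‖ and on the rate together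
  -- keep η̂_θ within δ of η₀.
  refine ⟨recentredConst d C₄ E₁ H + 1, by positivity,
    min (min δ K⁻¹) (min (δ / (2 * K)) κ), by positivity, min (min 1 (δ / (2 * K))) κ,
    by positivity, ?_⟩
  intro n hn hm x ηh θh hg hθhΘ hθh hmax
  have hnear : ∀ θ, ‖θ - θ₀‖ < min (min δ K⁻¹) (min (δ / (2 * K)) κ) →
      NearTruth M θ₀ η₀ δ K ηh θ := by
    intro θ hθ
    have h1 : ‖θ - θ₀‖ < δ := hθ.trans_le ((min_le_left _ _).trans (min_le_left _ _))
    have h2 : ‖θ - θ₀‖ < K⁻¹ := hθ.trans_le ((min_le_left _ _).trans (min_le_right _ _))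
    have h3 : ‖θ - θ₀‖ < δ / (2 * K) := hθ.trans_le ((min_le_right _ _).trans (min_le_left _ _))
    have hb : θ ∈ Metric.ball θ₀ δ := by simpa [dist_eq_norm] using h1
    refine ⟨hb, hball hb, h2, (hg.rate θ (hball hb) h2).trans_lt ?_⟩
    have h4 : (n : ℝ) ^ (-r) ≤ δ / (2 * K) :=
      (rpow_le_rateM hn).trans (hm.trans ((min_le_left _ _).trans (min_le_right _ _)))
    calc K * (‖θ - θ₀‖ + (n : ℝ) ^ (-r)) < K * (δ / (2 * K) + δ / (2 * K)) :=
          mul_lt_mul_of_pos_left (add_lt_add_of_lt_of_le h3 h4) hK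
      _ = δ := by field_simp; norm_num
  have hn' : (0 : ℝ) < n := by exact_mod_cast hn
  have hs : 0 < √(n : ℝ) := Real.sqrt_pos.2 hn'
  have hss : √(n : ℝ) ^ 2 = n := Real.sq_sqrt hn'.le
  have hm0 := rateM_nonneg r n
  have hwh0 : 0 ≤ ‖θh - θ₀‖ := norm_nonneg _
  have hnh := hnear θh hθh
  have hn0 := hnear θ₀ (by simp only [sub_self, norm_zero]; positivity)
  set Δ : Fin d → ℝ := fun i => empProc (M.law θ₀ η₀) n x (M.ellT sub i θ₀ θ₀ η₀) with hΔ
  have hscore : ∀ i, |Δ i - √(n : ℝ) * ∑ j, I i j * (θh - θ₀) j|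
      ≤ C₃ * (rateM r n + √(n : ℝ) * rateM r n * ‖θh - θ₀‖ + √(n : ℝ) * ‖θh - θ₀‖ ^ 2) := by
    intro i
    refine (hg.abs_score_sub_le hp hη₀ hA2 hsub hball hn hK hC hnh hmax i).trans ?_
    have h1 : 0 ≤ (d : ℝ) ^ 2 * K * (rateM r n + √(n : ℝ) * rateM r n * ‖θh - θ₀‖) := by positivity
    rw [hC₃]
    linarith
  -- root-n consistency
  have hquad : √(n : ℝ) * (lam * ‖θh - θ₀‖ ^ 2) ≤ d * (K + C₃ * (rateM r n
      + √(n : ℝ) * rateM r n * ‖θh - θ₀‖ + √(n : ℝ) * ‖θh - θ₀‖ ^ 2)) * ‖θh - θ₀‖ := by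
    have h1 : ∀ i, |√(n : ℝ) * ∑ j, I i j * (θh - θ₀) j| ≤ K + C₃ * (rateM r n
        + √(n : ℝ) * rateM r n * ‖θh - θ₀‖ + √(n : ℝ) * ‖θh - θ₀‖ ^ 2) := fun i => by
      have e : √(n : ℝ) * ∑ j, I i j * (θh - θ₀) j
          = Δ i - (Δ i - √(n : ℝ) * ∑ j, I i j * (θh - θ₀) j) := by ring
      rw [e]
      exact (abs_sub _ _).trans (add_le_add (hg.score i) (hscore i))
    have h2 := abs_sum_mul_le h1 (θh - θ₀)
    refine le_trans ?_ ((le_abs_self _).trans h2)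
    refine (mul_le_mul_of_nonneg_left (hpd _) hs.le).trans_eq ?_
    simp only [quadForm, Finset.mul_sum, Finset.sum_mul, mul_assoc]
  have hclose : √(n : ℝ) * ‖θh - θ₀‖ ≤ H :=
    le_of_quadratic_bound (Nat.cast_nonneg d) hC₃0 hlam hs.le hwh0
      (hm.trans ((min_le_left _ _).trans (min_le_left _ _))) hK.le
      (hκle _ (hm.trans (min_le_right _ _)))
      (hκle _ (hθh.le.trans ((min_le_right _ _).trans (min_le_right _ _)))) hquad
  have hscore' : ∀ i, |Δ i - √(n : ℝ) * ∑ j, I i j * (θh - θ₀) j| ≤ C₄ * rateM r n := by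
    intro i
    refine (hscore i).trans ?_
    have h1 : √(n : ℝ) * rateM r n * ‖θh - θ₀‖ ≤ rateM r n * H := by
      calc _ = rateM r n * (√(n : ℝ) * ‖θh - θ₀‖) := by ring
        _ ≤ _ := mul_le_mul_of_nonneg_left hclose hm0
    have h2 : √(n : ℝ) * ‖θh - θ₀‖ ^ 2 ≤ rateM r n * H ^ 2 := by
      calc _ = (√(n : ℝ))⁻¹ * (√(n : ℝ) * ‖θh - θ₀‖) ^ 2 := by field_simp
        _ ≤ rateM r n * H ^ 2 := mul_le_mul (inv_sqrt_le_rateM r n)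
          (pow_le_pow_left₀ (by positivity) hclose 2) (by positivity) hm0
    have := mul_le_mul_of_nonneg_left (add_le_add (add_le_add (le_refl (rateM r n)) h1) h2) hC₃0
    rw [hC₄]
    linarith
  have hexph := hg.abs_log_profLik_sub_le hp hη₀ hA2 hsub hn hK hC hnh hn0
  refine ⟨hclose.trans ?_, hexph.1, fun θ hθ =>
    (hg.abs_log_profLik_sub_le hp hη₀ hA2 hsub hn hK hC (hnear θ hθ) hn0).1, fun θ hθ => ?_⟩
  · have : 0 ≤ (d : ℝ) * C₄ + E₁ * (5 + 2 * H + 5 * H ^ 2 + 3 * H ^ 3) := by positivity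
    unfold recentredConst
    linarith
  have hexp := (hg.abs_log_profLik_sub_le hp hη₀ hA2 hsub hn hK hC (hnear θ hθ) hn0).2
  have hlin := abs_sum_mul_le hscore' (θ - θh)
  have hlin' := mul_le_mul_of_nonneg_left hlin hs.le
  rw [← abs_of_nonneg hs.le, ← abs_mul, abs_of_nonneg hs.le] at hlin'
  have hv : θ - θ₀ = (θ - θh) + (θh - θ₀) := by abel
  have hq := quadForm_add_eq hI (θ - θh) (θh - θ₀)
  rw [← hv] at hq
  have hl : ∑ i, Δ i * (θ - θ₀) i = ∑ i, Δ i * (θ - θh) i + ∑ i, Δ i * (θh - θ₀) i := by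
    rw [hv]
    simp only [PiLp.add_apply, mul_add, Finset.sum_add_distrib]
  -- Completing the square at θh: the linear term left over has coefficient Δ − √n I(θh − θ₀),
  -- already known to be of order M_n(r).
  have hcomb : √(n : ℝ) * ∑ i, (Δ i - √(n : ℝ) * ∑ j, I i j * (θh - θ₀) j) * (θ - θh) i
      = √(n : ℝ) * ∑ i, Δ i * (θ - θh) i
        - n * ∑ i, (∑ j, I i j * (θh - θ₀) j) * (θ - θh) i := by
    simp only [sub_mul, Finset.sum_sub_distrib, mul_assoc, ← Finset.mul_sum]
    linear_combination (-(∑ i, (∑ j, I i j * (θh - θ₀) j) * (θ - θh) i)) * hss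
  have hy : √(n : ℝ) * ‖θ - θ₀‖ ≤ √(n : ℝ) * ‖θ - θh‖ + H := by
    have : ‖θ - θ₀‖ ≤ ‖θ - θh‖ + ‖θh - θ₀‖ := by rw [hv]; exact norm_add_le _ _
    have := mul_le_mul_of_nonneg_left this hs.le
    linarith
  have hrem := recentred_remainder_le (Nat.cast_nonneg d) hC₄0 hE0 hm0 (norm_nonneg (θ - θ₀)) hwh0
    hs (by positivity : 0 ≤ √(n : ℝ) * ‖θ - θh‖) hclose (inv_sqrt_le_rateM r n) hy
  have hT0 : 0 ≤ rateM r n * (1 + √(n : ℝ) * ‖θ - θh‖ + (√(n : ℝ) * ‖θ - θh‖) ^ 2)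
        + ‖θ - θ₀‖ * (√(n : ℝ) * ‖θ - θh‖) ^ 2 := by positivity
  have hexph2 := hexph.2
  refine le_trans ?_ (hrem.trans (mul_le_mul_of_nonneg_right
    (le_add_of_nonneg_right zero_le_one) hT0))
  have e : Real.log (M.profLik n x θ) - Real.log (M.profLik n x θh)
        + n / 2 * quadForm I (θ - θh)
      = (Real.log (M.profLik n x θ) - Real.log (M.profLik n x θ₀)
          - (√(n : ℝ) * ∑ i, Δ i * (θ - θ₀) i - n / 2 * quadForm I (θ - θ₀)))
        - (Real.log (M.profLik n x θh) - Real.log (M.profLik n x θ₀)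
          - (√(n : ℝ) * ∑ i, Δ i * (θh - θ₀) i - n / 2 * quadForm I (θh - θ₀)))
        + √(n : ℝ) * ∑ i, (Δ i - √(n : ℝ) * ∑ j, I i j * (θh - θ₀) j) * (θ - θh) i := by
    rw [hcomb, hq, hl]
    ring
  rw [e]
  refine (abs_add_le _ _).trans (add_le_add ((abs_sub _ _).trans (add_le_add hexp hexph2)) ?_)
  refine hlin'.trans_eq ?_
  ring

end Recentred


/-! ### The square root of a positive definite matrix -/

section SquareRoot

variable {d : ℕ} {A : Matrix (Fin d) (Fin d) ℝ}

theorem matSqrt_transpose (A : Matrix (Fin d) (Fin d) ℝ) : (matSqrt A).transpose = matSqrt A := by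
  have h : IsSelfAdjoint (matSqrt A) := cfc_predicate Real.sqrt A
  have h2 : (matSqrt A).conjTranspose = matSqrt A := h
  rwa [Matrix.conjTranspose_eq_transpose_of_trivial] at h2

theorem matSqrt_mul_self (hA : A.PosDef) : matSqrt A * matSqrt A = A := by
  have hsa : IsSelfAdjoint A := hA.isHermitian
  have hsp : ∀ x ∈ spectrum ℝ A, 0 ≤ x := by
    intro x hx
    rw [hA.isHermitian.spectrum_real_eq_range_eigenvalues] at hx
    obtain ⟨i, rfl⟩ := hx
    exact (hA.eigenvalues_pos i).le
  rw [matSqrt, ← cfc_mul Real.sqrt Real.sqrt A]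
  conv_rhs => rw [← cfc_id ℝ A]
  exact cfc_congr fun x hx => Real.mul_self_sqrt (hsp x hx)

theorem det_matSqrt_ne_zero (hA : A.PosDef) : (matSqrt A).det ≠ 0 := by
  intro h
  have := hA.det_pos
  rw [← matSqrt_mul_self hA, Matrix.det_mul, h, mul_zero] at this
  exact lt_irrefl _ this

/-- The linear map of the square root of a matrix. -/
noncomputable def sqrtMap (A : Matrix (Fin d) (Fin d) ℝ) : Vec d →ₗ[ℝ] Vec d :=
  (matSqrt A).toLpLin 2 2

theorem sqrtMap_apply (v : Vec d) (i : Fin d) :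
    sqrtMap A v i = (matSqrt A).mulVec v i := rfl

theorem det_sqrtMap_ne_zero (hA : A.PosDef) : LinearMap.det (sqrtMap A) ≠ 0 := by
  rw [sqrtMap, LinearMap.det_toLpLin]
  exact det_matSqrt_ne_zero hA

theorem norm_sqrtMap_sq (hA : A.PosDef) (v : Vec d) : ‖sqrtMap A v‖ ^ 2 = quadForm A v := by
  have h : quadForm A v = dotProduct (A.mulVec v) v := rfl
  rw [h, EuclideanSpace.norm_sq_eq]
  conv_rhs => rw [← matSqrt_mul_self hA, ← Matrix.mulVec_mulVec, dotProduct_comm,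
    Matrix.dotProduct_mulVec, ← Matrix.mulVec_transpose, matSqrt_transpose]
  simp only [dotProduct, sqrtMap_apply, Real.norm_eq_abs, sq, abs_mul_abs_self]

/-- The square root is injective on a finite-dimensional space, hence antilipschitz; the squared
inverse of its constant serves as lam. -/
theorem exists_le_quadForm (hA : A.PosDef) : ∃ lam > 0, ∀ v, lam * ‖v‖ ^ 2 ≤ quadForm A v := by
  have hker : LinearMap.ker (sqrtMap A) = ⊥ :=
    LinearMap.ker_eq_bot.2 (LinearMap.equivOfDetNeZero (sqrtMap A) (det_sqrtMap_ne_zero hA)).injective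
  obtain ⟨K, hK, hlip⟩ := LinearMap.exists_antilipschitzWith (sqrtMap A) hker
  have hK' : (0 : ℝ) < K := hK
  refine ⟨((K : ℝ) ^ 2)⁻¹, by positivity, fun v => ?_⟩
  have h := hlip.le_mul_dist v 0
  rw [map_zero, dist_zero_right, dist_zero_right] at h
  rw [← norm_sqrtMap_sq hA, inv_mul_le_iff₀ (by positivity), ← mul_pow]
  exact pow_le_pow_left₀ (norm_nonneg _) h 2

end SquareRoot

/-! ### The standard normal distribution function as a ratio of integrals -/

section Normal

variable {d : ℕ}

theorem integrable_exp_neg_mul_sq_norm {b : ℝ} (hb : 0 < b) :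
    Integrable (fun v : Vec d => Real.exp (-b * ‖v‖ ^ 2)) := by
  have h := (GaussianFourier.integrable_cexp_neg_mul_sq_norm_add (V := Vec d) (b := (b : ℂ))
    (by simpa using hb) 0 0).re
  refine h.congr (Eventually.of_forall fun v => ?_)
  change (Complex.exp _).re = _
  rw [zero_mul, add_zero, ← Complex.ofReal_neg, ← Complex.ofReal_pow, ← Complex.ofReal_mul,
    Complex.exp_ofReal_re]

theorem integral_exp_neg_mul_sq_norm_pos {b : ℝ} (hb : 0 < b) :
    0 < ∫ v : Vec d, Real.exp (-b * ‖v‖ ^ 2) :=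
  integral_exp_pos (integrable_exp_neg_mul_sq_norm hb)

theorem integral_orthant_exp (ξ : Fin d → ℝ) :
    ∫ v in {v : Vec d | ∀ i, v i ≤ ξ i}, Real.exp (-(1 / 2) * ‖v‖ ^ 2)
      = ∏ i, ∫ x in Set.Iic (ξ i), Real.exp (-(1 / 2) * x ^ 2) := by
  have hm : MeasurableSet {v : Vec d | ∀ i, v i ≤ ξ i} := by
    rw [Set.ofPred_forall]
    exact MeasurableSet.iInter fun i => measurableSet_le (by fun_prop) measurable_const
  rw [← integral_indicator hm,
    ← (PiLp.volume_preserving_toLp (Fin d)).integral_comp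
      (MeasurableEquiv.toLp 2 (Fin d → ℝ)).measurableEmbedding]
  simp_rw [← integral_indicator measurableSet_Iic]
  rw [← integral_fintype_prod_volume_eq_prod]
  refine integral_congr_ae (Eventually.of_forall fun x => ?_)
  simp only [Set.indicator, Set.mem_ofPred_eq, Set.mem_Iic]
  rw [Finset.prod_ite_zero, EuclideanSpace.norm_sq_eq, Finset.mul_sum, Real.exp_sum]
  simp

theorem integral_univ_exp :
    ∫ v : Vec d, Real.exp (-(1 / 2) * ‖v‖ ^ 2)
      = ∏ _i : Fin d, ∫ x : ℝ, Real.exp (-(1 / 2) * x ^ 2) := by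
  rw [← (PiLp.volume_preserving_toLp (Fin d)).integral_comp
      (MeasurableEquiv.toLp 2 (Fin d → ℝ)).measurableEmbedding]
  rw [← integral_fintype_prod_volume_eq_prod]
  refine integral_congr_ae (Eventually.of_forall fun x => ?_)
  simp only
  rw [EuclideanSpace.norm_sq_eq, Finset.mul_sum, Real.exp_sum]
  simp

theorem gaussianReal_Iic_toReal (a : ℝ) :
    (gaussianReal 0 1 (Set.Iic a)).toReal
      = (∫ x in Set.Iic a, Real.exp (-(1 / 2) * x ^ 2))
        / ∫ x : ℝ, Real.exp (-(1 / 2) * x ^ 2) := by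
  have hpdf : ∀ x, gaussianPDFReal 0 1 x = (√(2 * Real.pi))⁻¹ * Real.exp (-(1 / 2) * x ^ 2) := by
    intro x
    rw [gaussianPDFReal]
    congr 2
    · simp
    · simp; ring
  have h1 := integral_gaussianPDFReal_eq_one 0 (v := 1) one_ne_zero
  rw [gaussianReal_apply_eq_integral _ one_ne_zero, ENNReal.toReal_ofReal
    (integral_nonneg fun x => gaussianPDFReal_nonneg _ _ _)]
  simp_rw [hpdf, integral_const_mul] at h1 ⊢
  rw [eq_div_iff]
  · linear_combination (∫ x in Set.Iic a, Real.exp (-(1 / 2) * x ^ 2)) * h1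
  · rintro h0
    rw [h0, mul_zero] at h1
    exact zero_ne_one h1

/-- Both integrals factor over coordinates and the normalizing constants cancel. This is the shape
of the posterior, a ratio of unnormalized integrals. -/
theorem stdNormalCdf_eq (ξ : Fin d → ℝ) :
    stdNormalCdf d ξ = (∫ v in {v : Vec d | ∀ i, v i ≤ ξ i}, Real.exp (-(1 / 2) * ‖v‖ ^ 2))
      / ∫ v : Vec d, Real.exp (-(1 / 2) * ‖v‖ ^ 2) := by
  rw [stdNormalCdf, ← Set.pi_univ_Iic, Measure.pi_pi, ENNReal.toReal_prod, integral_orthant_exp,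
    integral_univ_exp, ← Finset.prod_div_distrib]
  exact Finset.prod_congr rfl fun i _ => gaussianReal_Iic_toReal _

end Normal

/-! ### Standardization -/

section Standardize

variable {d : ℕ}

/-- Translation invariance and linear change of variables; for s = √n the Jacobian is of order
n^{-d/2}. -/
theorem integral_comp_standardize {L : Vec d →ₗ[ℝ] Vec d} (hL : LinearMap.det L ≠ 0) {s : ℝ}
    (hs : 0 < s) (v₀ : Vec d) (f : Vec d → ℝ) :
    ∫ v, f (s • L (v - v₀)) = |(LinearMap.det L)⁻¹| * (s ^ d)⁻¹ * ∫ v, f v := by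
  rw [integral_sub_right_eq_self (fun v => f (s • L v)) v₀]
  have hdet : LinearMap.det (s • L) = s ^ d * LinearMap.det L := by
    rw [LinearMap.det_smul]; simp
  have hne : LinearMap.det (s • L) ≠ 0 := by
    rw [hdet]; exact mul_ne_zero (by positivity) hL
  have hemb : MeasurableEmbedding (s • L : Vec d →ₗ[ℝ] Vec d) :=
    (LinearMap.equivOfDetNeZero (s • L) hne).toContinuousLinearEquiv.toHomeomorph.measurableEmbedding
  have h := hemb.integral_map (μ := volume) f
  rw [Measure.map_linearMap_addHaar_eq_smul_addHaar _ hne, integral_smul_measure,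
    ENNReal.toReal_ofReal (abs_nonneg _), hdet, mul_inv, abs_mul, abs_of_pos (a := (s ^ d)⁻¹)
    (by positivity)] at h
  rw [mul_comm |_|, ← smul_eq_mul (_ * _)]
  exact h.symm

theorem integrable_comp_standardize {L : Vec d →ₗ[ℝ] Vec d} (hL : LinearMap.det L ≠ 0) {s : ℝ}
    (hs : 0 < s) (v₀ : Vec d) {f : Vec d → ℝ} (hf : Integrable f) :
    Integrable (fun v => f (s • L (v - v₀))) := by
  have hne : LinearMap.det (s • L) ≠ 0 := by
    rw [LinearMap.det_smul]; exact mul_ne_zero (by positivity) hL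
  have hemb : MeasurableEmbedding (s • L : Vec d →ₗ[ℝ] Vec d) :=
    (LinearMap.equivOfDetNeZero (s • L) hne).toContinuousLinearEquiv.toHomeomorph.measurableEmbedding
  have h : Integrable f (Measure.map (s • L : Vec d →ₗ[ℝ] Vec d) volume) := by
    rw [Measure.map_linearMap_addHaar_eq_smul_addHaar _ hne]
    exact hf.smul_measure ENNReal.ofReal_ne_top
  exact (hemb.integrable_map_iff.1 h).comp_sub_right v₀

end Standardize


/-! ### Laplace approximation of the posterior profile distribution -/

section Pointwise

theorem abs_exp_sub_one_le (e : ℝ) : |Real.exp e - 1| ≤ |e| * Real.exp |e| := by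
  rcases le_total 0 e with h | h
  · rw [abs_of_nonneg h, abs_of_nonneg (by linarith [Real.add_one_le_exp e])]
    have h1 := Real.add_one_le_exp (-e)
    have h2 : Real.exp e * Real.exp (-e) = 1 := by rw [← Real.exp_add]; simp
    nlinarith [Real.exp_pos e]
  · rw [abs_of_nonpos h, abs_of_nonpos (by linarith [Real.exp_le_one_iff.2 h])]
    have h1 := Real.add_one_le_exp e
    have h2 : 1 ≤ Real.exp (-e) := Real.one_le_exp (by linarith)
    nlinarith

/-- The constant in the pointwise comparison with a Gaussian density near the truth. -/
noncomputable def nearConst (B L lam : ℝ) : ℝ :=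
  (L * (1 + B) + B * (4 + B)) * (1 + 2 * (8 / lam) ^ 2)

/-- Powers up to the third are dominated by 1 + y⁴, and y⁴ by the exponential through u²/2 ≤ e^u at
u = lam y²/8. -/
theorem near_polynomial_le {B L lam y : ℝ} (hB : 0 ≤ B) (hL : 0 ≤ L) (hlam : 0 < lam) :
    L * (y + B) + B * (1 + y + y ^ 2 + (y + B) * y ^ 2)
      ≤ nearConst B L lam * Real.exp (lam * y ^ 2 / 8) := by
  have h1 : y ≤ 1 + y ^ 4 := by nlinarith [sq_nonneg (y ^ 2 - 1), sq_nonneg (y - 1), sq_nonneg y]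
  have h2 : y ^ 2 ≤ 1 + y ^ 4 := by nlinarith [sq_nonneg (y ^ 2 - 1)]
  have h3 : y ^ 3 ≤ 1 + y ^ 4 := by
    nlinarith [sq_nonneg (y ^ 2 - y), sq_nonneg (y ^ 2 - 1), sq_nonneg y]
  have h0 : 0 ≤ y ^ 4 := by positivity
  have hp : L * (y + B) + B * (1 + y + y ^ 2 + (y + B) * y ^ 2)
      ≤ (L * (1 + B) + B * (4 + B)) * (1 + y ^ 4) := by
    have e1 := mul_le_mul_of_nonneg_left h1 hL
    have e2 : L * B ≤ L * B * (1 + y ^ 4) := le_mul_of_one_le_right (by positivity) (by linarith)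
    have e3 := mul_le_mul_of_nonneg_left h1 hB
    have e4 := mul_le_mul_of_nonneg_left h2 hB
    have e5 := mul_le_mul_of_nonneg_left h3 hB
    have e6 := mul_le_mul_of_nonneg_left h2 (mul_nonneg hB hB)
    have e7 : B ≤ B * (1 + y ^ 4) := le_mul_of_one_le_right hB (by linarith)
    nlinarith
  refine hp.trans ?_
  rw [nearConst, mul_assoc]
  refine mul_le_mul_of_nonneg_left ?_ (by positivity)
  have ht : 0 ≤ lam * y ^ 2 / 8 := by positivity
  have hq := Real.quadratic_le_exp_of_nonneg ht
  have h4 : y ^ 4 = (8 / lam) ^ 2 * (lam * y ^ 2 / 8) ^ 2 := by field_simp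
  have h5 : (lam * y ^ 2 / 8) ^ 2 ≤ 2 * Real.exp (lam * y ^ 2 / 8) := by linarith
  have h6 : 1 ≤ Real.exp (lam * y ^ 2 / 8) := Real.one_le_exp ht
  have h7 := mul_le_mul_of_nonneg_left h5 (sq_nonneg (8 / lam))
  rw [h4]
  linarith

/-- The log error e is bounded twice. Crudely, w ≤ δ gives |e| ≤ 1 + z/8, which tames exp|e|;
finely, w ≤ m(y + B) makes |e| at most m times a polynomial, itself dominated by exp(z/8). These
spend z/4 of the exponent z/2 and leave a Gaussian factor exp(−z/4). -/
theorem abs_near_sub_le {B L lam m y w z e ρr δ : ℝ} (hB : 0 ≤ B) (hL : 0 ≤ L) (hlam : 0 < lam)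
    (hm : 0 ≤ m) (hwδ : w ≤ δ) (hwm : w ≤ m * (y + B))
    (hm1 : 2 * B * m ≤ 1) (hm2 : 2 * B * m + B * δ ≤ lam / 8) (hz : lam * y ^ 2 ≤ z)
    (he : |e| ≤ B * (m * (1 + y + y ^ 2) + w * y ^ 2)) (hρ : |ρr - 1| ≤ L * w) :
    |ρr * Real.exp (-z / 2 + e) - Real.exp (-z / 2)|
      ≤ Real.exp 1 * nearConst B L lam * (m * Real.exp (-z / 4)) := by
  have hy2 : 0 ≤ y ^ 2 := sq_nonneg y
  have he1 : |e| ≤ 1 + z / 8 := by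
    have a1 : 1 + y + y ^ 2 ≤ 2 + 2 * y ^ 2 := by nlinarith [sq_nonneg (y - 1)]
    have a2 := mul_le_mul_of_nonneg_left a1 (mul_nonneg hB hm)
    have a3 := mul_le_mul_of_nonneg_left (mul_le_mul_of_nonneg_right hwδ hy2) hB
    have a4 := mul_le_mul_of_nonneg_right hm2 hy2
    linarith
  have he2 : |ρr - 1| + |e| ≤ m * (L * (y + B) + B * (1 + y + y ^ 2 + (y + B) * y ^ 2)) := by
    have a1 := mul_le_mul_of_nonneg_left hwm hL
    have a2 := mul_le_mul_of_nonneg_left (mul_le_mul_of_nonneg_right hwm hy2) hB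
    linarith
  have he3 : |ρr - 1| + |e| ≤ nearConst B L lam * (m * Real.exp (z / 8)) := by
    refine he2.trans ?_
    calc _ ≤ m * (nearConst B L lam * Real.exp (lam * y ^ 2 / 8)) :=
          mul_le_mul_of_nonneg_left (near_polynomial_le hB hL hlam) hm
      _ ≤ m * (nearConst B L lam * Real.exp (z / 8)) := by
          refine mul_le_mul_of_nonneg_left (mul_le_mul_of_nonneg_left ?_ ?_) hm
          · exact Real.exp_le_exp.2 (by linarith)
          · rw [nearConst]; positivity
      _ = _ := by ring
  have hfac : |ρr * Real.exp e - 1| ≤ Real.exp |e| * (|ρr - 1| + |e|) := by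
    have : ρr * Real.exp e - 1 = (ρr - 1) * Real.exp e + (Real.exp e - 1) := by ring
    rw [this]
    refine (abs_add_le _ _).trans ?_
    rw [abs_mul, abs_of_pos (Real.exp_pos e)]
    have a1 : Real.exp e ≤ Real.exp |e| := Real.exp_le_exp.2 (le_abs_self e)
    have a2 := mul_le_mul_of_nonneg_left a1 (abs_nonneg (ρr - 1))
    linarith [abs_exp_sub_one_le e]
  have hsplit : ρr * Real.exp (-z / 2 + e) - Real.exp (-z / 2)
      = Real.exp (-z / 2) * (ρr * Real.exp e - 1) := by
    rw [Real.exp_add]; ring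
  rw [hsplit, abs_mul, abs_of_pos (Real.exp_pos _)]
  have hexp : Real.exp (-z / 2) * (Real.exp (1 + z / 8) * Real.exp (z / 8))
      = Real.exp 1 * Real.exp (-z / 4) := by
    rw [← Real.exp_add, ← Real.exp_add, ← Real.exp_add]; ring_nf
  calc Real.exp (-z / 2) * |ρr * Real.exp e - 1|
      ≤ Real.exp (-z / 2) * (Real.exp (1 + z / 8) * (nearConst B L lam * (m * Real.exp (z / 8)))) := by
        refine mul_le_mul_of_nonneg_left (hfac.trans ?_) (Real.exp_pos _).le
        exact mul_le_mul (Real.exp_le_exp.2 he1) he3 (by positivity) (Real.exp_pos _).le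
    _ = nearConst B L lam * m
          * (Real.exp (-z / 2) * (Real.exp (1 + z / 8) * Real.exp (z / 8))) := by ring
    _ = _ := by rw [hexp]; ring

/-- Of the two factors exp(−z/4) one is at most a constant over s, since z grows at least linearly
in s at this distance; the other is kept for integrability. -/
theorem exp_far_le {lam s m δ y z : ℝ} (hlam : 0 < lam) (hδ : 0 < δ) (hs : 0 < s)
    (hsm : s⁻¹ ≤ m) (hy : s * δ / 2 ≤ y) (hy1 : 1 ≤ y) (hz : lam * y ^ 2 ≤ z) :
    Real.exp (-z / 2) ≤ 8 / (lam * δ) * (m * Real.exp (-z / 4)) := by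
  have h1 : Real.exp (-z / 2) = Real.exp (-z / 4) * Real.exp (-z / 4) := by
    rw [← Real.exp_add]; ring_nf
  have h2 : lam * s * δ / 8 ≤ Real.exp (z / 4) := by
    have a1 := Real.add_one_le_exp (z / 4)
    have a2 : lam * y ≤ lam * y ^ 2 := mul_le_mul_of_nonneg_left (by nlinarith) hlam.le
    have a3 := mul_le_mul_of_nonneg_left hy hlam.le
    linarith
  have h3 : Real.exp (-z / 4) ≤ 8 / (lam * δ) * m := by
    have a0 : 0 < lam * s * δ / 8 := by positivity
    have a1 : Real.exp (-z / 4) = (Real.exp (z / 4))⁻¹ := by rw [← Real.exp_neg]; ring_nf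
    rw [a1]
    calc (Real.exp (z / 4))⁻¹ ≤ (lam * s * δ / 8)⁻¹ := inv_anti₀ a0 h2
      _ = 8 / (lam * δ) * s⁻¹ := by field_simp
      _ ≤ _ := mul_le_mul_of_nonneg_left hsm (by positivity)
  rw [h1]
  calc _ ≤ 8 / (lam * δ) * m * Real.exp (-z / 4) :=
        mul_le_mul_of_nonneg_right h3 (Real.exp_pos _).le
    _ = _ := by ring

/-- Because a / A ≤ 1, only the denominator B has to be bounded below; A may even vanish, the
quotient then being 0. -/
theorem abs_ratio_sub_ratio_le {a b A B D : ℝ} (ha : 0 ≤ a) (haA : a ≤ A)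
    (hB : 0 < B) (h1 : |a - b| ≤ D) (h2 : |A - B| ≤ D) :
    |a / A - b / B| ≤ 2 * D / B := by
  have hD : 0 ≤ D := (abs_nonneg _).trans h1
  have hq : 0 ≤ a / A ∧ a / A ≤ 1 := by
    have hA : 0 ≤ A := ha.trans haA
    exact ⟨div_nonneg ha hA, div_le_one_of_le₀ haA hA⟩
  have heq : a / A - b / B = (a - b) / B + (a / A) * ((B - A) / B) := by
    rcases eq_or_ne A 0 with h0 | h0
    · have : a = 0 := le_antisymm (h0 ▸ haA) ha
      subst this; simp; ring
    · field_simp; ring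
  rw [heq]
  refine (abs_add_le _ _).trans ?_
  rw [abs_mul, abs_of_nonneg hq.1, abs_div, abs_div, abs_of_pos hB, abs_sub_comm B A]
  have a1 : |a - b| / B ≤ D / B := div_le_div_of_nonneg_right h1 hB.le
  have a2 : |A - B| / B ≤ D / B := div_le_div_of_nonneg_right h2 hB.le
  have a3 : a / A * (|A - B| / B) ≤ |A - B| / B :=
    mul_le_of_le_one_left (by positivity) hq.2
  have a4 : 2 * D / B = D / B + D / B := by ring
  linarith

/-- One L₁ bound controls the errors of numerator and denominator for every set A, which is the
source of uniformity in ξ. -/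
theorem abs_ratio_integral_sub_le {V : Type*} [MeasurableSpace V] {ν : Measure V} {q φ : V → ℝ}
    (hq : Integrable q ν) (hφ : Integrable φ ν) (hq0 : ∀ v, 0 ≤ q v)
    (hpos : 0 < ∫ v, φ v ∂ν) {A : Set V} {D : ℝ} (hD : ∫ v, |q v - φ v| ∂ν ≤ D) :
    |(∫ v in A, q v ∂ν) / (∫ v, q v ∂ν) - (∫ v in A, φ v ∂ν) / ∫ v, φ v ∂ν|
      ≤ 2 * D / ∫ v, φ v ∂ν := by
  refine abs_ratio_sub_ratio_le (integral_nonneg hq0)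
    (setIntegral_le_integral hq (Eventually.of_forall hq0)) hpos ?_ ?_
  · rw [← integral_sub hq.integrableOn hφ.integrableOn]
    refine (abs_integral_le_integral_abs).trans (le_trans ?_ hD)
    exact setIntegral_le_integral (hq.sub hφ).abs (Eventually.of_forall fun v => abs_nonneg _)
  · rw [← integral_sub hq hφ]
    exact (abs_integral_le_integral_abs).trans hD

end Pointwise

/-! ### Exponential decay against powers of n -/

section Rates

/-- The target is n^{-1/2} times the Jacobian order n^{-d/2}, because the tail mass has to be small
relative to the total Gaussian mass. -/
theorem eventually_exp_le (d : ℕ) {c κ : ℝ} (hc : 0 < c) (hκ : 0 < κ) :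
    ∀ᶠ n : ℕ in atTop, Real.exp (-(n * c)) ≤ κ * (√(n : ℝ))⁻¹ * ((√(n : ℝ)) ^ d)⁻¹ := by
  have h := tendsto_rpow_mul_exp_neg_mul_atTop_nhds_zero (d + 1 : ℕ) c hc
  have h2 := h.comp (tendsto_natCast_atTop_atTop (R := ℝ))
  filter_upwards [h2.eventually (gt_mem_nhds hκ), eventually_ge_atTop 1] with n hn hn1
  simp only [Function.comp] at hn
  have hn' : (1 : ℝ) ≤ n := by exact_mod_cast hn1
  have hs : 0 < √(n : ℝ) := Real.sqrt_pos.2 (by linarith)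
  have hsn : √(n : ℝ) ≤ n := by
    rw [Real.sqrt_le_left (by linarith)]; nlinarith
  rw [mul_assoc, ← mul_inv, ← pow_succ', ← div_eq_mul_inv, le_div_iff₀ (by positivity)]
  have h3 : (√(n : ℝ)) ^ (d + 1) ≤ (n : ℝ) ^ ((d + 1 : ℕ) : ℝ) := by
    rw [Real.rpow_natCast]
    exact pow_le_pow_left₀ hs.le hsn _
  have h4 := mul_le_mul_of_nonneg_left h3 (Real.exp_pos (-(n * c))).le
  have h5 : Real.exp (-c * n) = Real.exp (-(n * c)) := by ring_nf
  rw [h5] at hn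
  linarith

end Rates


/-! ### Comparison of the posterior with a Gaussian kernel -/

section Laplace

variable {d : ℕ} {𝒳 E : Type*} [MeasurableSpace 𝒳]
  {M : Model d 𝒳 E} {θ₀ : Vec d} {I : Matrix (Fin d) (Fin d) ℝ} {r B δ : ℝ}

theorem RecentredExpansion.mono {n : ℕ} {x : ℕ → 𝒳} {θh : Vec d} {δ' : ℝ}
    (h : RecentredExpansion M θ₀ I r B δ n x θh) (hδ : δ' ≤ δ) :
    RecentredExpansion M θ₀ I r B δ' n x θh :=
  ⟨h.close, h.pos_hat, fun θ hθ => h.pos θ (hθ.trans_le hδ),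
    fun θ hθ => h.expansion θ (hθ.trans_le hδ)⟩

/-- The prior times the profile likelihood on `Θ`, normalized by its size at `(θ₀, θh)`. -/
noncomputable def normalizedPosterior (M : Model d 𝒳 E) (ρ : Vec d → ℝ) (θ₀ : Vec d) (n : ℕ)
    (x : ℕ → 𝒳) (θh : Vec d) : Vec d → ℝ :=
  M.Θ.indicator fun θ => ρ θ * M.profLik n x θ / (ρ θ₀ * M.profLik n x θh)

theorem normalizedPosterior_nonneg {ρ : Vec d → ℝ} (hρ : ∀ θ ∈ M.Θ, 0 ≤ ρ θ) (hρ₀ : 0 < ρ θ₀)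
    {n : ℕ} {x : ℕ → 𝒳} {θh : Vec d} (hpos : 0 < M.profLik n x θh) (θ : Vec d) :
    0 ≤ normalizedPosterior M ρ θ₀ n x θh θ := by
  refine Set.indicator_nonneg (fun θ hθ => ?_) θ
  have := hρ θ hθ
  have := Model.profLik_nonneg (n := n) (x := x) hθ
  positivity

theorem posteriorProfile_eq {ρ : Vec d → ℝ} (hρ : ∀ θ ∈ M.Θ, 0 ≤ ρ θ) (hρ₀ : 0 < ρ θ₀)
    (hΘ : MeasurableSet M.Θ) {n : ℕ} {x : ℕ → 𝒳} {θh : Vec d} (hpos : 0 < M.profLik n x θh)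
    (hint : Integrable (normalizedPosterior M ρ θ₀ n x θh)) (A : Set (Vec d)) :
    M.posteriorProfile ρ n x A = (∫ θ in A, normalizedPosterior M ρ θ₀ n x θh θ)
      / ∫ θ, normalizedPosterior M ρ θ₀ n x θh θ := by
  set c := ρ θ₀ * M.profLik n x θh with hc
  have hc0 : 0 < c := mul_pos hρ₀ hpos
  have key : ∀ A : Set (Vec d), (∫⁻ θ in M.Θ ∩ A, ENNReal.ofReal (ρ θ * M.profLik n x θ)).toReal
      = c * ∫ θ in A, normalizedPosterior M ρ θ₀ n x θh θ := by
    intro A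
    have hq0 : ∀ θ, 0 ≤ normalizedPosterior M ρ θ₀ n x θh θ :=
      normalizedPosterior_nonneg hρ hρ₀ hpos
    rw [← setLIntegral_indicator hΘ]
    have : ∀ θ, M.Θ.indicator (fun θ => ENNReal.ofReal (ρ θ * M.profLik n x θ)) θ
        = ENNReal.ofReal c * ENNReal.ofReal (normalizedPosterior M ρ θ₀ n x θh θ) := by
      intro θ
      by_cases hθ : θ ∈ M.Θ
      · rw [normalizedPosterior, Set.indicator_of_mem hθ, Set.indicator_of_mem hθ,
          ← ENNReal.ofReal_mul hc0.le, ← hc, mul_div_cancel₀ _ hc0.ne']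
      · simp [normalizedPosterior, Set.indicator_of_notMem hθ]
    simp_rw [this]
    rw [lintegral_const_mul' _ _ ENNReal.ofReal_ne_top,
      ← ofReal_integral_eq_lintegral_ofReal hint.integrableOn (Eventually.of_forall hq0),
      ENNReal.toReal_mul, ENNReal.toReal_ofReal hc0.le,
      ENNReal.toReal_ofReal (integral_nonneg hq0)]
  have h2 := key Set.univ
  rw [Set.inter_univ, setIntegral_univ] at h2
  rw [Model.posteriorProfile, ENNReal.toReal_div, Set.inter_comm, key A, h2,
    mul_div_mul_left _ _ hc0.ne']

/-- Since θh maximizes pl_n, the function is dominated by ρ / ρ(θ₀). -/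
theorem integrable_normalizedPosterior {ρ : Vec d → ℝ} (hρ : ∀ θ ∈ M.Θ, 0 ≤ ρ θ) (hρ₀ : 0 < ρ θ₀)
    (hΘ : MeasurableSet M.Θ) (hρi : Integrable (M.Θ.indicator ρ))
    {n : ℕ} {x : ℕ → 𝒳} {θh : Vec d} (hpos : 0 < M.profLik n x θh)
    (hmax : IsMaxOn (fun θ => M.profLik n x θ) M.Θ θh)
    (hm : AEMeasurable (fun θ => M.profLik n x θ) (volume.restrict M.Θ)) :
    Integrable (normalizedPosterior M ρ θ₀ n x θh) := by
  have hρm : AEMeasurable ρ (volume.restrict M.Θ) :=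
    (aemeasurable_indicator_iff hΘ).1 hρi.aemeasurable
  refine Integrable.mono' (hρi.const_mul (ρ θ₀)⁻¹) ?_ (Eventually.of_forall fun θ => ?_)
  · exact ((aemeasurable_indicator_iff hΘ).2 ((hρm.mul hm).div_const _)).aestronglyMeasurable
  · rw [Real.norm_of_nonneg (normalizedPosterior_nonneg hρ hρ₀ hpos θ)]
    by_cases hθ : θ ∈ M.Θ
    · rw [normalizedPosterior, Set.indicator_of_mem hθ, Set.indicator_of_mem hθ,
        mul_div_mul_comm, inv_mul_eq_div]
      exact mul_le_of_le_one_right (div_nonneg (hρ θ hθ) hρ₀.le) (div_le_one_of_le₀ (hmax hθ) hpos.le)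
    · simp [normalizedPosterior, Set.indicator_of_notMem hθ]

/-- Within δ of θ₀ the quadratic expansion applies. Beyond δ both functions are small separately:
the posterior by the likelihood gap, the Gaussian because √n‖θ − θh‖ is at least √n δ/2. The bound
is the sum of both cases and is integrable over the whole space. -/
theorem abs_normalizedPosterior_sub_le {ρ : Vec d → ℝ} {Lρ lam c δ : ℝ} {n : ℕ} {x : ℕ → 𝒳}
    {θh : Vec d} (hρ : ∀ θ ∈ M.Θ, 0 ≤ ρ θ) (hρ₀ : 0 < ρ θ₀) (hB : 0 < B) (hLρ : 0 ≤ Lρ)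
    (hlam : 0 < lam) (hpd : ∀ v, lam * ‖v‖ ^ 2 ≤ quadForm I v) (hδ : 0 < δ)
    (hball : Metric.ball θ₀ δ ⊆ M.Θ)
    (hlip : ∀ θ, ‖θ - θ₀‖ < δ → |ρ θ / ρ θ₀ - 1| ≤ Lρ * ‖θ - θ₀‖) (hn : 0 < n)
    (hm1 : 2 * B * rateM r n ≤ 1) (hm2 : 2 * B * rateM r n + B * δ ≤ lam / 8)
    (hn1 : 2 * B ≤ √(n : ℝ) * δ) (hn2 : 2 ≤ √(n : ℝ) * δ)
    (h : RecentredExpansion M θ₀ I r B δ n x θh)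
    (hfar : ∀ θ ∈ M.Θ, δ ≤ ‖θ - θ₀‖ →
      M.profLik n x θ ≤ Real.exp (-(n * c)) * M.profLik n x θh) (θ : Vec d) :
    |normalizedPosterior M ρ θ₀ n x θh θ - Real.exp (-(n * quadForm I (θ - θh)) / 2)|
      ≤ (Real.exp 1 * nearConst B Lρ lam + 8 / (lam * δ))
          * (rateM r n * Real.exp (-(n * quadForm I (θ - θh)) / 4))
        + Real.exp (-(n * c)) / ρ θ₀ * M.Θ.indicator ρ θ := by
  have hn' : (0 : ℝ) < n := by exact_mod_cast hn
  set s := √(n : ℝ) with hs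
  have hs0 : 0 < s := Real.sqrt_pos.2 hn'
  have hss : s ^ 2 = n := Real.sq_sqrt hn'.le
  have hm0 := rateM_nonneg r n
  have hsm : s⁻¹ ≤ rateM r n := inv_sqrt_le_rateM r n
  set y := s * ‖θ - θh‖ with hy
  have hy0 : 0 ≤ y := by positivity
  set z := (n : ℝ) * quadForm I (θ - θh) with hz
  have hyz : lam * y ^ 2 ≤ z := by
    rw [hy, mul_pow, hss, hz]
    have := mul_le_mul_of_nonneg_left (hpd (θ - θh)) hn'.le
    linarith
  have hind : 0 ≤ M.Θ.indicator ρ θ := Set.indicator_nonneg hρ θ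
  have hnear0 : 0 ≤ nearConst B Lρ lam := by rw [nearConst]; positivity
  have hmexp : 0 ≤ rateM r n * Real.exp (-z / 4) := by positivity
  have hE : 0 ≤ Real.exp (-(n * c)) / ρ θ₀ * M.Θ.indicator ρ θ := by positivity
  rw [add_mul]
  rcases lt_or_ge ‖θ - θ₀‖ δ with hθ | hθ
  · have hθΘ : θ ∈ M.Θ := hball (by rwa [mem_ball_iff_norm])
    have hw : s * ‖θ - θ₀‖ ≤ y + B := by
      have h1 : ‖θ - θ₀‖ ≤ ‖θ - θh‖ + ‖θh - θ₀‖ := by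
        simpa using norm_add_le (θ - θh) (θh - θ₀)
      have h2 := mul_le_mul_of_nonneg_left h1 hs0.le
      have h3 := h.close
      rw [mul_add] at h2
      linarith
    have hwm : ‖θ - θ₀‖ ≤ rateM r n * (y + B) := by
      calc ‖θ - θ₀‖ = s⁻¹ * (s * ‖θ - θ₀‖) := by field_simp
        _ ≤ s⁻¹ * (y + B) := mul_le_mul_of_nonneg_left hw (by positivity)
        _ ≤ _ := mul_le_mul_of_nonneg_right hsm (by positivity)
    set e := Real.log (M.profLik n x θ) - Real.log (M.profLik n x θh)
      + n / 2 * quadForm I (θ - θh) with he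
    have hq : normalizedPosterior M ρ θ₀ n x θh θ = ρ θ / ρ θ₀ * Real.exp (-z / 2 + e) := by
      have : -z / 2 + e = Real.log (M.profLik n x θ) - Real.log (M.profLik n x θh) := by
        rw [he, hz]; ring
      rw [this, Real.exp_sub, Real.exp_log (h.pos θ hθ), Real.exp_log h.pos_hat,
        normalizedPosterior, Set.indicator_of_mem hθΘ, mul_div_mul_comm]
    rw [hq]
    have hmain := abs_near_sub_le (ρr := ρ θ / ρ θ₀) hB.le hLρ hlam hm0 hθ.le hwm hm1 hm2 hyz
      (h.expansion θ hθ) (hlip θ hθ)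
    have : 0 ≤ 8 / (lam * δ) * (rateM r n * Real.exp (-z / 4)) := by positivity
    linarith
  · have hyδ : s * δ / 2 ≤ y := by
      have h1 : ‖θ - θ₀‖ ≤ ‖θ - θh‖ + ‖θh - θ₀‖ := by
        simpa using norm_add_le (θ - θh) (θh - θ₀)
      have h2 := mul_le_mul_of_nonneg_left (hθ.trans h1) hs0.le
      have h3 := h.close
      rw [mul_add] at h2
      linarith
    have hg := exp_far_le hlam hδ hs0 hsm hyδ (by linarith) hyz
    have hq : normalizedPosterior M ρ θ₀ n x θh θ
        ≤ Real.exp (-(n * c)) / ρ θ₀ * M.Θ.indicator ρ θ := by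
      by_cases hθΘ : θ ∈ M.Θ
      · rw [normalizedPosterior, Set.indicator_of_mem hθΘ, Set.indicator_of_mem hθΘ,
          div_mul_eq_mul_div, div_le_div_iff₀ (mul_pos hρ₀ h.pos_hat) hρ₀]
        have := mul_le_mul_of_nonneg_left (hfar θ hθΘ hθ) (mul_nonneg (hρ θ hθΘ) hρ₀.le)
        linarith
      · simp [normalizedPosterior, Set.indicator_of_notMem hθΘ]
    have hq0 := normalizedPosterior_nonneg (n := n) (x := x) hρ hρ₀ h.pos_hat θ
    have hnear : 0 ≤ Real.exp 1 * nearConst B Lρ lam * (rateM r n * Real.exp (-z / 4)) := by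
      positivity
    rw [abs_le]
    constructor <;> linarith [Real.exp_pos (-z / 2)]

/-- Integrating the pointwise bound gives an L₁ distance of order κ M_n(r), with κ the Jacobian of
the standardization; the Gaussian mass carries the same κ, which cancels in the ratio. -/
theorem abs_posteriorProfile_sub_le {ρ : Vec d → ℝ} {Lρ lam c δ : ℝ} {n : ℕ} {x : ℕ → 𝒳}
    {θh : Vec d} (hI : I.PosDef) (hΘ : MeasurableSet M.Θ) (hρ : ∀ θ ∈ M.Θ, 0 ≤ ρ θ)
    (hρ₀ : 0 < ρ θ₀) (hρi : Integrable (M.Θ.indicator ρ)) (hρ1 : ∫ θ, M.Θ.indicator ρ θ = 1)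
    (hB : 0 < B) (hLρ : 0 ≤ Lρ)
    (hlam : 0 < lam) (hpd : ∀ v, lam * ‖v‖ ^ 2 ≤ quadForm I v) (hδ : 0 < δ)
    (hball : Metric.ball θ₀ δ ⊆ M.Θ)
    (hlip : ∀ θ, ‖θ - θ₀‖ < δ → |ρ θ / ρ θ₀ - 1| ≤ Lρ * ‖θ - θ₀‖) (hn : 0 < n)
    (hm1 : 2 * B * rateM r n ≤ 1) (hm2 : 2 * B * rateM r n + B * δ ≤ lam / 8)
    (hn1 : 2 * B ≤ √(n : ℝ) * δ) (hn2 : 2 ≤ √(n : ℝ) * δ)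
    (hexp : Real.exp (-(n * c))
      ≤ ρ θ₀ * |(LinearMap.det (sqrtMap I))⁻¹| * (√(n : ℝ))⁻¹ * (√(n : ℝ) ^ d)⁻¹)
    (h : RecentredExpansion M θ₀ I r B δ n x θh)
    (hmax : IsMaxOn (fun θ => M.profLik n x θ) M.Θ θh)
    (hm : AEMeasurable (fun θ => M.profLik n x θ) (volume.restrict M.Θ))
    (hfar : ∀ θ ∈ M.Θ, δ ≤ ‖θ - θ₀‖ →
      M.profLik n x θ ≤ Real.exp (-(n * c)) * M.profLik n x θh) (ξ : Fin d → ℝ) :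
    |M.posteriorProfile ρ n x
        {θ | ∀ i, √(n : ℝ) * (Matrix.mulVec (matSqrt I) ⇑(θ - θh)) i ≤ ξ i} - stdNormalCdf d ξ|
      ≤ 2 * ((Real.exp 1 * nearConst B Lρ lam + 8 / (lam * δ))
          * (∫ v : Vec d, Real.exp (-(1 / 4) * ‖v‖ ^ 2)) + 1)
          / (∫ v : Vec d, Real.exp (-(1 / 2) * ‖v‖ ^ 2)) * rateM r n := by
  have hn' : (0 : ℝ) < n := by exact_mod_cast hn
  set s := √(n : ℝ) with hs
  have hs0 : 0 < s := Real.sqrt_pos.2 hn'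
  have hss : s ^ 2 = n := Real.sq_sqrt hn'.le
  have hm0 := rateM_nonneg r n
  have hsm : s⁻¹ ≤ rateM r n := inv_sqrt_le_rateM r n
  set L := sqrtMap I with hL
  have hdet : LinearMap.det L ≠ 0 := det_sqrtMap_ne_zero hI
  set κ := |(LinearMap.det L)⁻¹| * (s ^ d)⁻¹ with hκ
  have hκ0 : 0 < κ := by
    have : 0 < |(LinearMap.det L)⁻¹| := abs_pos.2 (inv_ne_zero hdet)
    positivity
  have hz : ∀ θ, ‖s • L (θ - θh)‖ ^ 2 = n * quadForm I (θ - θh) := by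
    intro θ
    rw [norm_smul, mul_pow, norm_sqrtMap_sq hI, Real.norm_of_nonneg hs0.le, hss]
  set C := Real.exp 1 * nearConst B Lρ lam + 8 / (lam * δ) with hC
  set q := normalizedPosterior M ρ θ₀ n x θh with hq
  set φ : Vec d → ℝ := fun θ => Real.exp (-(1 / 2) * ‖s • L (θ - θh)‖ ^ 2) with hφ
  set ψ : Vec d → ℝ := fun θ => Real.exp (-(1 / 4) * ‖s • L (θ - θh)‖ ^ 2) with hψ
  have hqi : Integrable q := integrable_normalizedPosterior hρ hρ₀ hΘ hρi h.pos_hat hmax hm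
  have hφi : Integrable φ := integrable_comp_standardize hdet hs0 θh
    (integrable_exp_neg_mul_sq_norm (by norm_num : (0 : ℝ) < 1 / 2))
  have hψi : Integrable ψ := integrable_comp_standardize hdet hs0 θh
    (integrable_exp_neg_mul_sq_norm (by norm_num : (0 : ℝ) < 1 / 4))
  have hφv : ∫ θ, φ θ = κ * ∫ v : Vec d, Real.exp (-(1 / 2) * ‖v‖ ^ 2) :=
    integral_comp_standardize hdet hs0 θh fun v => Real.exp (-(1 / 2) * ‖v‖ ^ 2)
  have hψv : ∫ θ, ψ θ = κ * ∫ v : Vec d, Real.exp (-(1 / 4) * ‖v‖ ^ 2) :=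
    integral_comp_standardize hdet hs0 θh fun v => Real.exp (-(1 / 4) * ‖v‖ ^ 2)
  have hJ2 : 0 < ∫ v : Vec d, Real.exp (-(1 / 2) * ‖v‖ ^ 2) :=
    integral_exp_neg_mul_sq_norm_pos (by norm_num)
  set J2 := ∫ v : Vec d, Real.exp (-(1 / 2) * ‖v‖ ^ 2) with hJ2'
  set J4 := ∫ v : Vec d, Real.exp (-(1 / 4) * ‖v‖ ^ 2) with hJ4'
  have hpt : ∀ θ, |q θ - φ θ|
      ≤ C * rateM r n * ψ θ + Real.exp (-(n * c)) / ρ θ₀ * M.Θ.indicator ρ θ := by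
    intro θ
    have h1 := abs_normalizedPosterior_sub_le hρ hρ₀ hB hLρ hlam hpd hδ hball hlip hn hm1 hm2 hn1
      hn2 h hfar θ
    have e1 : φ θ = Real.exp (-(n * quadForm I (θ - θh)) / 2) := by
      simp only [hφ, hz]; ring_nf
    have e2 : ψ θ = Real.exp (-(n * quadForm I (θ - θh)) / 4) := by
      simp only [hψ, hz]; ring_nf
    rw [e1, e2, mul_assoc]
    exact h1
  have hD : ∫ θ, |q θ - φ θ| ≤ κ * rateM r n * (C * J4 + 1) := by
    calc ∫ θ, |q θ - φ θ|
        ≤ ∫ θ, (C * rateM r n * ψ θ + Real.exp (-(n * c)) / ρ θ₀ * M.Θ.indicator ρ θ) :=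
          integral_mono (hqi.sub hφi).abs
            ((hψi.const_mul _).add (hρi.const_mul _)) hpt
      _ = C * rateM r n * (κ * J4) + Real.exp (-(n * c)) / ρ θ₀ := by
          rw [integral_add (hψi.const_mul _) (hρi.const_mul _), integral_const_mul,
            integral_const_mul, hψv, hρ1, mul_one]
      _ ≤ C * rateM r n * (κ * J4) + κ * rateM r n := by
          refine add_le_add le_rfl ?_
          rw [div_le_iff₀ hρ₀]
          calc _ ≤ _ := hexp
            _ = κ * s⁻¹ * ρ θ₀ := by rw [hκ]; ring
            _ ≤ _ := by gcongr
      _ = _ := by ring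
  have hA : {θ : Vec d | ∀ i, s * (Matrix.mulVec (matSqrt I) ⇑(θ - θh)) i ≤ ξ i}
      = (fun θ => s • L (θ - θh)) ⁻¹' {v : Vec d | ∀ i, v i ≤ ξ i} := rfl
  set A := {θ : Vec d | ∀ i, s * (Matrix.mulVec (matSqrt I) ⇑(θ - θh)) i ≤ ξ i} with hA'
  have hTm : MeasurableSet {v : Vec d | ∀ i, v i ≤ ξ i} := by
    rw [Set.ofPred_forall]
    exact MeasurableSet.iInter fun i => measurableSet_le (by fun_prop) measurable_const
  have hAm : MeasurableSet A := by
    rw [hA]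
    have hc : Continuous fun θ : Vec d => s • L (θ - θh) :=
      (L.continuous_of_finiteDimensional.comp (continuous_id.sub continuous_const)).const_smul s
    exact hc.measurable hTm
  have hcdf : stdNormalCdf d ξ = (∫ θ in A, φ θ) / ∫ θ, φ θ := by
    have h1 : ∫ θ in A, φ θ
        = κ * ∫ v in {v : Vec d | ∀ i, v i ≤ ξ i}, Real.exp (-(1 / 2) * ‖v‖ ^ 2) := by
      rw [← integral_indicator hAm, ← integral_indicator hTm, hκ,
        ← integral_comp_standardize hdet hs0 θh]
      rfl
    rw [h1, hφv, mul_div_mul_left _ _ hκ0.ne', stdNormalCdf_eq]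
  rw [posteriorProfile_eq hρ hρ₀ hΘ h.pos_hat hqi, hcdf]
  refine (abs_ratio_integral_sub_le hqi hφi (normalizedPosterior_nonneg hρ hρ₀ h.pos_hat)
    (by rw [hφv]; positivity) hD).trans (le_of_eq ?_)
  rw [hφv]
  field_simp

/-- The posterior profile distribution is uniformly close to the normal distribution for every
sample with a quadratic expansion of the log profile likelihood and an exponential decay away from
the truth. -/
theorem exists_posteriorProfile_bound {ρ : Vec d → ℝ} (hr : 1 / 4 < r) (hI : I.PosDef)
    (hΘ : MeasurableSet M.Θ) (hθ₀ : θ₀ ∈ interior M.Θ) (hρm : AEMeasurable ρ (volume.restrict M.Θ))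
    (hρ : ∀ θ ∈ M.Θ, 0 ≤ ρ θ) (hρ₀ : 0 < ρ θ₀)
    (hρ1 : ∫⁻ θ in M.Θ, ENNReal.ofReal (ρ θ) = 1)
    (hρs : ∃ ε > 0, ContDiffOn ℝ 1 ρ (Metric.ball θ₀ ε)) (hB : 0 < B) {δ₁ : ℝ} (hδ₁ : 0 < δ₁) :
    ∃ δ > 0, δ ≤ δ₁ ∧ ∃ C, ∀ c > 0, ∀ᶠ n : ℕ in atTop, ∀ (x : ℕ → 𝒳) (θh : Vec d),
      RecentredExpansion M θ₀ I r B δ n x θh →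
      IsMaxOn (fun θ => M.profLik n x θ) M.Θ θh →
      AEMeasurable (fun θ => M.profLik n x θ) (volume.restrict M.Θ) →
      (∀ θ ∈ M.Θ, δ ≤ ‖θ - θ₀‖ →
        M.profLik n x θ ≤ Real.exp (-(n * c)) * M.profLik n x θh) →
      ∀ ξ : Fin d → ℝ, |M.posteriorProfile ρ n x
          {θ | ∀ i, √(n : ℝ) * (Matrix.mulVec (matSqrt I) ⇑(θ - θh)) i ≤ ξ i}
        - stdNormalCdf d ξ| ≤ C * rateM r n := by
  obtain ⟨lam, hlam, hpd⟩ := exists_le_quadForm hI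
  have hρpos : 0 ≤ᵐ[volume.restrict M.Θ] ρ := (ae_restrict_iff' hΘ).2 (Eventually.of_forall hρ)
  have hρon : IntegrableOn ρ M.Θ := by
    refine (lintegral_ofReal_ne_top_iff_integrable hρm.aestronglyMeasurable hρpos).1 ?_
    rw [hρ1]; exact ENNReal.one_ne_top
  have hρi : Integrable (M.Θ.indicator ρ) := (integrable_indicator_iff hΘ).2 hρon
  have hρ1' : ∫ θ, M.Θ.indicator ρ θ = 1 := by
    rw [integral_indicator hΘ, integral_eq_lintegral_of_nonneg_ae hρpos hρm.aestronglyMeasurable,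
      hρ1, ENNReal.toReal_one]
  obtain ⟨ε, hε, hsm⟩ := hρs
  obtain ⟨K, t, ht, hlip⟩ := (hsm.contDiffAt (Metric.ball_mem_nhds θ₀ hε)).exists_lipschitzOnWith
  obtain ⟨δa, hδa, hta⟩ := Metric.mem_nhds_iff.1 ht
  obtain ⟨δb, hδb, hb⟩ := Metric.mem_nhds_iff.1 (mem_interior_iff_mem_nhds.1 hθ₀)
  -- The bound lam/(16B) spends half of the allowance lam/8 for the log error; the other half goes
  -- to 2 B M_n(r), which tends to zero.
  set δ := min (min δ₁ (lam / (16 * B))) (min δa δb) with hδ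
  have hδ0 : 0 < δ := by positivity
  have hδle1 : δ ≤ δ₁ := (min_le_left _ _).trans (min_le_left _ _)
  have hδle2 : δ ≤ lam / (16 * B) := (min_le_left _ _).trans (min_le_right _ _)
  have hδlea : δ ≤ δa := (min_le_right _ _).trans (min_le_left _ _)
  have hδleb : δ ≤ δb := (min_le_right _ _).trans (min_le_right _ _)
  have hBδ : B * δ ≤ lam / 16 := by
    calc B * δ ≤ B * (lam / (16 * B)) := mul_le_mul_of_nonneg_left hδle2 hB.le
      _ = lam / 16 := by field_simp
  have hlip' : ∀ θ, ‖θ - θ₀‖ < δ → |ρ θ / ρ θ₀ - 1| ≤ K / ρ θ₀ * ‖θ - θ₀‖ := by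
    intro θ hθ
    have h1 := hlip.dist_le_mul θ (hta (by rw [mem_ball_iff_norm]; linarith)) θ₀
      (hta (Metric.mem_ball_self hδa))
    rw [Real.dist_eq, dist_eq_norm] at h1
    have : ρ θ / ρ θ₀ - 1 = (ρ θ - ρ θ₀) / ρ θ₀ := by field_simp
    rw [this, abs_div, abs_of_pos hρ₀, div_mul_eq_mul_div]
    exact div_le_div_of_nonneg_right h1 hρ₀.le
  -- The constant must not involve c, because the gap c is only found after δ; c affects merely how
  -- large n has to be.
  refine ⟨δ, hδ0, hδle1, 2 * ((Real.exp 1 * nearConst B (K / ρ θ₀) lam + 8 / (lam * δ))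
    * (∫ v : Vec d, Real.exp (-(1 / 4) * ‖v‖ ^ 2)) + 1)
    / (∫ v : Vec d, Real.exp (-(1 / 2) * ‖v‖ ^ 2)), fun c hc => ?_⟩
  have hrate2 : Tendsto (fun n => 2 * B * rateM r n) atTop (𝓝 0) := by
    simpa using (tendsto_rateM hr).const_mul (2 * B)
  have hsq : Tendsto (fun n : ℕ => √(n : ℝ) * δ) atTop atTop :=
    (Real.tendsto_sqrt_atTop.comp tendsto_natCast_atTop_atTop).atTop_mul_const hδ0
  have hκ : 0 < ρ θ₀ * |(LinearMap.det (sqrtMap I))⁻¹| :=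
    mul_pos hρ₀ (abs_pos.2 (inv_ne_zero (det_sqrtMap_ne_zero hI)))
  filter_upwards [eventually_gt_atTop 0, hsq.eventually_ge_atTop (2 * B), hsq.eventually_ge_atTop 2,
    eventually_exp_le d hc hκ,
    hrate2.eventually (gt_mem_nhds (one_pos (α := ℝ))),
    hrate2.eventually (gt_mem_nhds (by positivity : 0 < lam / 16))]
    with n hn hn1 hn2 hexp hm1 hm2 x θh h hmax hm hfar ξ
  exact abs_posteriorProfile_sub_le hI hΘ hρ hρ₀ hρi hρ1' hB (by positivity) hlam hpd hδ0
    ((Metric.ball_subset_ball hδleb).trans hb) hlip' hn hm1.le (by linarith) hn1 hn2 hexp h hmax hm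
    hfar ξ

end Laplace


/-! ### Positivity and decay of the profile likelihood -/

section Positivity

variable {d : ℕ} {𝒳 E Ω : Type*} [MeasurableSpace 𝒳] [MeasurableSpace Ω] {Pr : Measure Ω}
  {M : Model d 𝒳 E} {θ₀ : Vec d} {η₀ : E} {X : ℕ → Ω → 𝒳} {ηhat : ℕ → Ω → Vec d → E}

theorem Model.ae_lik_pos (hθ₀ : θ₀ ∈ M.Θ) (hη₀ : η₀ ∈ M.H) :
    ∀ᵐ x ∂(M.law θ₀ η₀), 0 < M.lik θ₀ η₀ x := by
  rw [Model.law, ae_withDensity_iff (M.lik_measurable θ₀ hθ₀ η₀ hη₀).ennreal_ofReal]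
  refine Eventually.of_forall fun x hx => ?_
  by_contra h
  exact hx (ENNReal.ofReal_eq_zero.2 (not_lt.1 h))

/-- The true density is almost surely positive at the observations, and the maximal profile
likelihood is at least the likelihood at the truth. -/
theorem ae_profLik_pos (hXm : ∀ k, Measurable (X k))
    (hXlaw : ∀ k, Measure.map (X k) Pr = M.law θ₀ η₀) (hθ₀ : θ₀ ∈ M.Θ) (hη₀ : η₀ ∈ M.H)
    (hηhat_max : ∀ n, ∀ᵐ ω ∂Pr, ∀ θ ∈ M.Θ,
      IsMaxOn (fun η => M.likn n (fun k => X k ω) θ η) M.H (ηhat n ω θ))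
    {θhat : ℕ → Ω → Vec d}
    (hθhat_max : ∀ n, ∀ᵐ ω ∂Pr,
      IsMaxOn (fun θ => M.profLik n (fun k => X k ω) θ) M.Θ (θhat n ω)) (n : ℕ) :
    ∀ᵐ ω ∂Pr, 0 < M.profLik n (fun k => X k ω) (θhat n ω) := by
  filter_upwards [ae_comp_of_ae hXm hXlaw (Model.ae_lik_pos hθ₀ hη₀), hηhat_max n, hθhat_max n]
    with ω h1 h2 h3
  calc 0 < M.likn n (fun k => X k ω) θ₀ η₀ := Finset.prod_pos fun i _ => h1 i
    _ ≤ M.profLik n (fun k => X k ω) θ₀ := Model.likn_le_profLik (h2 θ₀ hθ₀) hη₀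
    _ ≤ _ := h3 hθ₀

/-- Failure of the gap condition means either zero profile likelihood or a log-likelihood deficit
larger than n c. -/
theorem profLik_le_of_gap {n : ℕ} {x : ℕ → 𝒳} {θ θh : Vec d} {c : ℝ} (hn : 0 < n)
    (hθ : θ ∈ M.Θ) (hpos : 0 < M.profLik n x θh) (hle : M.profLik n x θ ≤ M.profLik n x θh)
    (h : ¬ (0 < M.profLik n x θ ∧
      |(n : ℝ)⁻¹ * (Real.log (M.profLik n x θ) - Real.log (M.profLik n x θh))| ≤ c)) :
    M.profLik n x θ ≤ Real.exp (-(n * c)) * M.profLik n x θh := by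
  have hn' : (0 : ℝ) < n := by exact_mod_cast hn
  rcases (Model.profLik_nonneg (n := n) (x := x) hθ).eq_or_lt with h0 | h0
  · rw [← h0]; positivity
  have hlog := Real.log_le_log h0 hle
  have h1 : c < (n : ℝ)⁻¹ * (Real.log (M.profLik n x θh) - Real.log (M.profLik n x θ)) := by
    have := not_le.1 fun hc => h ⟨h0, hc⟩
    rwa [abs_mul, abs_of_nonpos (by linarith : _ - _ ≤ (0 : ℝ)), neg_sub,
      abs_of_pos (by positivity)] at this
  rw [lt_inv_mul_iff₀ hn'] at h1
  rw [← Real.log_le_log_iff h0 (by positivity), Real.log_mul (Real.exp_pos _).ne' hpos.ne',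
    Real.log_exp]
  linarith

end Positivity

/-! ### Good samples have large probability -/

section GoodEvent

variable {d : ℕ} {𝒳 E Ω : Type*} [MeasurableSpace 𝒳] [SeminormedAddCommGroup E]
  [MeasurableSpace Ω] {Pr : Measure Ω}
  {M : Model d 𝒳 E} {sub : Vec d → Vec d → E → E} {θ₀ : Vec d} {η₀ : E} {X : ℕ → Ω → 𝒳}
  {ηhat : ℕ → Ω → Vec d → E} {F : 𝒳 → ℝ} {r δ : ℝ}

/-- Finitely many stochastic bounds, indexed by coordinates, are intersected with one common K;
those assumed along random sequences first pass through `tight_of_forall_seq`. -/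
theorem tight_goodSample [IsProbabilityMeasure Pr] [IsProbabilityMeasure (M.law θ₀ η₀)]
    (hXm : ∀ k, Measurable (X k)) (hXind : iIndepFun X Pr)
    (hXlaw : ∀ k, Measure.map (X k) Pr = M.law θ₀ η₀) (hθ₀ : θ₀ ∈ M.Θ)
    (hηhat_mem : ∀ n ω θ, ηhat n ω θ ∈ M.H)
    (hηhat_max : ∀ n, ∀ᵐ ω ∂Pr, ∀ θ ∈ M.Θ,
      IsMaxOn (fun η => M.likn n (fun k => X k ω) θ η) M.H (ηhat n ω θ))
    (hF : Integrable F (M.law θ₀ η₀))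
    (hsm : ∀ᵐ x ∂(M.law θ₀ η₀), SmoothAt M sub θ₀ η₀ δ (F x) x)
    (hscore : ∀ i, MemLp (M.ellT sub i θ₀ θ₀ η₀) 2 (M.law θ₀ η₀))
    (hrate : M.HasNuisanceRate Pr ηhat θ₀ η₀ r)
    (hB2 : M.AssumptionB2Stoch sub Pr X ηhat θ₀ η₀ r) (hδ : 0 < δ)
    (hball : Metric.ball θ₀ δ ⊆ M.Θ) {δ' : ℝ} (hδ' : δ ≤ δ')
    (hTT : ∀ i j, IsDonsker (M.law θ₀ η₀)
      ((fun p => M.ellTT sub i j p.1 p.2.1 p.2.2) '' M.nbhd θ₀ η₀ δ'))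
    (hTθ : ∀ i j, IsDonsker (M.law θ₀ η₀)
      ((fun p => M.ellTθ sub i j p.1 p.2.1 p.2.2) '' M.nbhd θ₀ η₀ δ')) :
    Tight Pr (fun K n ω => GoodSample M sub θ₀ η₀ F r δ K n (fun k => X k ω) (ηhat n ω)) := by
  have hmem : ∀ η ∈ M.H, ‖η - η₀‖ < δ → ∀ θ ∈ Metric.ball θ₀ δ,
      (θ₀, θ, η) ∈ M.nbhd θ₀ η₀ δ' := by
    intro η hη hηd θ hθ
    refine ⟨⟨hθ₀, by simpa using hδ.trans_le hδ'⟩, ⟨hball hθ, ?_⟩, hη, hηd.trans_le hδ'⟩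
    exact (mem_ball_iff_norm.1 hθ).trans_le hδ'
  have h1 : Tight Pr (fun _ n ω => (∀ k, SmoothAt M sub θ₀ η₀ δ (F (X k ω)) (X k ω)) ∧
      ∀ θ ∈ M.Θ, IsMaxOn (fun η => M.likn n (fun k => X k ω) θ η) M.H (ηhat n ω θ)) :=
    Tight.of_ae fun n => (ae_comp_of_ae hXm hXlaw hsm).and (hηhat_max n)
  have h2 := tight_empMean hXm hXlaw hF
  have h3 := Tight.forall_fintype fun i => tight_empProc hXm hXind hXlaw (hscore i)
  have h4 := Tight.forall_fintype fun i => Tight.forall_fintype fun j =>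
    (hTT i j).tight hXm hXind hXlaw
  have h5 := Tight.forall_fintype fun i => Tight.forall_fintype fun j =>
    (hTθ i j).tight hXm hXind hXlaw
  have h6 := tight_of_forall_seq (Pr := Pr) hθ₀ (fun n ω θ => ‖ηhat n ω θ - η₀‖)
    (fun n _ θ => ‖θ - θ₀‖ + (n : ℝ) ^ (-r)) (fun n ω θ => by positivity) hrate
  have h7 := Tight.forall_fintype fun i => tight_of_forall_seq (Pr := Pr) hθ₀
    (fun n ω θ => empProc (M.law θ₀ η₀) n (fun k => X k ω)
        fun x => M.ellT sub i θ₀ θ₀ (ηhat n ω θ) x - M.ellT sub i θ₀ θ₀ η₀ x)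
    (fun n _ θ => rateM r n + max ((n : ℝ) ^ (1 / 2 - r)) 1 * ‖θ - θ₀‖)
    (fun n ω θ => add_nonneg (rateM_nonneg r n) (by positivity))
    (fun θt h1 h2 => hB2 θt h1 h2 i)
  refine ((h1.and h2).and ((h3.and (h4.and h5)).and (h6.and h7))).mono fun K _ n _ ω h => ?_
  obtain ⟨⟨⟨a1, a2⟩, a3⟩, ⟨a4, a5, a6⟩, a7, a8⟩ := h
  exact ⟨a1, a3, hηhat_mem n ω, a2, a4,
    fun i j η hη hηd θ hθ => a5 i j _ ⟨_, hmem η hη hηd θ hθ, rfl⟩,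
    fun i j η hη hηd θ hθ => a6 i j _ ⟨_, hmem η hη hηd θ hθ, rfl⟩,
    fun θ hθ hθK => (le_abs_self _).trans (a7 θ hθ hθK), fun i θ hθ hθK => a8 i θ hθ hθK⟩

end GoodEvent

end ProfileSampler

/-! ### The main theorem: choice of constants and exceptional events -/

theorem theorem3 {d : ℕ} {𝒳 E Ω : Type*} [MeasurableSpace 𝒳]
    [SeminormedAddCommGroup E] [NormedSpace ℝ E]
    [MeasurableSpace Ω] (Pr : Measure Ω) [IsProbabilityMeasure Pr]
    (M : ProfileSampler.Model d 𝒳 E)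
    -- the true parameters
    (θ₀ : EuclideanSpace ℝ (Fin d)) (η₀ : E) (hη₀ : η₀ ∈ M.H)
    -- A1
    (hΘ : IsCompact M.Θ) (hθ₀ : θ₀ ∈ interior M.Θ)
    -- i.i.d. observations
    (X : ℕ → Ω → 𝒳) (hXm : ∀ k, Measurable (X k)) (hXind : iIndepFun X Pr)
    (hXlaw : ∀ k, Measure.map (X k) Pr = M.law θ₀ η₀)
    -- the maximum likelihood estimators
    (ηhat : ℕ → Ω → EuclideanSpace ℝ (Fin d) → E)
    (hηhat_mem : ∀ n ω θ, ηhat n ω θ ∈ M.H)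
    (hηhat_max : ∀ n, ∀ᵐ ω ∂Pr, ∀ θ ∈ M.Θ,
      IsMaxOn (fun η => M.likn n (fun k => X k ω) θ η) M.H (ηhat n ω θ))
    (θhat : ℕ → Ω → EuclideanSpace ℝ (Fin d))
    (hθhat_mem : ∀ n ω, θhat n ω ∈ M.Θ)
    (hθhat_max : ∀ n, ∀ᵐ ω ∂Pr,
      IsMaxOn (fun θ => M.profLik n (fun k => X k ω) θ) M.Θ (θhat n ω))
    (hpl : ∀ n, ∀ᵐ ω ∂Pr,
      AEMeasurable (fun θ => M.profLik n (fun k => X k ω) θ) (volume.restrict M.Θ))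
    -- the least favorable submodel, the efficient score and the efficient information (A2, A3)
    (sub : EuclideanSpace ℝ (Fin d) → EuclideanSpace ℝ (Fin d) → E → E)
    (hA2 : ∀ θ ∈ M.Θ, ∀ η ∈ M.H, sub θ θ η = η)
    (𝒟 : Set (ℝ → E))
    (hscore : ∀ i, MemLp (M.scoreθ θ₀ η₀ i) 2 (M.law θ₀ η₀))
    (hlf : M.IsLeastFavorable sub θ₀ η₀ 𝒟 hscore)
    (hA3 : (M.effInfo θ₀ η₀ 𝒟 hscore).PosDef)
    (hreg : M.DiffUnderIntegral sub θ₀ η₀)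
    -- the convergence rate of the nuisance parameter
    (r : ℝ) (hr : 1 / 4 < r) (hrate : M.HasNuisanceRate Pr ηhat θ₀ η₀ r)
    -- B1, B2, C1
    (hB1 : M.AssumptionB1 sub θ₀ η₀)
    (hB2 : M.AssumptionB2Stoch sub Pr X ηhat θ₀ η₀ r)
    (hB2' : M.AssumptionB2Bias sub θ₀ η₀)
    (hC1 : haveI : IsProbabilityMeasure (M.law θ₀ η₀) :=
        M.isProbabilityMeasure_law (interior_subset hθ₀) hη₀
      M.AssumptionC1 sub θ₀ η₀)
    -- identifiability
    (hident : M.Identifiable Pr X θhat θ₀)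
    -- the prior density
    (ρ : EuclideanSpace ℝ (Fin d) → ℝ) (hρm : AEMeasurable ρ (volume.restrict M.Θ))
    (hρ_nonneg : ∀ θ ∈ M.Θ, 0 ≤ ρ θ)
    (hρ_proper : ∫⁻ θ in M.Θ, ENNReal.ofReal (ρ θ) = 1)
    (hρ_pos : 0 < ρ θ₀) (hρ_smooth : ∃ ε > 0, ContDiffOn ℝ 1 ρ (Metric.ball θ₀ ε)) :
    ProfileSampler.IsBigOP Pr
      (fun n ω => ⨆ ξ : Fin d → ℝ,
        |M.posteriorProfile ρ n (fun k => X k ω)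
            {θ | ∀ i, √(n : ℝ) * (Matrix.mulVec
              (ProfileSampler.matSqrt (M.effInfo θ₀ η₀ 𝒟 hscore)) ⇑(θ - θhat n ω)) i ≤ ξ i}
          - ProfileSampler.stdNormalCdf d ξ|)
      (fun n _ => ProfileSampler.rateM r n) := by
  have hθ₀Θ : θ₀ ∈ M.Θ := interior_subset hθ₀
  have : IsProbabilityMeasure (M.law θ₀ η₀) := M.isProbabilityMeasure_law hθ₀Θ hη₀
  obtain ⟨δb, hδb, hball, hsub, F, hF, hsm⟩ := hB1.exists_smoothAt
  obtain ⟨δc, hδc, hC1⟩ := hC1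
  have hclass : ∀ δ ≤ min δb δc, 0 < δ → ∀ η ∈ M.H, ‖η - η₀‖ < δ → ∀ θ ∈ Metric.ball θ₀ δ,
      (θ₀, θ, η) ∈ M.nbhd θ₀ η₀ δc := by
    intro δ hδ hδ0 η hη hηd θ hθ
    have h1 : δ ≤ δc := hδ.trans (min_le_right _ _)
    refine ⟨⟨hθ₀Θ, by simpa using hδc⟩, ⟨hball ?_, ?_⟩, hη, hηd.trans_le h1⟩
    · exact Metric.ball_subset_ball (hδ.trans (min_le_left _ _)) hθ
    · exact (mem_ball_iff_norm.1 hθ).trans_le h1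
  set δm := min δb δc with hδm
  have hδm0 : 0 < δm := lt_min hδb hδc
  have hballm : Metric.ball θ₀ δm ⊆ M.Θ :=
    (Metric.ball_subset_ball (min_le_left _ _)).trans hball
  have hsubm : ∀ δ ≤ δm, ∀ t ∈ Metric.ball θ₀ δ, ∀ θ ∈ Metric.ball θ₀ δ, ∀ η ∈ M.H,
      ‖η - η₀‖ < δ → sub t θ η ∈ M.H := by
    intro δ hδ t ht θ hθ η hη hηd
    have h1 : δ ≤ δb := hδ.trans (min_le_left _ _)
    exact hsub t (Metric.ball_subset_ball h1 ht) θ (Metric.ball_subset_ball h1 hθ) η hη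
      (hηd.trans_le h1)
  have hsmm : ∀ᵐ x ∂(M.law θ₀ η₀), ∀ δ' ≤ δm, ProfileSampler.SmoothAt M sub θ₀ η₀ δ' (F x) x :=
    hsm.mono fun x hx δ' hδ' => hx δ' (hδ'.trans (min_le_left _ _))
  have hTTi : ∀ η ∈ M.H, ‖η - η₀‖ < δm → ∀ θ ∈ Metric.ball θ₀ δm, ∀ i j,
      Integrable (M.ellTT sub i j θ₀ θ η) (M.law θ₀ η₀) := fun η hη hηd θ hθ i j =>
    ((hC1 i j).1.1 _ ⟨_, hclass δm le_rfl hδm0 η hη hηd θ hθ, rfl⟩).integrable one_le_two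
  have hTθi : ∀ η ∈ M.H, ‖η - η₀‖ < δm → ∀ θ ∈ Metric.ball θ₀ δm, ∀ i j,
      Integrable (M.ellTθ sub i j θ₀ θ η) (M.law θ₀ η₀) := fun η hη hηd θ hθ i j =>
    ((hC1 i j).2.1.1 _ ⟨_, hclass δm le_rfl hδm0 η hη hηd θ hθ, rfl⟩).integrable one_le_two
  have hinfo := fun i j => ProfileSampler.Model.information_identities hη₀ hA2 hlf hreg hδm0 hsmm
    i j (hTTi η₀ hη₀ (by simpa using hδm0) θ₀ (Metric.mem_ball_self hδm0) i j)
    (hTθi η₀ hη₀ (by simpa using hδm0) θ₀ (Metric.mem_ball_self hδm0) i j)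
  set I := M.effInfo θ₀ η₀ 𝒟 hscore with hI
  have hIsymm : ∀ i j, I i j = I j i := fun i j => by
    have := hA3.isHermitian.apply j i
    simpa using this
  obtain ⟨lam, hlam, hpd⟩ := ProfileSampler.exists_le_quadForm hA3
  obtain ⟨C₀, hC₀, δ, hδ0, hδm', hpop⟩ := ProfileSampler.Model.exists_populationBound hδm0 hballm
    (hsubm δm le_rfl) hF hsmm hTTi hTθi (fun i j => (hinfo i j).1) (fun i j => (hinfo i j).2) hB2'
  have hballδ : Metric.ball θ₀ δ ⊆ M.Θ := (Metric.ball_subset_ball hδm').trans hballm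
  have htight := ProfileSampler.tight_goodSample hXm hXind hXlaw hθ₀Θ hηhat_mem hηhat_max hF
    (hsmm.mono fun x hx => hx δ hδm') (ProfileSampler.Model.memLp_ellT hlf) hrate hB2 hδ0 hballδ
    (hδm'.trans (min_le_right _ _)) (fun i j => (hC1 i j).1) (fun i j => (hC1 i j).2.1)
  have hposhat := ProfileSampler.ae_profLik_pos hXm hXlaw hθ₀Θ hη₀ hηhat_max hθhat_max
  have hD0 : ∀ e : ℝ, 0 < e → ∀ n, Pr {ω | ¬ (0 < M.profLik n (fun k => X k ω) (θhat n ω) ∧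
      |(n : ℝ)⁻¹ * (Real.log (M.profLik n (fun k => X k ω) (θhat n ω))
        - Real.log (M.profLik n (fun k => X k ω) (θhat n ω)))| ≤ e)} = 0 := by
    intro e he n
    exact (hposhat n).mono fun ω hω => ⟨hω, by simpa using he.le⟩
  -- The maximizer has gap zero relative to itself, so identifiability yields its consistency.
  have hcons : TendstoInMeasure Pr θhat atTop (fun _ => θ₀) :=
    hident θhat hθhat_mem fun e he => by simp only [hD0 e he]; exact tendsto_const_nhds
  intro ε hε
  have hε3 : 0 < ε / 3 := ENNReal.div_pos hε.ne' (by simp)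
  obtain ⟨K₀, hK₀⟩ := htight (ε / 3) hε3
  -- The maximum with 1 makes the constant positive. The order of choices matters: K fixes B and δ₁,
  -- these fix δ₂ and the final C, and only then does identifiability at radius δ₂ provide the gap
  -- c.
  have hgood := hK₀ (max K₀ 1) (le_max_left _ _)
  obtain ⟨B, hB, δ₁, hδ₁, ε₁, hε₁, hexpand⟩ := ProfileSampler.exists_recentredExpansion
    (F := F) (r := r) (K := max K₀ 1) hpop hη₀ hA2 (hsubm δ hδm') hballδ hδ0
    (lt_max_of_lt_right one_pos) hC₀ hIsymm hlam hpd
  obtain ⟨δ₂, hδ₂, hδ₂₁, C, hC⟩ := ProfileSampler.exists_posteriorProfile_bound hr hA3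
    hΘ.measurableSet hθ₀ hρm hρ_nonneg hρ_pos hρ_proper hρ_smooth hB hδ₁
  obtain ⟨c, hc, hgap⟩ := ProfileSampler.exists_gap_of_forall_seq (Pr := Pr) (Θ := M.Θ) (θ₀ := θ₀)
    (fun e n ω θ => 0 < M.profLik n (fun k => X k ω) θ ∧
      |(n : ℝ)⁻¹ * (Real.log (M.profLik n (fun k => X k ω) θ)
        - Real.log (M.profLik n (fun k => X k ω) (θhat n ω)))| ≤ e)
    θhat hθhat_mem hD0 (fun e e' he n ω θ h => ⟨h.1, h.2.trans he⟩) hident hδ₂ hε3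
  have hclose := (hcons (ENNReal.ofReal δ₁) (by simpa using hδ₁)).eventually (ge_mem_nhds hε3)
  refine ⟨C, ?_⟩
  filter_upwards [hgood, hgap, hclose, hC c hc, eventually_gt_atTop 0,
    (ProfileSampler.tendsto_rateM hr).eventually (ge_mem_nhds hε₁)] with n h1 h2 h3 h4 hn h5
  -- Three exceptional events share ε: a bad sample, a distant near-maximizer of pl_n, and θ̂_n not
  -- within δ₁ of θ₀. Outside them the deterministic bound holds for all ξ, up to null sets.
  rw [← ENNReal.add_thirds ε]
  refine le_trans ?_ (add_le_add (add_le_add h1 h2) h3)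
  refine le_trans ?_ ((measure_union_le _ _).trans (add_le_add (measure_union_le _ _) le_rfl))
  refine measure_mono_ae ?_
  filter_upwards [hθhat_max n, hpl n, hposhat n] with ω hmax hm hpos hbad
  by_contra hout
  obtain ⟨hout, ho3⟩ := not_or.1 hout
  obtain ⟨ho1, ho2⟩ := not_or.1 hout
  have hg := not_not.1 ho1
  have hdist : ‖θhat n ω - θ₀‖ < δ₁ := by
    have h6 : ¬ ENNReal.ofReal δ₁ ≤ edist (θhat n ω) θ₀ := ho3
    rwa [edist_dist, dist_eq_norm, not_le, ENNReal.ofReal_lt_ofReal_iff hδ₁] at h6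
  have hexp := (hexpand n hn h5 _ _ _ hg (hθhat_mem n ω) hdist hmax).mono hδ₂₁
  have hbound := h4 _ _ hexp hmax hm fun θ hθ hθδ =>
    ProfileSampler.profLik_le_of_gap hn hθ hpos (hmax hθ) fun hD => ho2 ⟨θ, hθ, hθδ, hD⟩
  refine absurd hbad (not_lt.2 ?_)
  rw [abs_of_nonneg (Real.iSup_nonneg fun ξ => abs_nonneg _)]
  exact ciSup_le hbound
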